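/- Let $q\ge 2$ be an integer, let $\mathbb F\in\{\mathbb R,\mathbb C,\mathbb H\}$ with $d:=\dim_{\mathbb R}\mathbb F\in\{1,2,4\}$, and let $G:=GL(q,\mathbb F)$ and $K:=U(q,\mathbb F)$. For $g\in G$ let $\sigma_{sing}(g)=(x_1\ge\dots\ge x_q>0)$ be the ordered vector of singular values of $g$ (the square roots of the eigenvalues of $g^*g$, counted with multiplicity), and let $\ln\sigma_{sing}(g):=(\ln x_1,\dots,\ln x_q)\in C_q^A:=\{t\in\mathbb R^q:\ t_1\ge\dots\ge t_q\}$. For a positive definite Hermitian $q\times q$ matrix $A=(a_{ij})$ over $\mathbb F$ let $\Delta_r(A):=\det\bigl((a_{ij})_{1\le i,j\le r}\bigr)>0$ (with the Dieudonné determinant if $\mathbb F=\mathbb H$, i.e. the square root of the determinant of the matrix considered as a complex matrix), and for $\mu\in\mathbb C^q$ let $$\Delta_\mu(A):=\Delta_1(A)^{\mu_1-\mu_2}\cdots\Delta_{q-1}(A)^{\mu_{q-1}-\mu_q}\,\Delta_q(A)^{\mu_q}.$$ Put $\rho_l:=\frac d2(q+1-2l)$ for $l=1,\dots,q$, $e^{2\underline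 t}:=\mathrm{diag}(e^{2t_1},\dots,e^{2t_q})$, and let $$\varphi_\lambda(t):=\int_K\Delta_{(i\lambda-\rho)/2}\bigl(u^{-1}e^{2\underline t}u\bigr)\,du\qquad(t\in\mathbb R^q,\ \lambda\in\mathbb C^q)$$ be the spherical functions, where $du$ is the normalized Haar measure of $K$. The moment function of first order is the map $m_{\mathbf 1}:\mathbb R^q\to\mathbb R^q$ with components $$m_{\mathbf 1}(t)_j:=\frac{\partial}{\partial\lambda_j}\varphi_{-i\rho-i\lambda}(t)\Big|_{\lambda=0}\qquad(j=1,\dots,q).$$ Let $(X_k)_{k\ge1}$ be i.i.d. $G$-valued random variables whose common distribution $\nu_G$ is $K$-biinvariant (i.e. invariant under $g\mapsto ugv$ for all $u,v\in K$), let $S_0:=I_q$ and $S_k:=X_1X_2\cdots X_k$, and let $\nu$ be the image of $\nu_G$ under $\ln\sigma_{sing}$, a probability measure on $C_q^A$. (1) If $\nu$ admits first moments, i.e. $\int|t_j|\,d\nu(t)<\infty$ for $j=1,\dots,q$, then $m_{\mathbf 1}$ is $\nu$-integrable, and with $m_{\mathbf 1}(\nu):=\int m_{\mathbf 1}(t)\,d\nu(t)\in\mathbb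 R^q$, $$\frac{\ln\sigma_{sing}(S_k)}{k}\longrightarrow m_{\mathbf 1}(\nu)\qquad\text{almost surely as }k\to\infty.$$ (2) If $\nu$ admits second moments, i.e. $\int t_j^2\,d\nu(t)<\infty$ for $j=1,\dots,q$, then for every $\epsilon>1/2$, $$\frac1{k^\epsilon}\bigl(\ln\sigma_{sing}(S_k)-k\cdot m_{\mathbf 1}(\nu)\bigr)\longrightarrow0\qquad\text{almost surely as }k\to\infty.$$ -/

import Mathlib

open MeasureTheory ProbabilityTheory Filter Topology
open scoped Quaternion

noncomputable section

namespace BiinvariantWalk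

/-- `𝔽` is one of the fields `ℝ`, `ℂ` or the skew field `ℍ`, with its usual conjugation `star`
(and, since it is finite dimensional over `ℝ`, with its usual topology). -/
class IsRealComplexOrQuaternion (𝔽 : Type*) [NormedDivisionRing 𝔽] [NormedAlgebra ℝ 𝔽]
    [StarRing 𝔽] : Prop where
  equiv : Nonempty (𝔽 ≃⋆ₐ[ℝ] ℝ) ∨ Nonempty (𝔽 ≃⋆ₐ[ℝ] ℂ) ∨ Nonempty (𝔽 ≃⋆ₐ[ℝ] ℍ[ℝ])

instance : IsRealComplexOrQuaternion ℝ := ⟨Or.inl ⟨StarAlgEquiv.refl ℝ ℝ⟩⟩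
instance : IsRealComplexOrQuaternion ℂ := ⟨Or.inr (Or.inl ⟨StarAlgEquiv.refl ℝ ℂ⟩)⟩
instance : IsRealComplexOrQuaternion ℍ[ℝ] := ⟨Or.inr (Or.inr ⟨StarAlgEquiv.refl ℝ ℍ[ℝ]⟩)⟩

/-- Matrices carry the Borel sigma-algebra of their entrywise topology. The group of invertible
matrices and the group of unitary matrices inherit their sigma-algebras from it. -/
instance instMeasurableSpaceMatrix {m n R : Type*} [TopologicalSpace R] :
    MeasurableSpace (Matrix m n R) := borel _

instance instBorelSpaceMatrix {m n R : Type*} [TopologicalSpace R] :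
    BorelSpace (Matrix m n R) := ⟨rfl⟩

section Topology

variable {𝔽 : Type*} [NormedDivisionRing 𝔽] [NormedAlgebra ℝ 𝔽] [StarRing 𝔽]

/-- Each of the three cases yields a linear homeomorphism onto a finite-dimensional C*-algebra. -/
theorem exists_model [h : IsRealComplexOrQuaternion 𝔽] :
    FiniteDimensional ℝ 𝔽 ∧ ContinuousStar 𝔽 ∧
      ∃ (N : 𝔽 → ℝ) (C : ℝ), (∀ a, ‖a‖ ≤ C * N a) ∧ (∀ a, 0 ≤ N a) ∧
        ∃ T : 𝔽 →+ ℝ, T 1 = 1 ∧ ∀ a, T (star a * a) = N a ^ 2 := by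
  rcases h.equiv with ⟨⟨e⟩⟩ | ⟨⟨e⟩⟩ | ⟨⟨e⟩⟩
  · have fd : FiniteDimensional ℝ 𝔽 := e.symm.toAlgEquiv.toLinearEquiv.finiteDimensional
    have c1 : Continuous e := e.toAlgEquiv.toLinearMap.continuous_of_finiteDimensional
    have c2 : Continuous e.symm := e.symm.toAlgEquiv.toLinearMap.continuous_of_finiteDimensional
    let L : ℝ →L[ℝ] 𝔽 := ⟨e.symm.toAlgEquiv.toLinearMap, c2⟩
    refine ⟨fd, ⟨?_⟩, fun a => ‖e a‖, ‖L‖, fun a => ?_, fun a => norm_nonneg _,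
      (e : 𝔽 →+ ℝ), by simp, fun a => ?_⟩
    · have : (star : 𝔽 → 𝔽) = fun a => e.symm (star (e a)) := by
        ext a; rw [← map_star, StarAlgEquiv.symm_apply_apply]
      rw [this]; fun_prop
    · have := L.le_opNorm (e a)
      simpa [L] using this
    · simp [map_star, sq]
  · have fd : FiniteDimensional ℝ 𝔽 := e.symm.toAlgEquiv.toLinearEquiv.finiteDimensional
    have c1 : Continuous e := e.toAlgEquiv.toLinearMap.continuous_of_finiteDimensional
    have c2 : Continuous e.symm := e.symm.toAlgEquiv.toLinearMap.continuous_of_finiteDimensional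
    let L : ℂ →L[ℝ] 𝔽 := ⟨e.symm.toAlgEquiv.toLinearMap, c2⟩
    refine ⟨fd, ⟨?_⟩, fun a => ‖e a‖, ‖L‖, fun a => ?_, fun a => norm_nonneg _,
      Complex.reAddGroupHom.comp (e : 𝔽 →+ ℂ), by simp, fun a => ?_⟩
    · have : (star : 𝔽 → 𝔽) = fun a => e.symm (star (e a)) := by
        ext a; rw [← map_star, StarAlgEquiv.symm_apply_apply]
      rw [this]; fun_prop
    · have := L.le_opNorm (e a)
      simpa [L] using this
    · rw [Complex.sq_norm, Complex.normSq_apply]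
      simp [map_star]
  · have fd : FiniteDimensional ℝ 𝔽 := e.symm.toAlgEquiv.toLinearEquiv.finiteDimensional
    have c1 : Continuous e := e.toAlgEquiv.toLinearMap.continuous_of_finiteDimensional
    have c2 : Continuous e.symm := e.symm.toAlgEquiv.toLinearMap.continuous_of_finiteDimensional
    let L : ℍ[ℝ] →L[ℝ] 𝔽 := ⟨e.symm.toAlgEquiv.toLinearMap, c2⟩
    refine ⟨fd, ⟨?_⟩, fun a => ‖e a‖, ‖L‖, fun a => ?_, fun a => norm_nonneg _,
      ⟨⟨fun a => (e a).re, by simp⟩, by simp⟩, by simp, fun a => ?_⟩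
    · have : (star : 𝔽 → 𝔽) = fun a => e.symm (star (e a)) := by
        ext a; rw [← map_star, StarAlgEquiv.symm_apply_apply]
      rw [this]; fun_prop
    · have := L.le_opNorm (e a)
      simpa [L] using this
    · have := Quaternion.normSq_eq_norm_mul_self (e a)
      simp only [AddMonoidHom.coe_mk, ZeroHom.coe_mk, map_mul, map_star]
      rw [Quaternion.star_mul_self, this, Quaternion.re_coe, sq]

instance instContinuousStar [IsRealComplexOrQuaternion 𝔽] : ContinuousStar 𝔽 :=
  (exists_model (𝔽 := 𝔽)).2.1

instance instFiniteDimensional [IsRealComplexOrQuaternion 𝔽] : FiniteDimensional ℝ 𝔽 :=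
  (exists_model (𝔽 := 𝔽)).1

end Topology

variable (𝔽 : Type*) [NormedDivisionRing 𝔽] [NormedAlgebra ℝ 𝔽] [StarRing 𝔽] (q : ℕ)

/-- The maximal compact subgroup `K = U(q, 𝔽)` of `GL(q, 𝔽)`. -/
abbrev UnitaryGroup : Type _ := unitary (Matrix (Fin q) (Fin q) 𝔽)

instance instCompactSpaceUnitaryGroup [IsRealComplexOrQuaternion 𝔽] :
    CompactSpace (UnitaryGroup 𝔽 q) := by
  obtain ⟨fd, -, N, C, hC, hN, T, hT1, hT⟩ := exists_model (𝔽 := 𝔽)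
  have : ProperSpace 𝔽 := FiniteDimensional.proper ℝ 𝔽
  have hcpt : IsCompact (Set.univ.pi fun _ : Fin q => Set.univ.pi fun _ : Fin q =>
      Metric.closedBall (0 : 𝔽) |C|) :=
    isCompact_univ_pi fun _ => isCompact_univ_pi fun _ => isCompact_closedBall _ _
  refine isCompact_iff_compactSpace.mp
    (IsCompact.of_isClosed_subset (X := Matrix (Fin q) (Fin q) 𝔽) hcpt isClosed_unitary ?_)
  intro u hu i _ j _
  rw [mem_closedBall_zero_iff]
  have h1 : star u * u = 1 := (Unitary.mem_iff.mp hu).1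
  have h2 : ∑ k, N (u k j) ^ 2 = 1 := by
    have h3 := congrArg T (congrFun (congrFun h1 j) j)
    simpa [Matrix.mul_apply, Matrix.star_apply, map_sum, hT, hT1] using h3
  have h4 : N (u i j) ^ 2 ≤ 1 := by
    rw [← h2]
    exact Finset.single_le_sum (f := fun k => N (u k j) ^ 2) (fun k _ => sq_nonneg _)
      (Finset.mem_univ i)
  have h5 : N (u i j) ≤ 1 := by nlinarith [hN (u i j)]
  calc ‖u i j‖ ≤ C * N (u i j) := hC _
    _ ≤ |C| * N (u i j) := mul_le_mul_of_nonneg_right (le_abs_self C) (hN _)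
    _ ≤ |C| * 1 := mul_le_mul_of_nonneg_left h5 (abs_nonneg C)
    _ = |C| := mul_one _

/-- The normalized Haar measure `du` on `K = U(q, 𝔽)`. -/
def haarUnitary [IsRealComplexOrQuaternion 𝔽] : Measure (UnitaryGroup 𝔽 q) :=
  Measure.haarMeasure ⊤

variable {𝔽 q}

/-- The diagonal matrix over `𝔽` with the real entries `x 0, …, x (q - 1)`. -/
def realDiag (x : Fin q → ℝ) : Matrix (Fin q) (Fin q) 𝔽 :=
  Matrix.diagonal fun i => algebraMap ℝ 𝔽 (x i)

/-- `x` lists the eigenvalues of the Hermitian matrix `A` over `𝔽` with multiplicities, in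
decreasing order: `A = u · diag(x) · u⁻¹` for some `u ∈ U(q, 𝔽)`. -/
def IsOrderedSpectrum (A : Matrix (Fin q) (Fin q) 𝔽) (x : Fin q → ℝ) : Prop :=
  Antitone x ∧ ∃ u : UnitaryGroup 𝔽 q,
    A = (u : Matrix (Fin q) (Fin q) 𝔽) * realDiag x * star (u : Matrix (Fin q) (Fin q) 𝔽)

open Classical in
/-- The ordered eigenvalues of a Hermitian matrix over `𝔽`; they exist by the spectral theorem. -/
def orderedSpectrum (A : Matrix (Fin q) (Fin q) 𝔽) : Fin q → ℝ :=
  if h : ∃ x, IsOrderedSpectrum A x then h.choose else 0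

/-- The singular spectrum `σ_sing(g)`: the square roots of the eigenvalues of `g* g`, ordered by
size. -/
def singularSpectrum (g : GL (Fin q) 𝔽) (j : Fin q) : ℝ :=
  Real.sqrt (orderedSpectrum
    (star (g : Matrix (Fin q) (Fin q) 𝔽) * (g : Matrix (Fin q) (Fin q) 𝔽)) j)

/-- `ln σ_sing(g)`, an element of the Weyl chamber of type `A`. -/
def logSingularSpectrum (g : GL (Fin q) 𝔽) (j : Fin q) : ℝ :=
  Real.log (singularSpectrum g j)

/-- The determinant of a positive definite Hermitian matrix `A` over `𝔽`, namely the `d`-th root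
of the determinant of the real linear map `v ↦ A v` on `𝔽 ^ r`, where `d = dim_ℝ 𝔽 ∈ {1, 2, 4}`.
For `𝔽 = ℝ, ℂ` this is the usual determinant of such a matrix, as the real determinant of a
complex matrix is the squared modulus of its determinant. For `𝔽 = ℍ` it is the Dieudonné
determinant, the square root of the determinant of `A` considered as a complex matrix. -/
def posDet {r : ℕ} (A : Matrix (Fin r) (Fin r) 𝔽) : ℝ :=
  (LinearMap.det ((LinearMap.pi fun i => ∑ j, LinearMap.mulLeft ℝ (A i j) ∘ₗ LinearMap.proj j) :
    (Fin r → 𝔽) →ₗ[ℝ] (Fin r → 𝔽))) ^ (1 / (Module.finrank ℝ 𝔽 : ℝ))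

/-- The principal minor of order `r + 1`, i.e. `Δ_{r+1}(A) = det ((a_ij)_{i, j ≤ r + 1})`. -/
def minor (A : Matrix (Fin q) (Fin q) 𝔽) (r : Fin q) : ℝ :=
  posDet (A.submatrix (Fin.castLE r.isLt : Fin (r + 1) → Fin q) (Fin.castLE r.isLt))

/-- The power function
`Δ_μ(A) = Δ_1(A)^(μ_1 - μ_2) ⋯ Δ_{q-1}(A)^(μ_{q-1} - μ_q) · Δ_q(A)^(μ_q)`. -/
def powerFunction (μ : Fin q → ℂ) (A : Matrix (Fin q) (Fin q) 𝔽) : ℂ :=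
  ∏ r : Fin q,
    (minor A r : ℂ) ^ (μ r - if h : (r : ℕ) + 1 < q then μ ⟨(r : ℕ) + 1, h⟩ else 0)

variable (𝔽) in
/-- The half sum of positive roots, `ρ_l = (d / 2) (q + 1 - 2 l)` for `l = 1, …, q`; here the
index `l : Fin q` starts from `0`. -/
def halfSum (l : Fin q) : ℝ :=
  (Module.finrank ℝ 𝔽 : ℝ) / 2 * ((q : ℝ) + 1 - 2 * ((l : ℕ) + 1 : ℝ))

variable (𝔽) in
/-- The spherical function of `(GL(q, 𝔽), U(q, 𝔽))` with spectral parameter `μ`,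
`φ_μ(t) = ∫_K Δ_{(iμ - ρ)/2}(u⁻¹ e^{2t} u) du`. -/
def spherical [IsRealComplexOrQuaternion 𝔽] (μ : Fin q → ℂ) (t : Fin q → ℝ) : ℂ :=
  ∫ u : UnitaryGroup 𝔽 q,
    powerFunction (fun l => (Complex.I * μ l - (halfSum 𝔽 l : ℂ)) / 2)
      (star (u : Matrix (Fin q) (Fin q) 𝔽) * realDiag (fun i => Real.exp (2 * t i)) *
        (u : Matrix (Fin q) (Fin q) 𝔽)) ∂(haarUnitary 𝔽 q)

variable (𝔽) in
/-- The vector-valued moment function of first order: its `j`-th entry is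
`∂/∂μ_j φ_{-iρ - iμ}(t)` at `μ = 0`. This is real, as `φ_{-iρ - iμ}(t)` is real for real `μ`. -/
def momentFunction [IsRealComplexOrQuaternion 𝔽] (t : Fin q → ℝ) (j : Fin q) : ℝ :=
  (deriv (fun s : ℝ => spherical 𝔽 (fun l => -Complex.I * (halfSum 𝔽 l : ℂ)
    - Complex.I * (Pi.single j s : Fin q → ℝ) l) t) 0).re

variable (𝔽) in
/-- The dispersion `m_1(ν) = ∫ m_1(t) dν(t)`. -/
def dispersion [IsRealComplexOrQuaternion 𝔽] (ν : Measure (Fin q → ℝ)) (j : Fin q) : ℝ :=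
  ∫ t, momentFunction 𝔽 t j ∂ν

/-- All usual first moments `∫ t_j dν(t)` exist. -/
def AdmitsFirstMoments (ν : Measure (Fin q → ℝ)) : Prop :=
  ∀ j, Integrable (fun t : Fin q → ℝ => t j) ν

/-- All usual second moments `∫ t_j ^ 2 dν(t)` exist. -/
def AdmitsSecondMoments (ν : Measure (Fin q → ℝ)) : Prop :=
  ∀ j, Integrable (fun t : Fin q → ℝ => t j ^ 2) ν

/-- A measure on `GL(q, 𝔽)` that is invariant under `g ↦ u g v` for all `u, v ∈ U(q, 𝔽)`. -/
def IsBiinvariant (νG : Measure (GL (Fin q) 𝔽)) : Prop :=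
  ∀ u v : UnitaryGroup 𝔽 q,
    νG.map (fun g => Unitary.toUnits u * g * Unitary.toUnits v) = νG

/-- The image of a measure on `G = GL(q, 𝔽)` under the canonical projection `ln σ_sing` of `G`
onto `G // K`, identified with the Weyl chamber in `ℝ ^ q`. -/
def radialPart (νG : Measure (GL (Fin q) 𝔽)) : Measure (Fin q → ℝ) :=
  νG.map logSingularSpectrum

/-- The random walk `S_0 = 1`, `S_{k+1} = S_k X_{k+1}`; here `X k` is the `(k+1)`-st increment. -/
def walk {Ω : Type*} (X : ℕ → Ω → GL (Fin q) 𝔽) : ℕ → Ω → GL (Fin q) 𝔽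
  | 0, _ => 1
  | k + 1, ω => walk X k ω * X k ω

end BiinvariantWalk

end

open BiinvariantWalk

set_option linter.unusedSectionVars false

noncomputable section

namespace BiinvariantWalk

open Matrix

/-! ### Conjugation and real structure of the scalars -/

section Scalars

variable {𝔽 : Type*} [NormedDivisionRing 𝔽] [NormedAlgebra ℝ 𝔽] [StarRing 𝔽]

/-! Put `L_r(g) = ½ log Δ_{r+1}(g* g)` (`logMinor`). Leading minors are multiplicative for upper
triangular right factors, so a QR factorization `s = u b` yields the cocycle identity `L_r(x s) =
L_r(x u) + L_r(s)`, with `u` depending on `s` alone (`exists_unitary_logMinor_mul`). Apply it to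
`S_k* = X_k* ⋯ X_1*`. The newest factor stands on the left, the unitary `u` comes from the past, and
left invariance of the law gives `X* u` the law of `X*` for each fixed `u`. Hence the increments of
`L_r(S_k*)` are identically distributed and independent of the past
(`map_eq_and_indep_logMinorIncr`), so scalar limit theorems apply: the strong law under first
moments, and `L²` martingale convergence with Kronecker's lemma under second moments.

The drift is the right one because differentiating the spherical integral at the trivial parameter
gives `m_1(t)_j = ∫_K (L_j - L_{j-1})(e^t u) du` (`momentFunction_eq`), while averaging over `K`
turns the mean of `L_r(X*)` into the integral of `∫_K L_r(e^t u) du` against the radial part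
(`integral_logMinor_star`).

It remains to compare `L_r(S_k*)` with the sum of the `r + 1` largest logarithmic singular values.
For ordered `t` the defect of `L_r(e^t u)` from that sum lies between `0` and `-(1/d) log |det|` of
the leading block of `u`. This bound is free of `t`, and its square is Haar integrable because a
small negative power of the block determinant is (`lintegral_blockSing_lt_top`). Left invariance of
the law of `S_k` transfers this to a uniform second-moment bound on the defect, without any moment
hypothesis, and Borel–Cantelli-type summation makes the defect `o(k^ε)` for every `ε > 1/2`. Taking
successive differences in `r` recovers the individual singular values. -/

theorem exists_basis_of_form (B : 𝔽 → 𝔽 → ℝ) (hB : ∀ x y, B x y = B y x)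
    (hadj : ∀ a x y, B x (star a * y) = B (a * x) y) {n : ℕ} (b : Module.Basis (Fin n) ℝ 𝔽)
    (hb : ∀ x i, b.repr x i = B (b i) x) :
    ∃ b : Module.Basis (Fin (Module.finrank ℝ 𝔽)) ℝ 𝔽,
      ∀ a, Algebra.leftMulMatrix b (star a) = (Algebra.leftMulMatrix b a)ᵀ := by
  obtain rfl : Module.finrank ℝ 𝔽 = n := by
    rw [Module.finrank_eq_card_basis b, Fintype.card_fin]
  refine ⟨b, fun a => ?_⟩
  ext i j
  rw [transpose_apply, Algebra.leftMulMatrix_eq_repr_mul, Algebra.leftMulMatrix_eq_repr_mul,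
    hb, hb, hadj, hB]

variable (𝔽) in
-- The inner product of the model satisfies `⟨x, a* y⟩ = ⟨a x, y⟩`, so conjugation becomes
-- transposition in an orthonormal basis.
theorem exists_basis_leftMulMatrix_star [h : IsRealComplexOrQuaternion 𝔽] :
    ∃ b : Module.Basis (Fin (Module.finrank ℝ 𝔽)) ℝ 𝔽,
      ∀ a, Algebra.leftMulMatrix b (star a) = (Algebra.leftMulMatrix b a)ᵀ := by
  rcases h.equiv with ⟨⟨e⟩⟩ | ⟨⟨e⟩⟩ | ⟨⟨e⟩⟩
  · refine exists_basis_of_form (fun x y => inner ℝ (e x) (e y)) (fun x y => real_inner_comm _ _)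
      (fun a x y => ?_)
      ((stdOrthonormalBasis ℝ ℝ).toBasis.map e.symm.toAlgEquiv.toLinearEquiv) fun x i => ?_
    · simp only [map_mul, map_star]; simp; ring
    · simp only [Module.Basis.map_repr, Module.Basis.map_apply, LinearEquiv.trans_apply]
      simp [OrthonormalBasis.repr_apply_apply]
  · refine exists_basis_of_form (fun x y => inner ℝ (e x) (e y)) (fun x y => real_inner_comm _ _)
      (fun a x y => ?_)
      ((stdOrthonormalBasis ℝ ℂ).toBasis.map e.symm.toAlgEquiv.toLinearEquiv) fun x i => ?_
    · simp only [map_mul, map_star]; simp [Complex.inner]; ring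
    · simp only [Module.Basis.map_repr, Module.Basis.map_apply, LinearEquiv.trans_apply]
      simp only [OrthonormalBasis.coe_toBasis_repr_apply, OrthonormalBasis.repr_apply_apply]
      simp
  · refine exists_basis_of_form (fun x y => inner ℝ (e x) (e y)) (fun x y => real_inner_comm _ _)
      (fun a x y => ?_)
      ((stdOrthonormalBasis ℝ ℍ[ℝ]).toBasis.map e.symm.toAlgEquiv.toLinearEquiv) fun x i => ?_
    · simp only [map_mul, map_star]; simp [Quaternion.inner_def]; ring
    · simp only [Module.Basis.map_repr, Module.Basis.map_apply, LinearEquiv.trans_apply]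
      simp only [OrthonormalBasis.coe_toBasis_repr_apply, OrthonormalBasis.repr_apply_apply]
      simp

variable (𝔽) in
theorem star_algebraMap_real [h : IsRealComplexOrQuaternion 𝔽] (r : ℝ) :
    star (algebraMap ℝ 𝔽 r) = algebraMap ℝ 𝔽 r := by
  rcases h.equiv with ⟨⟨e⟩⟩ | ⟨⟨e⟩⟩ | ⟨⟨e⟩⟩
  · have : e (algebraMap ℝ 𝔽 r) = algebraMap ℝ _ r := e.toAlgEquiv.commutes r
    apply EquivLike.injective e
    rw [map_star, this]; simp
  · have : e (algebraMap ℝ 𝔽 r) = algebraMap ℝ _ r := e.toAlgEquiv.commutes r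
    apply EquivLike.injective e
    rw [map_star, this]; simp
  · have : e (algebraMap ℝ 𝔽 r) = algebraMap ℝ _ r := e.toAlgEquiv.commutes r
    apply EquivLike.injective e
    rw [map_star, this]; simp [Quaternion.algebraMap_def]

theorem exists_star_mul_self_eq [h : IsRealComplexOrQuaternion 𝔽] (a : 𝔽) :
    ∃ c : ℝ, 0 ≤ c ∧ star a * a = algebraMap ℝ 𝔽 c := by
  rcases h.equiv with ⟨⟨e⟩⟩ | ⟨⟨e⟩⟩ | ⟨⟨e⟩⟩
  · have : e (algebraMap ℝ 𝔽 (e a * e a)) = algebraMap ℝ _ (e a * e a) := e.toAlgEquiv.commutes _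
    refine ⟨e a * e a, mul_self_nonneg _, EquivLike.injective e ?_⟩
    rw [this, map_mul, map_star]; simp
  · have : e (algebraMap ℝ 𝔽 (Complex.normSq (e a))) = algebraMap ℝ _ (Complex.normSq (e a)) :=
      e.toAlgEquiv.commutes _
    refine ⟨Complex.normSq (e a), Complex.normSq_nonneg _, EquivLike.injective e ?_⟩
    rw [this, map_mul, map_star]
    simpa using Complex.normSq_eq_conj_mul_self.symm
  · have : e (algebraMap ℝ 𝔽 (Quaternion.normSq (e a)))
        = algebraMap ℝ _ (Quaternion.normSq (e a)) := e.toAlgEquiv.commutes _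
    refine ⟨Quaternion.normSq (e a), Quaternion.normSq_nonneg, EquivLike.injective e ?_⟩
    rw [this, map_mul, map_star, Quaternion.star_mul_self, Quaternion.algebraMap_def]

end Scalars

/-! ### Determinant inequalities for real Gram matrices -/

section RealDet
variable {m n : Type*} [Fintype m] [DecidableEq m] [Fintype n] [DecidableEq n]

theorem one_le_det_one_add {P : Matrix n n ℝ} (hP : P.PosSemidef) : 1 ≤ (1 + P).det := by
  have hs := hP.1.spectral_theorem
  rw [Unitary.conjStarAlgAut_apply] at hs
  set U := (hP.1.eigenvectorUnitary : Matrix n n ℝ) with hU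
  have hUU : U * star U = 1 := Unitary.coe_mul_star_self _
  have h1 : 1 + P = U * (1 + diagonal (fun i => hP.1.eigenvalues i)) * star U := by
    rw [Matrix.mul_add, Matrix.add_mul, Matrix.mul_one, hUU]
    conv_lhs => rw [hs]
    rfl
  have h2 : U.det * (star U).det = 1 := by rw [← det_mul, hUU, det_one]
  rw [h1, det_mul, det_mul, mul_right_comm, h2, one_mul, ← diagonal_one, diagonal_add,
    det_diagonal]
  calc (1 : ℝ) = ∏ _i : n, (1 : ℝ) := by simp
    _ ≤ _ := Finset.prod_le_prod (fun _ _ => zero_le_one) fun i _ => by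
      have := hP.eigenvalues_nonneg i
      linarith

open scoped MatrixOrder ComplexOrder in
-- Factor `A = Sᵀ S`; then `B = Sᵀ (1 + P) S` with `P` positive semidefinite, and `det (1 + P) ≥ 1`.
theorem det_le_det_of_posSemidef_sub {A B : Matrix n n ℝ} (hA : A.PosDef)
    (hBA : (B - A).PosSemidef) : A.det ≤ B.det := by
  obtain ⟨S, hS⟩ := CStarAlgebra.nonneg_iff_eq_star_mul_self.mp hA.posSemidef.nonneg
  have hdet : A.det ≠ 0 := hA.det_pos.ne'
  have hSd : IsUnit S.det := by
    rw [isUnit_iff_ne_zero]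
    rintro h
    apply hdet
    rw [hS, det_mul, h, mul_zero]
  have hP : ((S⁻¹)ᴴ * (B - A) * S⁻¹).PosSemidef := hBA.conjTranspose_mul_mul_same _
  have h1 : Sᴴ * (S⁻¹)ᴴ = 1 := by
    rw [← conjTranspose_mul, nonsing_inv_mul _ hSd, conjTranspose_one]
  have h2 : B = Sᴴ * (1 + (S⁻¹)ᴴ * (B - A) * S⁻¹) * S := by
    have : Sᴴ * ((S⁻¹)ᴴ * (B - A) * S⁻¹) * S = B - A := by
      calc _ = (Sᴴ * (S⁻¹)ᴴ) * (B - A) * (S⁻¹ * S) := by simp only [Matrix.mul_assoc]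
        _ = _ := by rw [h1, nonsing_inv_mul _ hSd, Matrix.one_mul, Matrix.mul_one]
    rw [Matrix.mul_add, Matrix.add_mul, this, Matrix.mul_one, ← star_eq_conjTranspose, ← hS]
    abel
  have h3 : A.det = (Sᴴ).det * S.det := by rw [hS, det_mul, star_eq_conjTranspose]
  rw [h2, det_mul, det_mul, mul_right_comm, ← h3]
  exact le_mul_of_one_le_right hA.det_pos.le (one_le_det_one_add hP)

/-- For a matrix `J` with orthonormal columns, `det (Jᵀ D J)` is at most the product of the
largest diagonal entries of `D`. -/
theorem det_transpose_mul_diagonal_mul_le (f : m → n) (hf : Function.Injective f) (x : n → ℝ)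
    (hx : ∀ i, 0 < x i) (c : ℝ) (hc : 0 < c) (h1 : ∀ j, c ≤ x (f j))
    (h2 : ∀ i, i ∉ Set.range f → x i ≤ c) (J : Matrix n m ℝ) (hJ : Jᵀ * J = 1) :
    (Jᵀ * diagonal x * J).det ≤ ∏ j, x (f j) := by
  -- `F` is built so that `c (1 + F Fᵀ)` agrees with `diagonal x` on the range of `f` and equals `c
  -- ≥ x i` off it: a Loewner majorant of `diagonal x` with the same large entries.
  set F : Matrix n m ℝ := of fun i j => if i = f j then √(x (f j) / c - 1) else 0 with hF
  have hpos : ∀ j, 0 ≤ x (f j) / c - 1 := fun j => by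
    rw [sub_nonneg, one_le_div hc]; exact h1 j
  have hFF : Fᵀ * F = diagonal fun j => x (f j) / c - 1 := by
    ext j k
    rw [mul_apply, Finset.sum_eq_single (f j)]
    · by_cases hjk : j = k
      · subst hjk
        simp [hF, Real.mul_self_sqrt (hpos j)]
      · have : f j ≠ f k := fun h => hjk (hf h)
        simp [hF, hjk, this]
    · intro i _ hi
      simp [hF, hi]
    · simp
  have hFF' : (c • (1 + F * Fᵀ) - diagonal x).PosSemidef := by
    have : c • (1 + F * Fᵀ) - diagonal x
        = diagonal fun i => if i ∈ Set.range f then 0 else c - x i := by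
      ext i k
      have hsum : (F * Fᵀ) i k = if i = k ∧ i ∈ Set.range f then x i / c - 1 else 0 := by
        rw [mul_apply]
        split_ifs with h
        · obtain ⟨rfl, j, rfl⟩ := h
          rw [Finset.sum_eq_single j]
          · simp [hF, Real.mul_self_sqrt (hpos j)]
          · intro b _ hb
            have : f j ≠ f b := fun h => hb (hf h).symm
            simp [hF, this]
          · simp
        · refine Finset.sum_eq_zero fun j _ => ?_
          by_cases hij : i = f j
          · by_cases hkj : k = f j
            · exact absurd ⟨hij.trans hkj.symm, j, hij.symm⟩ h
            · simp [hF, hkj]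
          · simp [hF, hij]
      simp only [Matrix.sub_apply, Matrix.smul_apply, Matrix.add_apply, hsum, smul_eq_mul]
      by_cases hik : i = k
      · subst hik
        by_cases hi : i ∈ Set.range f
        · simp only [one_apply_eq, true_and, hi, if_true, diagonal_apply_eq]
          field_simp; ring
        · simp only [one_apply_eq, true_and, hi, if_false, diagonal_apply_eq]
          ring
      · simp [hik]
    rw [this]
    refine PosSemidef.diagonal fun i => ?_
    by_cases hi : i ∈ Set.range f
    · simp [hi]
    · simpa [hi] using h2 i hi
  have hJinj : Function.Injective J.mulVec := fun v w h => by
    have := congrArg (Jᵀ.mulVec) h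
    simpa [mulVec_mulVec, hJ] using this
  have hpd : (Jᵀ * diagonal x * J).PosDef := by
    have := (PosDef.diagonal (n := n) hx).conjTranspose_mul_mul_same (B := J) hJinj
    simpa using this
  -- `J Jᵀ` is an orthogonal projection, so its complement is its own Gram matrix.
  have hps : (1 - J * Jᵀ).PosSemidef := by
    have h := posSemidef_conjTranspose_mul_self (1 - J * Jᵀ)
    have : (1 - J * Jᵀ)ᴴ * (1 - J * Jᵀ) = 1 - J * Jᵀ := by
      rw [conjTranspose_eq_transpose_of_trivial]
      simp only [transpose_sub, transpose_one, transpose_mul, transpose_transpose,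
        Matrix.sub_mul, Matrix.mul_sub, Matrix.one_mul, Matrix.mul_one]
      rw [show J * Jᵀ * (J * Jᵀ) = J * (Jᵀ * J) * Jᵀ by simp only [Matrix.mul_assoc], hJ,
        Matrix.mul_one]
      abel
    rwa [this] at h
  -- Exchanging the factors in `det (1 + XY) = det (1 + YX)` puts `J Jᵀ` between `Fᵀ` and `F`, where
  -- `J Jᵀ ≤ 1` can be used.
  have hcard : (Jᵀ * (c • (1 + F * Fᵀ)) * J).det = c ^ Fintype.card m * (1 + Fᵀ * J * (Jᵀ * F)).det := by
    have : Jᵀ * (c • (1 + F * Fᵀ)) * J = c • (1 + Jᵀ * F * (Fᵀ * J)) := by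
      rw [Matrix.mul_smul, Matrix.smul_mul, Matrix.mul_add, Matrix.add_mul, Matrix.mul_one, hJ]
      simp only [Matrix.mul_assoc]
    rw [this, det_smul, det_one_add_mul_comm]
  calc (Jᵀ * diagonal x * J).det ≤ (Jᵀ * (c • (1 + F * Fᵀ)) * J).det := by
        refine det_le_det_of_posSemidef_sub hpd ?_
        rw [← Matrix.sub_mul, ← Matrix.mul_sub]
        simpa using hFF'.conjTranspose_mul_mul_same J
    _ = c ^ Fintype.card m * (1 + Fᵀ * J * (Jᵀ * F)).det := hcard
    _ ≤ c ^ Fintype.card m * (1 + Fᵀ * F).det := by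
        refine mul_le_mul_of_nonneg_left ?_ (by positivity)
        refine det_le_det_of_posSemidef_sub ?_ ?_
        · have h := posSemidef_conjTranspose_mul_self (Jᵀ * F)
          have e : (Jᵀ * F)ᴴ * (Jᵀ * F) = Fᵀ * J * (Jᵀ * F) := by
            simp [conjTranspose_eq_transpose_of_trivial]
          rw [e] at h
          exact PosDef.one.add_posSemidef h
        · have h := hps.conjTranspose_mul_mul_same F
          have e : (1 + Fᵀ * F) - (1 + Fᵀ * J * (Jᵀ * F)) = Fᴴ * (1 - J * Jᵀ) * F := by
            rw [Matrix.mul_sub, Matrix.sub_mul, Matrix.mul_one,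
              conjTranspose_eq_transpose_of_trivial]
            simp only [Matrix.mul_assoc]
            abel
          rwa [e]
    _ = ∏ j, x (f j) := by
        rw [hFF, ← diagonal_one, diagonal_add, det_diagonal, ← Finset.card_univ,
          ← Finset.prod_const, ← Finset.prod_mul_distrib]
        refine Finset.prod_congr rfl fun j _ => ?_
        field_simp; ring

/-- Discarding the rows of `J` outside the range of `f` lowers the Gram matrix in the Loewner order,
and the determinant of the square remainder factors. -/
theorem det_sq_mul_prod_le_det (f : m → n) (hf : Function.Injective f) (x : n → ℝ)
    (hx : ∀ i, 0 < x i) (J : Matrix n m ℝ) :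
    (J.submatrix f id).det ^ 2 * ∏ j, x (f j) ≤ (Jᵀ * diagonal x * J).det := by
  by_cases h0 : (J.submatrix f id).det = 0
  · rw [h0]
    have := (PosSemidef.diagonal (n := n) (fun i => (hx i).le)).conjTranspose_mul_mul_same J
    simpa using this.det_nonneg
  have e1 : (J.submatrix f id).det ^ 2 * ∏ j, x (f j)
      = ((J.submatrix f id)ᵀ * diagonal (x ∘ f) * (J.submatrix f id)).det := by
    rw [det_mul, det_mul, det_transpose, det_diagonal]
    simp only [Function.comp]; ring
  rw [e1]
  refine det_le_det_of_posSemidef_sub ?_ ?_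
  · have hinj : Function.Injective (J.submatrix f id).mulVec :=
      mulVec_injective_iff_isUnit.mpr ((isUnit_iff_isUnit_det _).mpr (isUnit_iff_ne_zero.mpr h0))
    have := (PosDef.diagonal (n := m) (d := x ∘ f) (fun j => hx (f j))).conjTranspose_mul_mul_same
      (B := J.submatrix f id) hinj
    simpa using this
  · have e2 : Jᵀ * diagonal x * J - (J.submatrix f id)ᵀ * diagonal (x ∘ f) * (J.submatrix f id)
        = Jᵀ * diagonal (fun i => if i ∈ Set.range f then 0 else x i) * J := by
      ext a b
      rw [Matrix.sub_apply, sub_eq_iff_eq_add]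
      rw [mul_apply, mul_apply, mul_apply]
      simp only [mul_diagonal, transpose_apply, submatrix_apply, id, Function.comp]
      have h3 : ∑ j, J (f j) a * x (f j) * J (f j) b
          = ∑ i, if i ∈ Set.range f then J i a * x i * J i b else 0 := by
        rw [← Finset.sum_filter]
        rw [show Finset.univ.filter (· ∈ Set.range f) = Finset.univ.image f by
          ext i; simp]
        rw [Finset.sum_image fun _ _ _ _ h => hf h]
      rw [h3, ← Finset.sum_add_distrib]
      refine Finset.sum_congr rfl fun i _ => ?_
      split_ifs <;> ring
    rw [e2]
    have := (PosSemidef.diagonal (n := n)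
      (d := fun i => if i ∈ Set.range f then 0 else x i) (fun i => by
        by_cases hi : i ∈ Set.range f
        · simp [hi]
        · simpa [hi] using (hx i).le)).conjTranspose_mul_mul_same J
    simpa using this

end RealDet

end BiinvariantWalk
end

noncomputable section

namespace BiinvariantWalk

open Matrix

/-! ### Realification of matrices over `𝔽` -/

section RealMat

variable (𝔽 : Type*) [NormedDivisionRing 𝔽] [NormedAlgebra ℝ 𝔽] [StarRing 𝔽]
  [IsRealComplexOrQuaternion 𝔽]

/-- A real basis of `𝔽` in which left multiplication by `star a` is the transpose of left
multiplication by `a`. -/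
def realBasis : Module.Basis (Fin (Module.finrank ℝ 𝔽)) ℝ 𝔽 :=
  (exists_basis_leftMulMatrix_star 𝔽).choose

theorem finrank_real_pos : 0 < Module.finrank ℝ 𝔽 := Module.finrank_pos

variable {𝔽}
variable {l m n : Type*}

/-- The realification of a matrix over `𝔽`. -/
def realMat (A : Matrix m n 𝔽) :
    Matrix (m × Fin (Module.finrank ℝ 𝔽)) (n × Fin (Module.finrank ℝ 𝔽)) ℝ :=
  of fun p r => Algebra.leftMulMatrix (realBasis 𝔽) (A p.1 r.1) p.2 r.2

theorem realMat_apply (A : Matrix m n 𝔽) (p r) :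
    realMat A p r = Algebra.leftMulMatrix (realBasis 𝔽) (A p.1 r.1) p.2 r.2 := rfl

theorem realMat_mul [Fintype m] (A : Matrix l m 𝔽) (B : Matrix m n 𝔽) :
    realMat (A * B) = realMat A * realMat B := by
  ext p r
  simp only [realMat_apply, mul_apply, map_sum, map_mul, Matrix.sum_apply, Fintype.sum_prod_type]

theorem realMat_one [DecidableEq n] : realMat (1 : Matrix n n 𝔽) = 1 := by
  ext ⟨i, k⟩ ⟨j, l⟩
  rw [realMat_apply]
  by_cases h : i = j
  · subst h
    simp [one_apply]
  · simp [one_apply, h]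

theorem realMat_add (A B : Matrix m n 𝔽) : realMat (A + B) = realMat A + realMat B := by
  ext p r
  simp [realMat_apply]

theorem realMat_real_smul_one [DecidableEq n] (s : ℝ) :
    realMat (diagonal fun _ => algebraMap ℝ 𝔽 s : Matrix n n 𝔽) = s • 1 := by
  ext ⟨i, k⟩ ⟨j, l⟩
  rw [realMat_apply]
  by_cases h : i = j
  · subst h
    simp [one_apply, Algebra.algebraMap_eq_smul_one]
  · simp [one_apply, h]

theorem realMat_conjTranspose (A : Matrix m n 𝔽) : realMat Aᴴ = (realMat A)ᵀ := by
  ext p r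
  rw [transpose_apply, realMat_apply, realMat_apply, conjTranspose_apply,
    show Algebra.leftMulMatrix (realBasis 𝔽) (star (A r.1 p.1)) = _ from
      (exists_basis_leftMulMatrix_star 𝔽).choose_spec _, transpose_apply]
  rfl

theorem realMat_realDiag {q : ℕ} (x : Fin q → ℝ) :
    realMat (realDiag x : Matrix (Fin q) (Fin q) 𝔽) = diagonal fun p => x p.1 := by
  ext ⟨i, k⟩ ⟨j, l⟩
  rw [realMat_apply, realDiag]
  by_cases h : i = j
  · subst h
    simp [diagonal_apply, Algebra.algebraMap_eq_smul_one, one_apply]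
  · simp [h]

theorem realMat_submatrix {m' n' : Type*} (A : Matrix m n 𝔽) (f : m' → m) (g : n' → n) :
    realMat (A.submatrix f g) = (realMat A).submatrix (Prod.map f id) (Prod.map g id) := rfl

theorem continuous_realMat : Continuous (realMat : Matrix m n 𝔽 → _) := by
  refine continuous_matrix fun p r => ?_
  have h : Continuous (Algebra.leftMulMatrix (realBasis 𝔽)) :=
    (Algebra.leftMulMatrix (realBasis 𝔽)).toLinearMap.continuous_of_finiteDimensional
  exact (h.comp (continuous_id.matrix_elem p.1 r.1)).matrix_elem p.2 r.2

/-- This brings all minors, including the quaternionic ones, under real determinant theory: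
realification is multiplicative and turns conjugate transposes into transposes. -/
theorem det_mulVec_eq_det_realMat {r : ℕ} (A : Matrix (Fin r) (Fin r) 𝔽) :
    LinearMap.det
      ((LinearMap.pi fun i => ∑ j, LinearMap.mulLeft ℝ (A i j) ∘ₗ LinearMap.proj j) :
        (Fin r → 𝔽) →ₗ[ℝ] (Fin r → 𝔽)) = (realMat A).det := by
  rw [← LinearMap.det_toMatrix (Pi.basis fun _ : Fin r => realBasis 𝔽),
    ← det_submatrix_equiv_self (Equiv.sigmaEquivProd (Fin r) (Fin (Module.finrank ℝ 𝔽)))]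
  congr 1
  ext ⟨i, k⟩ ⟨j, l⟩
  rw [LinearMap.toMatrix_apply, Pi.basis_repr, Pi.basis_apply]
  simp only [LinearMap.pi_apply, LinearMap.sum_apply, LinearMap.comp_apply, LinearMap.proj_apply,
    LinearMap.mulLeft_apply, submatrix_apply, realMat_apply, Equiv.sigmaEquivProd_apply,
    Algebra.leftMulMatrix_eq_repr_mul]
  rw [Finset.sum_eq_single j]
  · simp
  · intro b _ hb
    simp [Pi.single_eq_of_ne hb]
  · simp

theorem minor_eq_det_rpow {q : ℕ} (A : Matrix (Fin q) (Fin q) 𝔽) (r : Fin q) :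
    minor A r = (realMat (A.submatrix (Fin.castLE r.isLt : Fin (r + 1) → Fin q)
      (Fin.castLE r.isLt))).det ^ (1 / (Module.finrank ℝ 𝔽 : ℝ)) := by
  rw [minor, posDet, det_mulVec_eq_det_realMat]

end RealMat

/-! ### Unitary block matrices for induction on the size -/

section OneBlock

variable {R : Type*} [Ring R] {n : ℕ}

/-- The block matrix `diag(1, u)`. -/
def oneBlock (u : Matrix (Fin n) (Fin n) R) : Matrix (Fin (n + 1)) (Fin (n + 1)) R :=
  of fun i j => Fin.cases (Fin.cases 1 (fun _ => 0) j) (fun i' => Fin.cases 0 (u i') j) i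

@[simp] theorem oneBlock_zero_zero (u : Matrix (Fin n) (Fin n) R) : oneBlock u 0 0 = 1 := rfl

@[simp] theorem oneBlock_zero_succ (u : Matrix (Fin n) (Fin n) R) (j : Fin n) :
    oneBlock u 0 j.succ = 0 := rfl

@[simp] theorem oneBlock_succ_zero (u : Matrix (Fin n) (Fin n) R) (i : Fin n) :
    oneBlock u i.succ 0 = 0 := rfl

@[simp] theorem oneBlock_succ_succ (u : Matrix (Fin n) (Fin n) R) (i j : Fin n) :
    oneBlock u i.succ j.succ = u i j := rfl

theorem oneBlock_mul (u v : Matrix (Fin n) (Fin n) R) :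
    oneBlock u * oneBlock v = oneBlock (u * v) := by
  ext i j
  refine Fin.cases ?_ (fun i => ?_) i <;> refine Fin.cases ?_ (fun j => ?_) j <;>
    simp [mul_apply, Fin.sum_univ_succ]

theorem oneBlock_one : oneBlock (1 : Matrix (Fin n) (Fin n) R) = 1 := by
  ext i j
  refine Fin.cases ?_ (fun i => ?_) i <;> refine Fin.cases ?_ (fun j => ?_) j <;>
    simp [one_apply, Fin.succ_ne_zero, (Fin.succ_ne_zero _).symm]

theorem star_oneBlock [StarRing R] (u : Matrix (Fin n) (Fin n) R) :
    star (oneBlock u) = oneBlock (star u) := by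
  ext i j
  refine Fin.cases ?_ (fun i => ?_) i <;> refine Fin.cases ?_ (fun j => ?_) j <;>
    simp [star_apply]

theorem oneBlock_mem_unitary [StarRing R] (u : unitary (Matrix (Fin n) (Fin n) R)) :
    oneBlock (u : Matrix (Fin n) (Fin n) R) ∈ unitary (Matrix (Fin (n + 1)) (Fin (n + 1)) R) := by
  rw [Unitary.mem_iff, star_oneBlock, oneBlock_mul, oneBlock_mul, Unitary.mul_star_self_of_mem u.2,
    Unitary.star_mul_self_of_mem u.2, oneBlock_one]
  exact ⟨rfl, rfl⟩

end OneBlock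

theorem mem_unitary_of_star_eq_of_mul_self {R : Type*} [Ring R] [StarRing R] {r : R}
    (h1 : star r = r) (h2 : r * r = 1) : r ∈ unitary R := by
  rw [Unitary.mem_iff, h1]; exact ⟨h2, h2⟩

/-! ### Reflections, QR decomposition and spectral theorem over `𝔽` -/

section UnitaryExistence

variable {𝔽 : Type*} [NormedDivisionRing 𝔽] [NormedAlgebra ℝ 𝔽] [StarRing 𝔽]
  [IsRealComplexOrQuaternion 𝔽]

instance instStarModuleReal : StarModule ℝ 𝔽 where
  star_smul r a := by
    rw [Algebra.smul_def, star_mul, star_algebraMap_real, ← Algebra.commutes, ← Algebra.smul_def,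
      star_trivial r]

theorem exists_dotProduct_star_self_eq {n : ℕ} (v : Fin n → 𝔽) :
    ∃ c : ℝ, 0 ≤ c ∧ ∑ i, star (v i) * v i = algebraMap ℝ 𝔽 c ∧ (c = 0 → v = 0) := by
  choose c hc0 hc using fun i => exists_star_mul_self_eq (v i)
  refine ⟨∑ i, c i, Finset.sum_nonneg fun i _ => hc0 i, ?_, fun h => ?_⟩
  · simp [hc, map_sum]
  · funext i
    have h1 := (Finset.sum_eq_zero_iff_of_nonneg fun i _ => hc0 i).mp h i (Finset.mem_univ i)
    have h2 := hc i
    rw [h1, map_zero, mul_eq_zero, star_eq_zero, or_self] at h2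
    exact h2

/-- Unit vectors with real first coordinate are moved to the first basis vector by a reflection. -/
theorem exists_reflection_of_unit {n : ℕ} (v : Fin (n + 1) → 𝔽) (hv : ∑ i, star (v i) * v i = 1)
    (a : ℝ) (hv0 : v 0 = algebraMap ℝ 𝔽 a) :
    ∃ R : Matrix (Fin (n + 1)) (Fin (n + 1)) 𝔽, star R = R ∧ R * R = 1 ∧
      R *ᵥ v = Pi.single 0 1 := by
  set w : Fin (n + 1) → 𝔽 := v - Pi.single 0 1 with hw
  obtain ⟨c, hc0, hc, hcw⟩ := exists_dotProduct_star_self_eq w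
  by_cases hcz : c = 0
  · refine ⟨1, star_one _, one_mul _, ?_⟩
    rw [one_mulVec]
    exact sub_eq_zero.mp (hcw hcz)
  -- The real first coordinate makes this pairing real, hence central, so the Householder formula `1
  -- - (2 / c) w w*` works over the quaternions too.
  have hwv : ∑ i, star (w i) * v i = algebraMap ℝ 𝔽 (1 - a) := by
    simp only [hw, Pi.sub_apply, star_sub, sub_mul, Finset.sum_sub_distrib, hv]
    rw [Finset.sum_eq_single 0 (by intro b _ hb; simp [hb]) (by simp)]
    simp [hv0]
  have hww : ∑ i, star (w i) * w i = algebraMap ℝ 𝔽 (2 * (1 - a)) := by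
    have : ∑ i, star (w i) * w i = ∑ i, star (w i) * v i - star (w 0) := by
      rw [hw]
      simp only [Pi.sub_apply, mul_sub, Finset.sum_sub_distrib]
      congr 1
      rw [Finset.sum_eq_single 0 (by intro b _ hb; simp [hb]) (by simp)]
      simp
    rw [this, hwv]
    simp only [hw, Pi.sub_apply, Pi.single_eq_same, hv0, star_sub, star_algebraMap_real, star_one]
    simp only [map_sub, map_mul, map_one, map_ofNat]
    noncomm_ring
  have hca : c = 2 * (1 - a) := (algebraMap ℝ 𝔽).injective (hc.symm.trans hww)
  set Q : Matrix (Fin (n + 1)) (Fin (n + 1)) 𝔽 := of fun i j => w i * star (w j) with hQ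
  have hQs : star Q = Q := by
    ext i j
    simp [hQ, star_apply]
  have hQQ : Q * Q = c • Q := by
    ext i j
    simp only [mul_apply, hQ, of_apply, Matrix.smul_apply]
    have : ∀ k, w i * star (w k) * (w k * star (w j)) = w i * (star (w k) * w k) * star (w j) :=
      fun k => by simp only [mul_assoc]
    simp only [this]
    rw [← Finset.sum_mul, ← Finset.mul_sum, hc, ← Algebra.commutes, ← Algebra.smul_def,
      smul_mul_assoc]
  have hQv : Q *ᵥ v = (1 - a) • w := by
    ext i
    simp only [mulVec, dotProduct, hQ, of_apply, mul_assoc, Pi.smul_apply]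
    rw [← Finset.mul_sum, hwv, ← Algebra.commutes, ← Algebra.smul_def]
  refine ⟨1 - (2 / c) • Q, ?_, ?_, ?_⟩
  · rw [star_sub, star_one, star_smul, hQs, star_trivial]
  · rw [sub_mul, mul_sub, mul_sub, one_mul, mul_one, one_mul, smul_mul_smul_comm, hQQ, smul_smul]
    have : 2 / c * (2 / c) * c = 2 / c + 2 / c := by field_simp; ring
    rw [this, add_smul]
    abel
  · have h1 : 2 / c * (1 - a) = 1 := by
      have : 1 - a = c / 2 := by rw [hca]; ring
      rw [this]
      field_simp
    rw [sub_mulVec, one_mulVec, smul_mulVec, hQv, smul_smul, h1, one_smul, hw]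
    abel

/-- Every vector is moved to a multiple of the first basis vector by a reflection. -/
theorem exists_reflection {n : ℕ} (v : Fin (n + 1) → 𝔽) :
    ∃ R : Matrix (Fin (n + 1)) (Fin (n + 1)) 𝔽, star R = R ∧ R * R = 1 ∧
      ∃ c : 𝔽, R *ᵥ v = Pi.single 0 c := by
  obtain ⟨c, hc0, hc, hcv⟩ := exists_dotProduct_star_self_eq v
  by_cases hcz : c = 0
  · exact ⟨1, star_one _, one_mul _, 0, by simp [hcv hcz]⟩
  have hcpos : 0 < c := lt_of_le_of_ne hc0 (Ne.symm hcz)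
  -- Right scaling commutes with the action of matrices from the left, so `v` may be replaced by the
  -- unit vector `v p`. Taking `p` to be a real multiple of `star (v 0)` makes its first coordinate
  -- real; when `v 0 = 0`, normalization suffices.
  obtain ⟨p, a, hp, hpa⟩ : ∃ (p : 𝔽) (a : ℝ), star p * p = algebraMap ℝ 𝔽 c⁻¹ ∧
      v 0 * p = algebraMap ℝ 𝔽 a := by
    by_cases h0 : v 0 = 0
    · refine ⟨algebraMap ℝ 𝔽 (√c)⁻¹, 0, ?_, by simp [h0]⟩
      rw [star_algebraMap_real, ← map_mul, ← mul_inv, Real.mul_self_sqrt hc0]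
    · obtain ⟨b, hb0, hb⟩ := exists_star_mul_self_eq (v 0)
      have hbz : b ≠ 0 := by
        rintro rfl
        rw [map_zero, mul_eq_zero, star_eq_zero, or_self] at hb
        exact h0 hb
      have hb' : v 0 * star (v 0) = algebraMap ℝ 𝔽 b := by
        apply mul_right_cancel₀ h0
        rw [mul_assoc, hb, Algebra.commutes]
      have hcb : 0 ≤ c * b := mul_nonneg hc0 hb0
      refine ⟨(√(c * b))⁻¹ • star (v 0), (√(c * b))⁻¹ * b, ?_, ?_⟩
      · rw [star_smul, star_star, smul_mul_smul_comm, hb', Algebra.smul_def, ← map_mul,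
          star_trivial, ← mul_inv, Real.mul_self_sqrt hcb]
        congr 1
        field_simp
      · rw [mul_smul_comm, hb', Algebra.smul_def, ← map_mul]
  have hp0 : p ≠ 0 := by
    rintro rfl
    rw [mul_zero, eq_comm, map_eq_zero] at hp
    exact hcz (inv_eq_zero.mp hp)
  obtain ⟨R, h1, h2, h3⟩ := exists_reflection_of_unit (fun i => v i * p) (by
    have : ∀ i, star (v i * p) * (v i * p) = star p * (star (v i) * v i) * p := fun i => by
      simp only [star_mul, mul_assoc]
    simp only [this]
    rw [← Finset.sum_mul, ← Finset.mul_sum, hc, ← Algebra.commutes, mul_assoc, hp, ← map_mul,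
      mul_inv_cancel₀ hcz, map_one]) a hpa
  refine ⟨R, h1, h2, p⁻¹, ?_⟩
  ext i
  have h4 := congrFun h3 i
  simp only [mulVec, dotProduct, ← mul_assoc] at h4 ⊢
  rw [← Finset.sum_mul] at h4
  rw [(eq_mul_inv_iff_mul_eq₀ hp0).mpr h4]
  by_cases hi : i = 0
  · subst hi; simp
  · simp [hi]

/-- The QR decomposition. -/
theorem exists_unitary_mul_upperTriangular {n : ℕ} (s : Matrix (Fin n) (Fin n) 𝔽) :
    ∃ u : UnitaryGroup 𝔽 n, ∃ b : Matrix (Fin n) (Fin n) 𝔽,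
      s = (u : Matrix (Fin n) (Fin n) 𝔽) * b ∧ ∀ i j, j < i → b i j = 0 := by
  suffices h : ∃ u : UnitaryGroup 𝔽 n, ∀ i j, j < i →
      (star (u : Matrix (Fin n) (Fin n) 𝔽) * s) i j = 0 by
    obtain ⟨u, hu⟩ := h
    exact ⟨u, _, by rw [← mul_assoc, Unitary.mul_star_self_of_mem u.2, one_mul], hu⟩
  induction n with
  | zero => exact ⟨1, fun i => i.elim0⟩
  | succ n ih =>
    obtain ⟨R, h1, h2, c, hc⟩ := exists_reflection (fun i => s i 0)
    obtain ⟨u, hu⟩ := ih ((R * s).submatrix Fin.succ Fin.succ)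
    refine ⟨⟨R, mem_unitary_of_star_eq_of_mul_self h1 h2⟩ * ⟨_, oneBlock_mem_unitary u⟩, ?_⟩
    intro i j hij
    simp only [Submonoid.coe_mul, star_mul, h1, star_oneBlock, mul_assoc]
    have hcol : ∀ i : Fin n, (R * s) i.succ 0 = 0 := fun i => by
      have := congrFun hc i.succ
      simpa [mulVec, dotProduct, mul_apply] using this
    revert hij
    refine Fin.cases (fun h => absurd h (Fin.not_lt_zero j)) (fun i => ?_) i
    refine Fin.cases (fun _ => ?_) (fun j hij => ?_) j
    · rw [mul_apply, Fin.sum_univ_succ]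
      simp [hcol]
    · rw [mul_apply, Fin.sum_univ_succ, oneBlock_succ_zero, zero_mul, zero_add]
      have := hu i j (Fin.succ_lt_succ_iff.mp hij)
      rw [mul_apply] at this
      simpa using this

/-- The realification of `A` is real symmetric. The blocks of a real eigenvector are the coordinates
of a vector over `𝔽`, and the eigenvalue, being real, commutes with the passage back. -/
theorem exists_eigenvector {n : ℕ} (A : Matrix (Fin (n + 1)) (Fin (n + 1)) 𝔽) (hA : star A = A) :
    ∃ (v : Fin (n + 1) → 𝔽) (c : ℝ), v ≠ 0 ∧ A *ᵥ v = c • v := by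
  have hH : (realMat A).IsHermitian := by
    rw [IsHermitian, conjTranspose_eq_transpose_of_trivial, ← realMat_conjTranspose,
      ← star_eq_conjTranspose, hA]
  let p : Fin (n + 1) × Fin (Module.finrank ℝ 𝔽) := (0, ⟨0, finrank_real_pos 𝔽⟩)
  have hev := hH.mulVec_eigenvectorBasis p
  set y : Fin (n + 1) × Fin (Module.finrank ℝ 𝔽) → ℝ := ⇑(hH.eigenvectorBasis p) with hy
  have hy0 : y ≠ 0 := by
    intro h
    have h1 : hH.eigenvectorBasis p ≠ 0 := hH.eigenvectorBasis.orthonormal.ne_zero p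
    apply h1
    ext i
    exact congrFun h i
  let v : Fin (n + 1) → 𝔽 := fun i => (realBasis 𝔽).equivFun.symm fun k => y (i, k)
  have hv : ∀ i k, (realBasis 𝔽).repr (v i) k = y (i, k) := fun i k => by
    rw [← Module.Basis.equivFun_apply, LinearEquiv.apply_symm_apply]
  refine ⟨v, hH.eigenvalues p, ?_, ?_⟩
  · intro h
    apply hy0
    ext ⟨i, k⟩
    rw [← hv, h]
    simp
  · ext i
    apply (realBasis 𝔽).repr.injective
    ext k
    have h1 := congrFun hev (i, k)
    simp only [mulVec, dotProduct, map_sum, Finsupp.coe_finsetSum, Finset.sum_apply,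
      Pi.smul_apply, map_smul, Finsupp.smul_apply, hv] at h1 ⊢
    rw [← h1, Fintype.sum_prod_type]
    refine Finset.sum_congr rfl fun j _ => ?_
    rw [← Algebra.leftMulMatrix_mulVec_repr]
    simp only [mulVec, dotProduct, realMat_apply, hv]

/-- The spectral theorem for Hermitian matrices over `𝔽`. -/
theorem exists_unitary_diagonalization {n : ℕ} (A : Matrix (Fin n) (Fin n) 𝔽) (hA : star A = A) :
    ∃ (u : UnitaryGroup 𝔽 n) (x : Fin n → ℝ), A = (u : Matrix (Fin n) (Fin n) 𝔽) *
      realDiag x * star (u : Matrix (Fin n) (Fin n) 𝔽) := by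
  induction n with
  | zero => exact ⟨1, 0, by ext i; exact i.elim0⟩
  | succ n ih =>
    obtain ⟨v, c, hv, hAv⟩ := exists_eigenvector A hA
    obtain ⟨R, h1, h2, d, hd⟩ := exists_reflection v
    have hd0 : d ≠ 0 := by
      rintro rfl
      rw [Pi.single_zero] at hd
      have := congrArg (R.mulVec) hd
      rw [mulVec_mulVec, h2, one_mulVec, mulVec_zero] at this
      exact hv this
    -- Deflation: once the eigenvector lies along the first axis, the first column is cleared, and
    -- Hermitian symmetry clears the first row.
    set B := R * A * R with hB
    have hBs : star B = B := by rw [hB, star_mul, star_mul, h1, hA, mul_assoc]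
    have hBd : B *ᵥ (Pi.single 0 d) = c • (Pi.single 0 d : Fin (n + 1) → 𝔽) := by
      rw [← hd, mulVec_mulVec, hB, mul_assoc, h2, mul_one, ← mulVec_mulVec, hAv, mulVec_smul]
    have hcol : ∀ i, B i 0 = c • (Pi.single 0 1 : Fin (n + 1) → 𝔽) i := fun i => by
      have h := congrFun hBd i
      rw [mulVec_single] at h
      apply mul_right_cancel₀ hd0
      refine Eq.trans ?_ (h.trans ?_)
      · simp
      · by_cases hi : i = 0
        · subst hi; simp
        · simp [hi]
    have hrow : ∀ j, B 0 j = c • (Pi.single 0 1 : Fin (n + 1) → 𝔽) j := fun j => by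
      have h := congrFun (congrFun hBs 0) j
      rw [star_apply, hcol] at h
      rw [← h]
      by_cases hj : j = 0
      · subst hj; simp
      · simp [hj]
    obtain ⟨u, x, hu⟩ := ih (B.submatrix Fin.succ Fin.succ) (by
      ext i j
      exact congrFun (congrFun hBs i.succ) j.succ)
    have hBu : B = oneBlock (u : Matrix (Fin n) (Fin n) 𝔽) *
        realDiag (Fin.cons c x : Fin (n + 1) → ℝ) *
        star (oneBlock (u : Matrix (Fin n) (Fin n) 𝔽)) := by
      rw [star_oneBlock]
      ext i j
      refine Fin.cases ?_ (fun i => ?_) i <;> refine Fin.cases ?_ (fun j => ?_) j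
      · rw [hcol, mul_apply]
        simp [realDiag, mul_diagonal, Fin.sum_univ_succ, Algebra.algebraMap_eq_smul_one]
      · rw [hrow, mul_apply]
        simp [realDiag, mul_diagonal, Fin.sum_univ_succ]
      · rw [hcol, mul_apply]
        simp [realDiag, mul_diagonal, Fin.sum_univ_succ]
      · have h := congrFun (congrFun hu i) j
        rw [submatrix_apply, mul_apply] at h
        rw [h, mul_apply]
        simp [realDiag, mul_diagonal, Fin.sum_univ_succ]
    refine ⟨⟨R, mem_unitary_of_star_eq_of_mul_self h1 h2⟩ * ⟨_, oneBlock_mem_unitary u⟩,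
      Fin.cons c x, ?_⟩
    have hAB : A = R * B * R := by
      rw [hB]
      calc A = (R * R) * A * (R * R) := by rw [h2, one_mul, mul_one]
        _ = _ := by simp only [mul_assoc]
    rw [hAB, hBu]
    simp only [Submonoid.coe_mul, star_mul, h1, mul_assoc]

theorem exists_isOrderedSpectrum {n : ℕ} (A : Matrix (Fin n) (Fin n) 𝔽) (hA : star A = A) :
    ∃ x, IsOrderedSpectrum A x := by
  obtain ⟨u, x, hu⟩ := exists_unitary_diagonalization A hA
  let σ : Equiv.Perm (Fin n) := Tuple.sort (fun i => -x i)
  have hσ : Antitone (x ∘ σ) := by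
    have h := Tuple.monotone_sort (fun i => -x i)
    intro i j hij
    have := h hij
    simpa using this
  have key : ∀ y : Fin n → 𝔽, (u : Matrix (Fin n) (Fin n) 𝔽).submatrix id σ * diagonal (y ∘ σ) *
      star ((u : Matrix (Fin n) (Fin n) 𝔽).submatrix id σ) = u * diagonal y * star (u : Matrix (Fin n) (Fin n) 𝔽) := by
    intro y
    ext i j
    rw [mul_apply, mul_apply]
    simp only [mul_diagonal, submatrix_apply, star_apply, id, Function.comp]
    exact Equiv.sum_comp σ (fun k => (u : Matrix (Fin n) (Fin n) 𝔽) i k * y k *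
      star ((u : Matrix (Fin n) (Fin n) 𝔽) j k))
  have hmem : (u : Matrix (Fin n) (Fin n) 𝔽).submatrix id σ ∈ unitary (Matrix (Fin n) (Fin n) 𝔽) := by
    rw [Unitary.mem_iff]
    constructor
    · rw [star_eq_conjTranspose, conjTranspose_submatrix,
        ← submatrix_mul _ _ σ id σ Function.bijective_id, ← star_eq_conjTranspose,
        Unitary.star_mul_self_of_mem u.2, submatrix_one_equiv]
    · have := key 1
      simpa [Unitary.mul_star_self_of_mem u.2] using this
  exact ⟨x ∘ σ, hσ, ⟨_, hmem⟩, by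
    rw [hu]; exact (key fun i => algebraMap ℝ 𝔽 (x i)).symm⟩

end UnitaryExistence

end BiinvariantWalk
end

noncomputable section

namespace BiinvariantWalk

open Matrix

/-! ### Leading minors of `g* g`, the cocycle identity and singular values -/

section Gram

variable {𝔽 : Type*} [NormedDivisionRing 𝔽] [NormedAlgebra ℝ 𝔽] [StarRing 𝔽]
  [IsRealComplexOrQuaternion 𝔽] {q : ℕ}

/-- The realification of the first `r + 1` columns. -/
def colMat (g : Matrix (Fin q) (Fin q) 𝔽) (r : Fin q) :
    Matrix (Fin q × Fin (Module.finrank ℝ 𝔽)) (Fin (r + 1) × Fin (Module.finrank ℝ 𝔽)) ℝ :=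
  realMat (g.submatrix id (Fin.castLE r.isLt))

/-- The real determinant of the leading block of size `r + 1`. -/
def blockDet (g : Matrix (Fin q) (Fin q) 𝔽) (r : Fin q) : ℝ :=
  (realMat (g.submatrix (Fin.castLE r.isLt : Fin (r + 1) → Fin q) (Fin.castLE r.isLt))).det

theorem blockDet_star_mul_self (g : Matrix (Fin q) (Fin q) 𝔽) (r : Fin q) :
    blockDet (star g * g) r = ((colMat g r)ᵀ * colMat g r).det := by
  rw [blockDet, colMat, ← realMat_conjTranspose, ← realMat_mul, conjTranspose_submatrix,
    submatrix_mul _ _ _ _ _ Function.bijective_id, star_eq_conjTranspose]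

theorem blockDet_star_mul_self_nonneg (g : Matrix (Fin q) (Fin q) 𝔽) (r : Fin q) :
    0 ≤ blockDet (star g * g) r := by
  rw [blockDet_star_mul_self]
  simpa using (posSemidef_conjTranspose_mul_self (colMat g r)).det_nonneg

theorem castLE_prodMap_injective (r : Fin q) : Function.Injective
    (Prod.map (Fin.castLE r.isLt : Fin (r + 1) → Fin q) (id : Fin (Module.finrank ℝ 𝔽) → _)) :=
  (Fin.castLE_injective _).prodMap Function.injective_id

theorem posDef_realMat_star_mul_self {g : Matrix (Fin q) (Fin q) 𝔽} (hg : IsUnit g) :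
    (realMat (star g * g)).PosDef := by
  obtain ⟨h, hh⟩ := hg.exists_left_inv
  rw [realMat_mul, star_eq_conjTranspose, realMat_conjTranspose]
  have := PosDef.conjTranspose_mul_self (realMat g) (fun v w hvw => by
    have := congrArg (realMat h).mulVec hvw
    simpa [mulVec_mulVec, ← realMat_mul, hh, realMat_one] using this)
  simpa using this

theorem blockDet_star_mul_self_pos {g : Matrix (Fin q) (Fin q) 𝔽} (hg : IsUnit g) (r : Fin q) :
    0 < blockDet (star g * g) r := by
  rw [blockDet, realMat_submatrix]
  exact ((posDef_realMat_star_mul_self hg).submatrix (castLE_prodMap_injective r)).det_pos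

/-- Half the logarithm of the principal minor of order `r + 1` of `g* g`. -/
def logMinor (g : Matrix (Fin q) (Fin q) 𝔽) (r : Fin q) : ℝ :=
  1 / 2 * Real.log (minor (star g * g) r)

theorem minor_star_mul_self_pos {g : Matrix (Fin q) (Fin q) 𝔽} (hg : IsUnit g) (r : Fin q) :
    0 < minor (star g * g) r := by
  rw [minor_eq_det_rpow]
  exact Real.rpow_pos_of_pos (blockDet_star_mul_self_pos hg r) _

theorem logMinor_eq (g : Matrix (Fin q) (Fin q) 𝔽) (r : Fin q) :
    logMinor g r = 1 / (2 * Module.finrank ℝ 𝔽) * Real.log (blockDet (star g * g) r) := by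
  have hd : (0 : ℝ) < Module.finrank ℝ 𝔽 := by exact_mod_cast finrank_real_pos 𝔽
  rw [logMinor, minor_eq_det_rpow]
  change 1 / 2 * Real.log (blockDet (star g * g) r ^ _) = _
  -- When the minor vanishes both sides are `0`, since `Real.log 0 = 0`; so the formula holds on all
  -- matrices, as needed for measurability.
  rcases (blockDet_star_mul_self_nonneg g r).eq_or_lt with h | h
  · rw [← h, Real.zero_rpow (by positivity)]; simp
  · rw [Real.log_rpow h]; field_simp

theorem logMinor_unitary_mul (u : UnitaryGroup 𝔽 q) (g : Matrix (Fin q) (Fin q) 𝔽) (r : Fin q) :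
    logMinor ((u : Matrix (Fin q) (Fin q) 𝔽) * g) r = logMinor g r := by
  have : star ((u : Matrix (Fin q) (Fin q) 𝔽) * g) * ((u : Matrix (Fin q) (Fin q) 𝔽) * g)
      = star g * g := by
    rw [star_mul, mul_assoc, ← mul_assoc (star (u : Matrix (Fin q) (Fin q) 𝔽)),
      Unitary.star_mul_self_of_mem u.2, one_mul]
  rw [logMinor, logMinor, this]

/-- Column `j` of `b` is supported on rows up to `j`, so truncating the inner sum drops only zeros.
This is the source of the multiplicativity of leading minors. -/
theorem submatrix_mul_of_upperTriangular {m : Type*} (x : Matrix m (Fin q) 𝔽)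
    (b : Matrix (Fin q) (Fin q) 𝔽) (hb : ∀ i j, j < i → b i j = 0) (r : Fin q)
    {m' : Type*} (f : m' → m) :
    (x * b).submatrix f (Fin.castLE r.isLt : Fin (r + 1) → Fin q)
      = x.submatrix f (Fin.castLE r.isLt : Fin (r + 1) → Fin q) *
        b.submatrix (Fin.castLE r.isLt : Fin (r + 1) → Fin q) (Fin.castLE r.isLt) := by
  ext i j
  simp only [submatrix_apply, mul_apply]
  rw [← Finset.sum_image (f := fun k => x (f i) k * b k (Fin.castLE r.isLt j))
    (fun _ _ _ _ h => Fin.castLE_injective _ h)]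
  symm
  refine Finset.sum_subset (Finset.subset_univ _) fun k _ hk => ?_
  rw [hb _ _ ?_, mul_zero]
  by_contra hlt
  apply hk
  rw [Finset.mem_image]
  refine ⟨⟨k, ?_⟩, Finset.mem_univ _, by ext; rfl⟩
  have h1 : (k : ℕ) ≤ j := by
    have := not_lt.mp hlt
    exact this
  omega

theorem blockDet_mul_of_upperTriangular (x b : Matrix (Fin q) (Fin q) 𝔽)
    (hb : ∀ i j, j < i → b i j = 0) (r : Fin q) :
    blockDet (x * b) r = blockDet x r * blockDet b r := by
  rw [blockDet, submatrix_mul_of_upperTriangular x b hb, realMat_mul, det_mul]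
  rfl

theorem blockDet_gram_mul_of_upperTriangular (x b : Matrix (Fin q) (Fin q) 𝔽)
    (hb : ∀ i j, j < i → b i j = 0) (r : Fin q) :
    blockDet (star (x * b) * (x * b)) r = blockDet (star x * x) r * blockDet b r ^ 2 := by
  rw [blockDet_star_mul_self, blockDet_star_mul_self, colMat,
    submatrix_mul_of_upperTriangular x b hb, realMat_mul]
  rw [transpose_mul, Matrix.mul_assoc,
    ← Matrix.mul_assoc (realMat (x.submatrix id (Fin.castLE r.isLt)))ᵀ, det_mul, det_mul,
    det_transpose]
  simp only [blockDet, colMat]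
  ring

theorem blockDet_one (r : Fin q) : blockDet (1 : Matrix (Fin q) (Fin q) 𝔽) r = 1 := by
  rw [blockDet, submatrix_one _ (Fin.castLE_injective _), realMat_one, det_one]

/-- The cocycle property of `logMinor`. -/
theorem exists_unitary_logMinor_mul (s : Matrix (Fin q) (Fin q) 𝔽) (hs : IsUnit s) :
    ∃ u : UnitaryGroup 𝔽 q, ∀ x : Matrix (Fin q) (Fin q) 𝔽, IsUnit x → ∀ r,
      logMinor (x * s) r = logMinor (x * u.1) r + logMinor s r := by
  -- The unitary factor is fixed before `x` is chosen; the triangular factor contributes exactly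
  -- `logMinor s`, as unitary left factors leave `logMinor` unchanged.
  obtain ⟨u, b, rfl, hb⟩ := exists_unitary_mul_upperTriangular s
  refine ⟨u, fun x hx r => ?_⟩
  have hu : IsUnit (u : Matrix (Fin q) (Fin q) 𝔽) := (Unitary.toUnits u).isUnit
  have h1 := blockDet_gram_mul_of_upperTriangular (u : Matrix (Fin q) (Fin q) 𝔽) b hb r
  rw [Unitary.star_mul_self_of_mem u.2, blockDet_one, one_mul] at h1
  rw [← mul_assoc, logMinor_eq, logMinor_eq, logMinor_eq,
    blockDet_gram_mul_of_upperTriangular _ _ hb, h1,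
    Real.log_mul (blockDet_star_mul_self_pos (hx.mul hu) r).ne'
      (h1 ▸ (blockDet_star_mul_self_pos hs r).ne'), mul_add]

/-- The sum of the first `r + 1` entries. -/
def topSum (t : Fin q → ℝ) (r : Fin q) : ℝ := ∑ i : Fin (r + 1), t (Fin.castLE r.isLt i)

theorem colMat_unitary (v : UnitaryGroup 𝔽 q) (r : Fin q) :
    (colMat (v : Matrix (Fin q) (Fin q) 𝔽) r)ᵀ * colMat (v : Matrix (Fin q) (Fin q) 𝔽) r = 1 := by
  rw [colMat, ← realMat_conjTranspose, ← realMat_mul, conjTranspose_submatrix,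
    ← submatrix_mul _ _ _ _ _ Function.bijective_id, ← star_eq_conjTranspose,
    Unitary.star_mul_self_of_mem v.2, submatrix_one _ (Fin.castLE_injective _), realMat_one]

theorem colMat_realDiag_mul (x : Fin q → ℝ) (v : Matrix (Fin q) (Fin q) 𝔽) (r : Fin q) :
    colMat (realDiag x * v) r = diagonal (fun p : Fin q × Fin (Module.finrank ℝ 𝔽) => x p.1) * colMat v r := by
  rw [colMat, colMat, ← realMat_realDiag (𝔽 := 𝔽), ← realMat_mul]
  rfl

theorem blockDet_gram_exp (t : Fin q → ℝ) (v : Matrix (Fin q) (Fin q) 𝔽) (r : Fin q) :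
    blockDet (star (realDiag (fun i => Real.exp (t i)) * v) *
      (realDiag (fun i => Real.exp (t i)) * v)) r
      = ((colMat v r)ᵀ * diagonal (fun p : Fin q × Fin (Module.finrank ℝ 𝔽) => Real.exp (2 * t p.1)) * colMat v r).det := by
  rw [blockDet_star_mul_self, colMat_realDiag_mul, transpose_mul, diagonal_transpose,
    Matrix.mul_assoc, ← Matrix.mul_assoc (diagonal _) (diagonal _), diagonal_mul_diagonal,
    ← Matrix.mul_assoc]
  simp only [← Real.exp_add, ← two_mul]

theorem prod_exp_two_mul (t : Fin q → ℝ) (r : Fin q) :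
    ∏ p : Fin (r + 1) × Fin (Module.finrank ℝ 𝔽), Real.exp (2 * t (Fin.castLE r.isLt p.1))
      = Real.exp (2 * Module.finrank ℝ 𝔽 * topSum t r) := by
  rw [← Real.exp_sum, Fintype.sum_prod_type]
  congr 1
  simp only [Finset.sum_const, Finset.card_univ, Fintype.card_fin, nsmul_eq_mul, topSum,
    Finset.mul_sum]
  refine Finset.sum_congr rfl fun i _ => ?_
  ring

theorem isUnit_realDiag_exp (t : Fin q → ℝ) :
    IsUnit (realDiag (fun i => Real.exp (t i)) : Matrix (Fin q) (Fin q) 𝔽) := by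
  refine IsUnit.of_mul_eq_one (realDiag (fun i => Real.exp (-t i))) ?_
  · rw [realDiag, realDiag, diagonal_mul_diagonal]
    simp [← map_mul, ← Real.exp_add]

theorem isUnit_realDiag_exp_mul (t : Fin q → ℝ) (v : UnitaryGroup 𝔽 q) :
    IsUnit (realDiag (fun i => Real.exp (t i)) * (v : Matrix (Fin q) (Fin q) 𝔽)) :=
  (isUnit_realDiag_exp t).mul (Unitary.toUnits v).isUnit

/-- Since `t` is ordered, the leading indices carry the largest entries and `exp (2 * t r)` serves
as the threshold in `det_transpose_mul_diagonal_mul_le`. -/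
theorem logMinor_exp_mul_le (t : Fin q → ℝ) (ht : Antitone t) (v : UnitaryGroup 𝔽 q) (r : Fin q) :
    logMinor (realDiag (fun i => Real.exp (t i)) * (v : Matrix (Fin q) (Fin q) 𝔽)) r
      ≤ topSum t r := by
  have hd : (0 : ℝ) < Module.finrank ℝ 𝔽 := by exact_mod_cast finrank_real_pos 𝔽
  have hpos := blockDet_star_mul_self_pos (isUnit_realDiag_exp_mul t v) r
  have hle := det_transpose_mul_diagonal_mul_le
    (Prod.map (Fin.castLE r.isLt : Fin (r + 1) → Fin q) (id : Fin (Module.finrank ℝ 𝔽) → _))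
    (castLE_prodMap_injective r) (fun p => Real.exp (2 * t p.1)) (fun _ => Real.exp_pos _)
    (Real.exp (2 * t r)) (Real.exp_pos _) (fun j => by
      have : Fin.castLE r.isLt j.1 ≤ r := Fin.le_def.mpr (by have := j.1.isLt; simp; omega)
      have := ht this
      simp only [Prod.map_fst, Real.exp_le_exp]
      linarith) (fun p hp => by
      have : r ≤ p.1 := by
        by_contra hlt
        exact hp ⟨(⟨p.1, by have := Fin.lt_def.mp (not_le.mp hlt); omega⟩, p.2), rfl⟩
      have := ht this
      simp only [Real.exp_le_exp]
      linarith) _ (colMat_unitary v r)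
  rw [← blockDet_gram_exp] at hle
  have h2 : ∏ j : Fin (r + 1) × Fin (Module.finrank ℝ 𝔽), Real.exp (2 * t (Prod.map
      (Fin.castLE r.isLt : Fin (r + 1) → Fin q) (id : Fin (Module.finrank ℝ 𝔽) → _) j).1)
      = Real.exp (2 * Module.finrank ℝ 𝔽 * topSum t r) := prod_exp_two_mul t r
  rw [h2] at hle
  rw [logMinor_eq]
  have h3 := Real.log_le_log hpos hle
  rw [Real.log_exp] at h3
  calc _ ≤ 1 / (2 * Module.finrank ℝ 𝔽 : ℝ) * (2 * Module.finrank ℝ 𝔽 * topSum t r) := by gcongr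
    _ = _ := by field_simp

theorem blockDet_sq_mul_le (t : Fin q → ℝ) (v : Matrix (Fin q) (Fin q) 𝔽) (r : Fin q) :
    blockDet v r ^ 2 * Real.exp (2 * Module.finrank ℝ 𝔽 * topSum t r) ≤
      blockDet (star (realDiag (fun i => Real.exp (t i)) * v) *
        (realDiag (fun i => Real.exp (t i)) * v)) r := by
  have hle := det_sq_mul_prod_le_det
    (Prod.map (Fin.castLE r.isLt : Fin (r + 1) → Fin q) (id : Fin (Module.finrank ℝ 𝔽) → _))
    (castLE_prodMap_injective r) (fun p => Real.exp (2 * t p.1)) (fun _ => Real.exp_pos _)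
    (colMat v r)
  rw [← blockDet_gram_exp] at hle
  have h2 : ∏ j : Fin (r + 1) × Fin (Module.finrank ℝ 𝔽), Real.exp (2 * t (Prod.map
      (Fin.castLE r.isLt : Fin (r + 1) → Fin q) (id : Fin (Module.finrank ℝ 𝔽) → _) j).1)
      = Real.exp (2 * Module.finrank ℝ 𝔽 * topSum t r) := prod_exp_two_mul t r
  rw [h2] at hle
  exact hle

/-- The loss against the upper bound depends on `v` only, not on `t`. This uniformity drives the
estimate of the defect. -/
theorem le_logMinor_exp_mul (t : Fin q → ℝ) (v : UnitaryGroup 𝔽 q) (r : Fin q)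
    (h0 : blockDet (v : Matrix (Fin q) (Fin q) 𝔽) r ≠ 0) :
    topSum t r + 1 / Module.finrank ℝ 𝔽 * Real.log |blockDet (v : Matrix (Fin q) (Fin q) 𝔽) r| ≤
      logMinor (realDiag (fun i => Real.exp (t i)) * (v : Matrix (Fin q) (Fin q) 𝔽)) r := by
  have hd : (0 : ℝ) < Module.finrank ℝ 𝔽 := by exact_mod_cast finrank_real_pos 𝔽
  have hle := blockDet_sq_mul_le t (v : Matrix (Fin q) (Fin q) 𝔽) r
  have h3 := Real.log_le_log (by positivity) hle
  rw [Real.log_mul (by positivity) (by positivity), Real.log_exp, Real.log_pow,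
    ← Real.log_abs] at h3
  rw [logMinor_eq]
  calc _ = 1 / (2 * Module.finrank ℝ 𝔽 : ℝ) *
        (((2 : ℕ) : ℝ) * Real.log |blockDet (v : Matrix (Fin q) (Fin q) 𝔽) r|
          + 2 * Module.finrank ℝ 𝔽 * topSum t r) := by push_cast; field_simp; ring
    _ ≤ _ := by gcongr

theorem abs_blockDet_le_one (v : UnitaryGroup 𝔽 q) (r : Fin q) :
    |blockDet (v : Matrix (Fin q) (Fin q) 𝔽) r| ≤ 1 := by
  have hle := blockDet_sq_mul_le 0 (v : Matrix (Fin q) (Fin q) 𝔽) r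
  rw [blockDet_gram_exp] at hle
  simp [topSum, colMat_unitary] at hle
  exact hle

theorem logMinor_exp (t : Fin q → ℝ) (ht : Antitone t) (r : Fin q) :
    logMinor (realDiag (fun i => Real.exp (t i)) : Matrix (Fin q) (Fin q) 𝔽) r = topSum t r := by
  have h1 := logMinor_exp_mul_le (𝔽 := 𝔽) t ht 1 r
  have h2 := le_logMinor_exp_mul (𝔽 := 𝔽) t 1 r (by simp [blockDet_one])
  simp only [OneMemClass.coe_one, mul_one, blockDet_one] at h1 h2
  simp at h2
  exact le_antisymm h1 h2

/-- A cruder two-sided bound valid without ordering, from `exp (-2c) ≤ exp (2 t_i) ≤ exp (2c)` with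
`c = ∑ |t_i|`. It supplies domination for all integrals of `logMinor`. -/
theorem abs_logMinor_exp_mul_le (t : Fin q → ℝ) (v : UnitaryGroup 𝔽 q) (r : Fin q) :
    |logMinor (realDiag (fun i => Real.exp (t i)) * (v : Matrix (Fin q) (Fin q) 𝔽)) r|
      ≤ q * ∑ i, |t i| := by
  have hd : (0 : ℝ) < Module.finrank ℝ 𝔽 := by exact_mod_cast finrank_real_pos 𝔽
  set c := ∑ i, |t i| with hc
  have hti : ∀ i, |t i| ≤ c := fun i =>
    Finset.single_le_sum (f := fun i => |t i|) (fun i _ => abs_nonneg _) (Finset.mem_univ i)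
  have hc0 : 0 ≤ c := Finset.sum_nonneg fun i _ => abs_nonneg _
  have hJ := colMat_unitary v r
  set J := colMat (v : Matrix (Fin q) (Fin q) 𝔽) r with hJdef
  have hJc : ∀ s : ℝ, Jᵀ * diagonal (fun _ : Fin q × Fin (Module.finrank ℝ 𝔽) => Real.exp s) * J =
      Real.exp s • (1 : Matrix (Fin (r + 1) × Fin (Module.finrank ℝ 𝔽))
      (Fin (r + 1) × Fin (Module.finrank ℝ 𝔽)) ℝ) := fun s => by
    rw [← smul_one_eq_diagonal, Matrix.mul_smul, Matrix.smul_mul, Matrix.mul_one, hJ]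
  have hpd : ∀ s : ℝ, (Real.exp s • (1 : Matrix (Fin (r + 1) × Fin (Module.finrank ℝ 𝔽))
      (Fin (r + 1) × Fin (Module.finrank ℝ 𝔽)) ℝ)).PosDef := fun s =>
    PosDef.one.smul (Real.exp_pos s)
  have hdet : ∀ s : ℝ, (Real.exp s • (1 : Matrix (Fin (r + 1) × Fin (Module.finrank ℝ 𝔽))
      (Fin (r + 1) × Fin (Module.finrank ℝ 𝔽)) ℝ)).det
        = Real.exp ((r + 1) * Module.finrank ℝ 𝔽 * s) := fun s => by
    rw [det_smul, det_one, mul_one, ← Real.exp_nat_mul]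
    simp
  have hmono : ∀ x y : Fin q × Fin (Module.finrank ℝ 𝔽) → ℝ, (∀ p, x p ≤ y p) →
      (Jᵀ * diagonal y * J - Jᵀ * diagonal x * J).PosSemidef := fun x y hxy => by
    rw [← Matrix.sub_mul, ← Matrix.mul_sub, diagonal_sub]
    have := (PosSemidef.diagonal (d := fun p => y p - x p)
      (fun p => sub_nonneg.mpr (hxy p))).conjTranspose_mul_mul_same J
    simpa using this
  have hJinj : Function.Injective J.mulVec := fun v w h => by
    have := congrArg (Jᵀ.mulVec) h
    simpa [mulVec_mulVec, hJ] using this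
  have hpdt : (Jᵀ * diagonal (fun p : Fin q × Fin (Module.finrank ℝ 𝔽) => Real.exp (2 * t p.1)) * J).PosDef := by
    have := (PosDef.diagonal (d := fun p : Fin q × Fin (Module.finrank ℝ 𝔽) =>
      Real.exp (2 * t p.1)) (fun p => Real.exp_pos _)).conjTranspose_mul_mul_same (B := J) hJinj
    simpa using this
  have hlow : Real.exp ((r + 1) * Module.finrank ℝ 𝔽 * (-(2 * c))) ≤
      (Jᵀ * diagonal (fun p : Fin q × Fin (Module.finrank ℝ 𝔽) => Real.exp (2 * t p.1)) * J).det := by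
    rw [← hdet]
    refine det_le_det_of_posSemidef_sub (hpd _) ?_
    rw [← hJc]
    refine hmono _ _ fun p => Real.exp_le_exp.mpr ?_
    have := (abs_le.mp (hti p.1)).1
    linarith
  have hupp : (Jᵀ * diagonal (fun p : Fin q × Fin (Module.finrank ℝ 𝔽) => Real.exp (2 * t p.1)) * J).det ≤
      Real.exp ((r + 1) * Module.finrank ℝ 𝔽 * (2 * c)) := by
    rw [← hdet]
    refine det_le_det_of_posSemidef_sub hpdt ?_
    rw [← hJc]
    refine hmono _ _ fun p => Real.exp_le_exp.mpr ?_
    have := (abs_le.mp (hti p.1)).2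
    linarith
  have l1 := Real.log_le_log (Real.exp_pos _) hlow
  have l2 := Real.log_le_log hpdt.det_pos hupp
  rw [Real.log_exp] at l1 l2
  have hr : ((r : ℕ) + 1 : ℝ) ≤ q := by exact_mod_cast r.isLt
  rw [logMinor_eq, blockDet_gram_exp, abs_mul, abs_of_pos (by positivity)]
  have l3 : |Real.log (Jᵀ * diagonal (fun p : Fin q × Fin (Module.finrank ℝ 𝔽) => Real.exp (2 * t p.1)) * J).det| ≤
      (r + 1) * Module.finrank ℝ 𝔽 * (2 * c) := by
    rw [abs_le]; exact ⟨by linarith, l2⟩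
  calc _ ≤ 1 / (2 * Module.finrank ℝ 𝔽 : ℝ) * ((r + 1) * Module.finrank ℝ 𝔽 * (2 * c)) := by
        gcongr
    _ = (r + 1) * c := by field_simp
    _ ≤ q * c := by gcongr

theorem star_realDiag (x : Fin q → ℝ) :
    star (realDiag x : Matrix (Fin q) (Fin q) 𝔽) = realDiag x := by
  rw [realDiag, star_eq_conjTranspose, diagonal_conjTranspose]
  congr 1
  ext i
  simp [star_algebraMap_real]

/-- The singular value decomposition. -/
theorem exists_singularValueDecomposition (g : GL (Fin q) 𝔽) :
    Antitone (logSingularSpectrum g) ∧ ∃ k l : UnitaryGroup 𝔽 q,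
      (g : Matrix (Fin q) (Fin q) 𝔽) = (k : Matrix (Fin q) (Fin q) 𝔽) *
        realDiag (fun i => Real.exp (logSingularSpectrum g i)) * l.1 := by
  set G := (g : Matrix (Fin q) (Fin q) 𝔽) with hG
  have hex : ∃ x, IsOrderedSpectrum (star G * G) x :=
    exists_isOrderedSpectrum _ (by rw [star_mul, star_star])
  have hspec : IsOrderedSpectrum (star G * G) (orderedSpectrum (star G * G)) := by
    rw [orderedSpectrum, dif_pos hex]; exact hex.choose_spec
  set x := orderedSpectrum (star G * G) with hx
  obtain ⟨hanti, u, hu⟩ := hspec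
  have huu := Unitary.star_mul_self_of_mem u.2
  have huu' := Unitary.mul_star_self_of_mem u.2
  set U := (u : Matrix (Fin q) (Fin q) 𝔽) with hU
  have hGU : star (G * U) * (G * U) = realDiag x := by
    calc star (G * U) * (G * U) = star U * (star G * G) * U := by
          rw [star_mul]; simp only [mul_assoc]
      _ = (star U * U) * realDiag x * (star U * U) := by rw [hu]; simp only [mul_assoc]
      _ = realDiag x := by rw [huu, one_mul, mul_one]
  have hUu : IsUnit U := (Unitary.toUnits u).isUnit
  -- The chosen spectrum is a priori just real; positivity is read off the diagonal of a positive
  -- definite realification.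
  have hxpos : ∀ i, 0 < x i := by
    have h := posDef_realMat_star_mul_self (g.isUnit.mul hUu)
    rw [← hG, hGU, realMat_realDiag] at h
    intro i
    have h1 := h.diag_pos (i := (i, ⟨0, finrank_real_pos 𝔽⟩))
    simpa using h1
  have hs : ∀ i, singularSpectrum g i = √(x i) := fun i => rfl
  have hl : ∀ i, Real.exp (logSingularSpectrum g i) = √(x i) := fun i => by
    rw [logSingularSpectrum, hs, Real.exp_log (Real.sqrt_pos.mpr (hxpos i))]
  refine ⟨fun i j hij => ?_, ?_⟩
  · rw [logSingularSpectrum, logSingularSpectrum, hs, hs]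
    exact Real.log_le_log (Real.sqrt_pos.mpr (hxpos j)) (Real.sqrt_le_sqrt (hanti hij))
  have e : (fun i => Real.exp (logSingularSpectrum g i)) = fun i => √(x i) := funext hl
  rw [e]
  have hmulDiag : ∀ y z : Fin q → ℝ,
      (realDiag y * realDiag z : Matrix (Fin q) (Fin q) 𝔽) = realDiag fun i => y i * z i :=
    fun y z => by simp only [realDiag, diagonal_mul_diagonal, map_mul]
  have hdiag1 : (realDiag (fun _ => 1) : Matrix (Fin q) (Fin q) 𝔽) = 1 := by
    simp [realDiag]
  have hinv : ∀ i, (√(x i))⁻¹ * √(x i) = 1 := fun i =>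
    inv_mul_cancel₀ (Real.sqrt_pos.mpr (hxpos i)).ne'
  have h1 : star (G * U * realDiag fun i => (√(x i))⁻¹) * (G * U * realDiag fun i => (√(x i))⁻¹)
      = 1 := by
    rw [star_mul, star_realDiag, mul_assoc, ← mul_assoc (star (G * U)), hGU, hmulDiag, hmulDiag,
      ← hdiag1]
    congr 1
    ext i
    have h := Real.mul_self_sqrt (hxpos i).le
    have h2 := (Real.sqrt_pos.mpr (hxpos i)).ne'
    rw [← h]
    field_simp
    (rw [Real.sqrt_sq_eq_abs]; simp)
  have hmem : (G * U * realDiag fun i => (√(x i))⁻¹) ∈ unitary (Matrix (Fin q) (Fin q) 𝔽) := by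
    rw [Unitary.mem_iff]
    exact ⟨h1, mul_eq_one_comm.mp h1⟩
  refine ⟨⟨_, hmem⟩, star u, ?_⟩
  calc G = G * (U * star U) := by rw [huu', mul_one]
    _ = G * U * (realDiag (fun i => (√(x i))⁻¹) * realDiag fun i => √(x i)) * star U := by
      rw [hmulDiag]; simp only [hinv, hdiag1, mul_one, mul_assoc]
    _ = _ := by simp only [mul_assoc]; rfl

end Gram

end BiinvariantWalk
end

noncomputable section

namespace BiinvariantWalk

open Matrix
open scoped ENNReal

/-! ### Uniform integrability of negative powers of monic polynomials -/

section MonicBound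

/-- The singularity `|y|^(-1/2)` is integrable near `0`, the integrand is at most `1` once `|s - x|
> 1`, and translation invariance makes the bound uniform in `x`. -/
theorem exists_lintegral_inv_sqrt_le :
    ∃ C : ℝ≥0∞, C ≠ ∞ ∧ ∀ x : ℝ,
      ∫⁻ s in Set.Icc (0 : ℝ) 1, (ENNReal.ofReal (|s - x| ^ (1 / 2 : ℝ)))⁻¹ ≤ C := by
  let h : ℝ → ℝ≥0∞ := (Set.Ioc (0 : ℝ) 1).indicator fun y => ENNReal.ofReal (y ^ (-(1 / 2) : ℝ))
  have hmeas : Measurable h :=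
    Measurable.indicator (by fun_prop) measurableSet_Ioc
  have hfin : ∫⁻ y, h y < ∞ := by
    rw [lintegral_indicator measurableSet_Ioc]
    have h1 : IntervalIntegrable (fun y : ℝ => y ^ (-(1 / 2) : ℝ)) volume 0 1 :=
      intervalIntegral.intervalIntegrable_rpow' (by norm_num)
    rw [intervalIntegrable_iff_integrableOn_Ioc_of_le zero_le_one] at h1
    exact h1.lintegral_lt_top
  refine ⟨(∫⁻ y, h y) + (∫⁻ y, h y) + 1, by finiteness, fun x => ?_⟩
  have hle : ∀ᵐ s : ℝ, s ∈ Set.Icc (0 : ℝ) 1 →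
      (ENNReal.ofReal (|s - x| ^ (1 / 2 : ℝ)))⁻¹ ≤ h (s - x) + h (x - s) + 1 := by
    have hne : ∀ᵐ s : ℝ, s ≠ x := by simp [ae_iff]
    filter_upwards [hne] with s hs _
    have hinv : (ENNReal.ofReal (|s - x| ^ (1 / 2 : ℝ)))⁻¹
        = ENNReal.ofReal (|s - x| ^ (-(1 / 2) : ℝ)) := by
      have : 0 < |s - x| := abs_pos.mpr (sub_ne_zero.mpr hs)
      rw [← ENNReal.ofReal_inv_of_pos (by positivity), Real.rpow_neg this.le]
    rw [hinv]
    rcases le_or_gt |s - x| 1 with h1 | h1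
    · rcases lt_or_gt_of_ne hs with hlt | hgt
      · have e : |s - x| = x - s := by rw [abs_sub_comm, abs_of_pos (sub_pos.mpr hlt)]
        rw [e] at h1 ⊢
        have : h (x - s) = ENNReal.ofReal ((x - s) ^ (-(1 / 2) : ℝ)) :=
          Set.indicator_of_mem (show x - s ∈ Set.Ioc (0 : ℝ) 1 from ⟨sub_pos.mpr hlt, h1⟩) _
        rw [← this]
        exact le_add_right le_add_self
      · have e : |s - x| = s - x := abs_of_pos (sub_pos.mpr hgt)
        rw [e] at h1 ⊢
        have : h (s - x) = ENNReal.ofReal ((s - x) ^ (-(1 / 2) : ℝ)) :=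
          Set.indicator_of_mem (show s - x ∈ Set.Ioc (0 : ℝ) 1 from ⟨sub_pos.mpr hgt, h1⟩) _
        rw [← this]
        exact le_add_right le_self_add
    · refine le_add_left ?_
      rw [ENNReal.ofReal_le_one]
      exact Real.rpow_le_one_of_one_le_of_nonpos h1.le (by norm_num)
  calc _ ≤ ∫⁻ s in Set.Icc (0 : ℝ) 1, (h (s - x) + h (x - s) + 1) :=
        setLIntegral_mono_ae (by fun_prop) hle
    _ = (∫⁻ s in Set.Icc (0 : ℝ) 1, h (s - x)) + (∫⁻ s in Set.Icc (0 : ℝ) 1, h (x - s)) + 1 := by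
        rw [lintegral_add_left (by fun_prop), lintegral_add_left (by fun_prop)]
        simp
    _ ≤ (∫⁻ s, h (s - x)) + (∫⁻ s, h (x - s)) + 1 := by
        gcongr <;> exact Measure.restrict_le_self
    _ = _ := by rw [lintegral_sub_right_eq_self, lintegral_sub_left_eq_self]

theorem pow_card_le_prod_map {α : Type*} (S : Multiset α) (f : α → ℝ) {a : ℝ} (ha : 0 ≤ a)
    (h : ∀ z ∈ S, a ≤ f z) : a ^ Multiset.card S ≤ (S.map f).prod := by
  induction S using Multiset.induction_on with
  | empty => simp
  | cons z S ih =>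
    rw [Multiset.card_cons, Multiset.map_cons, Multiset.prod_cons, pow_succ']
    exact mul_le_mul (h z (Multiset.mem_cons_self z S))
      (ih fun w hw => h w (Multiset.mem_cons_of_mem hw)) (pow_nonneg ha _)
      (ha.trans (h z (Multiset.mem_cons_self z S)))

open Polynomial in
-- If `z` is a complex root whose real part is nearest to `s`, then `|p(s)| ≥ |s - Re z| ^ m`, so
-- the power `1 / (2m)` leaves a singularity of order `1/2`. Summing over all roots removes the
-- dependence of `z` on `s`.
theorem exists_lintegral_inv_monic_le (m : ℕ) (hm : 0 < m) :
    ∃ C : ℝ≥0∞, C ≠ ∞ ∧ ∀ p : ℝ[X], p.Monic → p.natDegree = m →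
      ∫⁻ s in Set.Icc (0 : ℝ) 1, (ENNReal.ofReal (|p.eval s| ^ (1 / (2 * m) : ℝ)))⁻¹ ≤ C := by
  obtain ⟨C, hC, hCb⟩ := exists_lintegral_inv_sqrt_le
  refine ⟨m * C, by finiteness, fun p hp hpm => ?_⟩
  let pc := p.map (algebraMap ℝ ℂ)
  have hs : pc.Splits := IsAlgClosed.splits pc
  have hcard : Multiset.card pc.roots = m := by
    rw [← hs.natDegree_eq_card_roots, natDegree_map, hpm]
  have heval : ∀ s : ℝ, |p.eval s| = (pc.roots.map fun z => ‖(s : ℂ) - z‖).prod := fun s => by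
    have h1 := hs.eval_eq_prod_roots_of_monic (hp.map _) (s : ℂ)
    have h2 : pc.eval (s : ℂ) = ((p.eval s : ℝ) : ℂ) := by
      rw [eval_map]
      exact eval₂_at_apply (algebraMap ℝ ℂ) s
    rw [h2] at h1
    rw [← Real.norm_eq_abs, ← Complex.norm_real, h1]
    exact (map_multiset_prod (normHom : ℂ →*₀ ℝ) _).trans (by rw [Multiset.map_map]; rfl)
  have hle : ∀ s : ℝ, (ENNReal.ofReal (|p.eval s| ^ (1 / (2 * m) : ℝ)))⁻¹ ≤
      ∑ z ∈ pc.roots.toFinset, (ENNReal.ofReal (|s - z.re| ^ (1 / 2 : ℝ)))⁻¹ := fun s => by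
    have hne : pc.roots.toFinset.Nonempty := by
      rw [Multiset.toFinset_nonempty, ← Multiset.card_pos, hcard]; exact hm
    obtain ⟨z, hz, hmin⟩ := Finset.exists_min_image _ (fun z : ℂ => |s - z.re|) hne
    refine le_trans ?_ (Finset.single_le_sum
      (f := fun z : ℂ => (ENNReal.ofReal (|s - z.re| ^ (1 / 2 : ℝ)))⁻¹)
      (fun _ _ => zero_le) hz)
    rw [ENNReal.inv_le_inv]
    refine ENNReal.ofReal_le_ofReal ?_
    have h1 : |s - z.re| ^ m ≤ |p.eval s| := by
      rw [heval, ← hcard]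
      refine pow_card_le_prod_map _ _ (abs_nonneg _) fun w hw => ?_
      refine (hmin w (Multiset.mem_toFinset.mpr hw)).trans ?_
      have := Complex.abs_re_le_norm ((s : ℂ) - w)
      simpa using this
    have hm' : (0 : ℝ) < m := by exact_mod_cast hm
    calc |s - z.re| ^ (1 / 2 : ℝ) = (|s - z.re| ^ m) ^ (1 / (2 * m) : ℝ) := by
          rw [← Real.rpow_natCast, ← Real.rpow_mul (abs_nonneg _)]
          congr 1
          field_simp
      _ ≤ _ := Real.rpow_le_rpow (by positivity) h1 (by positivity)
  calc _ ≤ ∫⁻ s in Set.Icc (0 : ℝ) 1,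
        ∑ z ∈ pc.roots.toFinset, (ENNReal.ofReal (|s - z.re| ^ (1 / 2 : ℝ)))⁻¹ :=
        lintegral_mono hle
    _ = ∑ z ∈ pc.roots.toFinset, ∫⁻ s in Set.Icc (0 : ℝ) 1,
        (ENNReal.ofReal (|s - z.re| ^ (1 / 2 : ℝ)))⁻¹ :=
        lintegral_finsetSum _ fun z _ => by fun_prop
    _ ≤ ∑ z ∈ pc.roots.toFinset, C := Finset.sum_le_sum fun z _ => hCb z.re
    _ ≤ m * C := by
        rw [Finset.sum_const, nsmul_eq_mul]
        gcongr
        exact (Multiset.toFinset_card_le _).trans hcard.le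

/-- As a function of `s`, the determinant is the characteristic polynomial of `-N`: monic of fixed
degree, whence uniformity in `N`. -/
theorem exists_lintegral_inv_det_add_smul_one_le (n : Type*) [Fintype n] [DecidableEq n]
    [Nonempty n] : ∃ C : ℝ≥0∞, C ≠ ∞ ∧ ∀ N : Matrix n n ℝ,
      ∫⁻ s in Set.Icc (0 : ℝ) 1, (ENNReal.ofReal
        (|(N + s • (1 : Matrix n n ℝ)).det| ^ (1 / (2 * Fintype.card n) : ℝ)))⁻¹ ≤ C := by
  obtain ⟨C, hC, h⟩ := exists_lintegral_inv_monic_le (Fintype.card n) Fintype.card_pos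
  refine ⟨C, hC, fun N => ?_⟩
  have h1 := h (-N).charpoly (charpoly_monic _) (charpoly_natDegree_eq_dim _)
  have h2 : ∀ s : ℝ, (-N).charpoly.eval s = (N + s • (1 : Matrix n n ℝ)).det := fun s => by
    rw [eval_charpoly, sub_neg_eq_add, add_comm, scalar_apply, ← smul_one_eq_diagonal]
  simpa only [h2] using h1

end MonicBound

/-! ### Haar integrability of negative powers of leading block determinants -/

section HaarBound

variable (𝔽 : Type*) [NormedDivisionRing 𝔽] [NormedAlgebra ℝ 𝔽] [StarRing 𝔽]
  [IsRealComplexOrQuaternion 𝔽] {q : ℕ}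

theorem properSpace_field : ProperSpace 𝔽 := FiniteDimensional.proper ℝ 𝔽

instance instSecondCountableMatrix : SecondCountableTopology (Matrix (Fin q) (Fin q) 𝔽) :=
  haveI := properSpace_field 𝔽
  inferInstanceAs (SecondCountableTopology (Fin q → Fin q → 𝔽))

instance instLocallyCompactMatrix : LocallyCompactSpace (Matrix (Fin q) (Fin q) 𝔽) :=
  haveI := properSpace_field 𝔽
  inferInstanceAs (LocallyCompactSpace (Fin q → Fin q → 𝔽))

instance instIsHaarMeasureHaarUnitary : (haarUnitary 𝔽 q).IsHaarMeasure :=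
  inferInstanceAs (Measure.haarMeasure ⊤).IsHaarMeasure

instance instIsProbabilityMeasureHaarUnitary : IsProbabilityMeasure (haarUnitary 𝔽 q) :=
  ⟨Measure.haarMeasure_self⟩

instance instIsMulRightInvariantHaarUnitary : (haarUnitary 𝔽 q).IsMulRightInvariant where
  map_mul_right_eq_self k := by
    have : IsProbabilityMeasure ((haarUnitary 𝔽 q).map (· * k)) :=
      Measure.isProbabilityMeasure_map (by fun_prop)
    exact Measure.isHaarMeasure_eq_of_isProbabilityMeasure _ _

variable {𝔽}

theorem continuous_blockDet (r : Fin q) :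
    Continuous fun g : Matrix (Fin q) (Fin q) 𝔽 => blockDet g r :=
  (continuous_realMat.comp (continuous_id.matrix_submatrix _ _)).matrix_det

/-- The exponent in the singular integrals below. -/
def blockExponent (𝔽 : Type*) [NormedDivisionRing 𝔽] [NormedAlgebra ℝ 𝔽] (r : Fin q) : ℝ :=
  1 / (2 * Fintype.card (Fin (r + 1) × Fin (Module.finrank ℝ 𝔽)))

theorem blockExponent_pos (r : Fin q) : 0 < blockExponent 𝔽 r := by
  have : Nonempty (Fin (Module.finrank ℝ 𝔽)) := ⟨⟨0, finrank_real_pos 𝔽⟩⟩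
  have : 0 < Fintype.card (Fin (r + 1) × Fin (Module.finrank ℝ 𝔽)) := Fintype.card_pos
  rw [blockExponent]
  positivity

/-- A negative power of the leading block determinant, infinite where the latter vanishes. -/
def blockSing (r : Fin q) (g : Matrix (Fin q) (Fin q) 𝔽) : ℝ≥0∞ :=
  (ENNReal.ofReal (|blockDet g r| ^ blockExponent 𝔽 r))⁻¹

theorem measurable_blockSing (r : Fin q) :
    Measurable (blockSing r : Matrix (Fin q) (Fin q) 𝔽 → ℝ≥0∞) := by
  have := (continuous_blockDet (𝔽 := 𝔽) r).measurable
  unfold blockSing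
  fun_prop

theorem exists_lintegral_blockSing_add_le (r : Fin q) :
    ∃ C : ℝ≥0∞, C ≠ ∞ ∧ ∀ Y : Matrix (Fin q) (Fin q) 𝔽,
      ∫⁻ s in Set.Icc (0 : ℝ) 1,
        blockSing r (Y + diagonal fun _ => algebraMap ℝ 𝔽 s) ≤ C := by
  have : Nonempty (Fin (Module.finrank ℝ 𝔽)) := ⟨⟨0, finrank_real_pos 𝔽⟩⟩
  obtain ⟨C, hC, h⟩ := exists_lintegral_inv_det_add_smul_one_le
    (Fin (r + 1) × Fin (Module.finrank ℝ 𝔽))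
  refine ⟨C, hC, fun Y => ?_⟩
  have h1 : ∀ s : ℝ, blockDet (Y + diagonal fun _ => algebraMap ℝ 𝔽 s) r =
      (realMat (Y.submatrix (Fin.castLE r.isLt : Fin (r + 1) → Fin q) (Fin.castLE r.isLt))
        + s • 1).det := fun s => by
    rw [blockDet, ← realMat_real_smul_one, ← realMat_add]
    congr 2
    ext i j
    simp [diagonal_apply, (Fin.castLE_injective _).eq_iff]
  simpa only [blockSing, h1, blockExponent] using h _

/-- No explicit form of the Haar measure is needed. The bound along lines `Y + s` gives a bound of
the Lebesgue integral over `Z ∈ B` of the singular function at `u Z`, uniform in `u`. By Fubini some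
fixed `Z` has a finite integral over `u`, and QR with right invariance reduces `Z` to the identity.
-/
theorem lintegral_blockSing_lt_top (r : Fin q) :
    ∫⁻ u : UnitaryGroup 𝔽 q, blockSing r u.1 ∂(haarUnitary 𝔽 q) < ∞ := by
  obtain ⟨C, hC, hCb⟩ := exists_lintegral_blockSing_add_le (𝔽 := 𝔽) r
  let μ : Measure (Matrix (Fin q) (Fin q) 𝔽) := Measure.addHaar
  obtain ⟨B, hBc, hB0⟩ := exists_compact_mem_nhds (0 : Matrix (Fin q) (Fin q) 𝔽)
  have hBm : MeasurableSet B := hBc.measurableSet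
  have hμB : 0 < μ B := lt_of_lt_of_le
    (isOpen_interior.measure_pos μ ⟨0, mem_interior_iff_mem_nhds.mpr hB0⟩)
    (measure_mono interior_subset)
  let F : Matrix (Fin q) (Fin q) 𝔽 × ℝ × UnitaryGroup 𝔽 q → Matrix (Fin q) (Fin q) 𝔽 :=
    fun p => p.1 - p.2.1 • star p.2.2.1
  have hFc : Continuous F := by fun_prop
  -- A single compact set containing every translate of `B` by `-s u*`, so that the constant below
  -- does not depend on `u`.
  let B' := F '' (B ×ˢ Set.Icc (0 : ℝ) 1 ×ˢ Set.univ)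
  have hB'c : IsCompact B' :=
    (hBc.prod (isCompact_Icc.prod isCompact_univ)).image hFc
  have hB'm : MeasurableSet B' := hB'c.measurableSet
  have hmul : Measurable fun p : UnitaryGroup 𝔽 q × Matrix (Fin q) (Fin q) 𝔽 =>
      blockSing r (p.1.1 * p.2) := by
    have hc : Continuous fun p : UnitaryGroup 𝔽 q × Matrix (Fin q) (Fin q) 𝔽 => p.1.1 * p.2 := by
      fun_prop
    exact (measurable_blockSing r).comp hc.measurable
  have hone : ∀ u : UnitaryGroup 𝔽 q, ∫⁻ Z in B, blockSing r (u.1 * Z) ∂μ ≤ C * μ B' := by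
    intro u
    have hmeas : Measurable fun p : ℝ × Matrix (Fin q) (Fin q) 𝔽 =>
        blockSing r (u.1 * p.2 + diagonal fun _ => algebraMap ℝ 𝔽 p.1) := by
      have hc : Continuous fun p : ℝ × Matrix (Fin q) (Fin q) 𝔽 =>
          u.1 * p.2 + diagonal fun _ => algebraMap ℝ 𝔽 p.1 := by
        have : Continuous (algebraMap ℝ 𝔽) := continuous_algebraMap ℝ 𝔽
        refine (continuous_const.mul continuous_snd).add ?_
        exact (continuous_pi fun _ => this.comp continuous_fst).matrix_diagonal
      exact (measurable_blockSing r).comp hc.measurable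
    -- Translating `Z` by `s u*` adds the scalar `s` to `u Z`, which creates the one-parameter
    -- family bounded above.
    have hs : ∀ s ∈ Set.Icc (0 : ℝ) 1, ∫⁻ Z in B, blockSing r (u.1 * Z) ∂μ ≤
        ∫⁻ Z in B', blockSing r (u.1 * Z + diagonal fun _ => algebraMap ℝ 𝔽 s) ∂μ := by
      intro s hs
      rw [← lintegral_indicator hBm, ← lintegral_indicator hB'm,
        ← lintegral_add_right_eq_self _ (s • star u.1)]
      refine lintegral_mono fun Z => ?_
      by_cases hZ : Z + s • star u.1 ∈ B
      · have hZ' : Z ∈ B' := ⟨(Z + s • star u.1, s, u), ⟨hZ, hs, Set.mem_univ _⟩, by simp [F]⟩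
        rw [Set.indicator_of_mem hZ, Set.indicator_of_mem hZ', mul_add, mul_smul_comm,
          Unitary.mul_star_self_of_mem u.2]
        have : (s • (1 : Matrix (Fin q) (Fin q) 𝔽)) = diagonal fun _ => algebraMap ℝ 𝔽 s := by
          ext i j
          by_cases hij : i = j
          · subst hij; simp [Algebra.algebraMap_eq_smul_one]
          · simp [hij]
        rw [this]
      · rw [Set.indicator_of_notMem hZ]
        exact zero_le
    calc ∫⁻ Z in B, blockSing r (u.1 * Z) ∂μ
        = ∫⁻ _ in Set.Icc (0 : ℝ) 1, ∫⁻ Z in B, blockSing r (u.1 * Z) ∂μ := by simp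
      _ ≤ ∫⁻ s in Set.Icc (0 : ℝ) 1, ∫⁻ Z in B',
            blockSing r (u.1 * Z + diagonal fun _ => algebraMap ℝ 𝔽 s) ∂μ :=
          setLIntegral_mono' measurableSet_Icc hs
      _ = ∫⁻ Z in B', (∫⁻ s in Set.Icc (0 : ℝ) 1,
            blockSing r (u.1 * Z + diagonal fun _ => algebraMap ℝ 𝔽 s)) ∂μ :=
          lintegral_lintegral_swap hmeas.aemeasurable
      _ ≤ ∫⁻ _ in B', C ∂μ := lintegral_mono fun Z => hCb _
      _ = C * μ B' := by simp
  have htot : ∫⁻ Z in B, ∫⁻ u : UnitaryGroup 𝔽 q, blockSing r (u.1 * Z) ∂(haarUnitary 𝔽 q) ∂μ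
      ≠ ∞ := by
    rw [← lintegral_lintegral_swap hmul.aemeasurable]
    refine ne_top_of_le_ne_top (b := C * μ B')
      (ENNReal.mul_ne_top hC hB'c.measure_ne_top) ?_
    calc _ ≤ ∫⁻ _ : UnitaryGroup 𝔽 q, C * μ B' ∂(haarUnitary 𝔽 q) := lintegral_mono hone
      _ = C * μ B' := by simp
  have hae := ae_lt_top hmul.lintegral_prod_left' htot
  have : (ae (μ.restrict B)).NeBot := by
    rw [ae_neBot]
    intro h
    rw [Measure.restrict_eq_zero] at h
    exact hμB.ne' h
  obtain ⟨Z, hZ⟩ := hae.exists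
  obtain ⟨k, b, rfl, hb⟩ := exists_unitary_mul_upperTriangular Z
  -- The maximum with `1` keeps the comparison constant positive even if `b` is singular.
  set Y := max |blockDet b r| 1 with hY
  have hY0 : 0 < Y := lt_of_lt_of_le one_pos (le_max_right _ _)
  set δ := blockExponent 𝔽 r with hδ
  have hδ0 : 0 < δ := blockExponent_pos r
  have hlow : ∀ u : UnitaryGroup 𝔽 q,
      (ENNReal.ofReal (Y ^ δ))⁻¹ * blockSing r (u * k).1 ≤ blockSing r (u.1 * (k.1 * b)) := by
    intro u
    rw [← mul_assoc, blockSing, blockSing, blockDet_mul_of_upperTriangular _ _ hb,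
      ← ENNReal.mul_inv (Or.inr ENNReal.ofReal_ne_top) (Or.inl ENNReal.ofReal_ne_top),
      ENNReal.inv_le_inv, ← ENNReal.ofReal_mul (by positivity), abs_mul,
      Real.mul_rpow (abs_nonneg _) (abs_nonneg _), mul_comm]
    refine ENNReal.ofReal_le_ofReal ?_
    exact mul_le_mul_of_nonneg_right
      (Real.rpow_le_rpow (abs_nonneg _) (le_max_left _ _) hδ0.le) (by positivity)
  have h1 : (ENNReal.ofReal (Y ^ δ))⁻¹ *
      ∫⁻ u : UnitaryGroup 𝔽 q, blockSing r u.1 ∂(haarUnitary 𝔽 q) < ∞ := by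
    rw [← lintegral_mul_right_eq_self (fun u : UnitaryGroup 𝔽 q => blockSing r u.1) k,
      ← lintegral_const_mul' _ _ (ENNReal.inv_ne_top.mpr (by simp; positivity))]
    exact (lintegral_mono hlow).trans_lt hZ
  by_contra h2
  rw [not_lt, top_le_iff] at h2
  rw [h2, ENNReal.mul_top (ENNReal.inv_ne_zero.mpr ENNReal.ofReal_ne_top)] at h1
  exact lt_irrefl _ h1

/-- The defect of `logMinor` from its maximum is bounded in mean square, uniformly in `t`. -/
theorem exists_lintegral_sq_topSum_sub_le (r : Fin q) :
    ∃ C : ℝ≥0∞, C ≠ ∞ ∧ ∀ (t : Fin q → ℝ), Antitone t → ∀ l : UnitaryGroup 𝔽 q,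
      ∫⁻ u : UnitaryGroup 𝔽 q, ENNReal.ofReal ((topSum t r -
        logMinor (realDiag (fun i => Real.exp (t i)) * (l * u).1) r) ^ 2) ∂(haarUnitary 𝔽 q)
        ≤ C := by
  set δ := blockExponent 𝔽 r with hδ
  have hδ0 : 0 < δ := blockExponent_pos r
  refine ⟨ENNReal.ofReal (2 / δ ^ 2) *
    ∫⁻ u : UnitaryGroup 𝔽 q, blockSing r u.1 ∂(haarUnitary 𝔽 q),
    ENNReal.mul_ne_top ENNReal.ofReal_ne_top (lintegral_blockSing_lt_top r).ne,
    fun t ht l => ?_⟩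
  rw [lintegral_mul_left_eq_self (fun u : UnitaryGroup 𝔽 q => ENNReal.ofReal ((topSum t r -
        logMinor (realDiag (fun i => Real.exp (t i)) * u.1) r) ^ 2)) l,
    ← lintegral_const_mul' _ _ ENNReal.ofReal_ne_top]
  refine lintegral_mono fun u => ?_
  -- On this set the right-hand side is infinite, so the logarithmic lower bound is not needed
  -- there.
  by_cases h0 : blockDet u.1 r = 0
  · have : blockSing r u.1 = ∞ := by
      simp [blockSing, h0, Real.zero_rpow hδ0.ne', ← hδ]
    rw [this, ENNReal.mul_top]
    · exact le_top
    · simp; positivity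
  have hd : (1 : ℝ) ≤ Module.finrank ℝ 𝔽 := by exact_mod_cast finrank_real_pos 𝔽
  have hx : 0 < |blockDet u.1 r| := abs_pos.mpr h0
  have h1 := logMinor_exp_mul_le t ht u r
  have h2 := le_logMinor_exp_mul t u r h0
  have h3 := abs_blockDet_le_one u r
  set x := |blockDet u.1 r| with hxdef
  set D := topSum t r - logMinor (realDiag (fun i => Real.exp (t i)) * u.1) r with hD
  have hy : 0 ≤ -Real.log x := by
    have := Real.log_nonpos hx.le h3
    linarith
  have hDy : D ≤ -Real.log x := by
    have : 1 / (Module.finrank ℝ 𝔽 : ℝ) * (-Real.log x) ≤ 1 * (-Real.log x) := by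
      refine mul_le_mul_of_nonneg_right ?_ hy
      rw [div_le_one (by linarith)]
      exact hd
    rw [hD]
    linarith
  have hD0 : 0 ≤ D := by rw [hD]; linarith
  -- From `y² / 2 ≤ exp y` at `y = -δ log x` one gets `(log x)² ≤ (2 / δ²) x^(-δ)`, the origin of
  -- the constant.
  have hexp := Real.quadratic_le_exp_of_nonneg (mul_nonneg hδ0.le hy)
  have hfin : D ^ 2 ≤ 2 / δ ^ 2 * (x ^ δ)⁻¹ := by
    have e : (x ^ δ)⁻¹ = Real.exp (δ * -Real.log x) := by
      rw [Real.rpow_def_of_pos hx, ← Real.exp_neg]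
      congr 1; ring
    rw [e, div_mul_eq_mul_div, le_div_iff₀ (by positivity)]
    have : D ^ 2 ≤ (-Real.log x) ^ 2 := by gcongr
    nlinarith [mul_nonneg hδ0.le hy, sq_nonneg δ]
  rw [blockSing, ← ENNReal.ofReal_inv_of_pos (by positivity), ← ENNReal.ofReal_mul (by positivity)]
  exact ENNReal.ofReal_le_ofReal hfin

end HaarBound

end BiinvariantWalk
end

noncomputable section

namespace BiinvariantWalk

open Matrix
open scoped ENNReal

/-! ### Passing between partial sums and coordinates -/

section Increments

variable {q : ℕ}

/-- The increments of a finite sequence, starting from the value `0`. -/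
def incr (F : Fin q → ℝ) (j : Fin q) : ℝ :=
  F j - if h : 0 < (j : ℕ) then F ⟨j - 1, by omega⟩ else 0

theorem incr_topSum (t : Fin q → ℝ) : incr (topSum t) = t := by
  have key : ∀ r : Fin q, topSum t r
      = ∑ n ∈ Finset.range (r + 1), if h : n < q then t ⟨n, h⟩ else 0 := fun r => by
    rw [Finset.sum_range, topSum]
    refine Finset.sum_congr rfl fun i _ => ?_
    rw [dif_pos (lt_of_lt_of_le i.isLt r.isLt)]
    rfl
  ext j
  rw [incr, key, Finset.sum_range_succ, dif_pos j.isLt]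
  by_cases h : 0 < (j : ℕ)
  · rw [dif_pos h, key]
    simp only
    rw [Nat.sub_add_cancel h]
    simp
  · have : (j : ℕ) = 0 := by omega
    have hr : Finset.range (j : ℕ) = ∅ := by rw [this]; rfl
    rw [dif_neg h, hr]
    simp

theorem measurable_incr : Measurable (incr : (Fin q → ℝ) → Fin q → ℝ) := by
  refine measurable_pi_lambda _ fun j => ?_
  unfold incr
  split_ifs
  · exact (measurable_pi_apply _).sub (measurable_pi_apply _)
  · exact (measurable_pi_apply _).sub measurable_const

theorem continuous_incr : Continuous (incr : (Fin q → ℝ) → Fin q → ℝ) := by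
  refine continuous_pi fun j => ?_
  unfold incr
  split_ifs
  · exact (continuous_apply _).sub (continuous_apply _)
  · exact (continuous_apply _).sub continuous_const

theorem incr_sub (F G : Fin q → ℝ) : incr (F - G) = incr F - incr G := by
  ext j
  simp only [incr, Pi.sub_apply]
  split_ifs <;> ring

theorem incr_smul (c : ℝ) (F : Fin q → ℝ) : incr (c • F) = c • incr F := by
  ext j
  simp only [incr, Pi.smul_apply, smul_eq_mul]
  split_ifs <;> ring

theorem abs_incr_le (F : Fin q → ℝ) {B : ℝ} (hF : ∀ r, |F r| ≤ B) (j : Fin q) :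
    |incr F j| ≤ 2 * B := by
  have hB : 0 ≤ B := (abs_nonneg _).trans (hF j)
  unfold incr
  split_ifs
  · refine (abs_sub _ _).trans ?_
    linarith [hF j, hF ⟨j - 1, by omega⟩]
  · rw [sub_zero]; linarith [hF j]

theorem integral_incr {α : Type*} [MeasurableSpace α] (μ : Measure α) (F : α → Fin q → ℝ)
    (hF : ∀ r, Integrable (fun a => F a r) μ) (j : Fin q) :
    ∫ a, incr (F a) j ∂μ = incr (fun r => ∫ a, F a r ∂μ) j := by
  unfold incr
  split_ifs with h
  · rw [integral_sub (hF _) (hF _)]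
  · simp

end Increments

/-! ### Measurability of the singular spectrum -/

section Measurability

variable {𝔽 : Type*} [NormedDivisionRing 𝔽] [NormedAlgebra ℝ 𝔽] [StarRing 𝔽]
  [IsRealComplexOrQuaternion 𝔽] {q : ℕ}

theorem continuous_blockDet_gram (r : Fin q) :
    Continuous fun g : Matrix (Fin q) (Fin q) 𝔽 => blockDet (star g * g) r :=
  (continuous_blockDet r).comp (continuous_star.mul continuous_id)

theorem measurable_logMinor (r : Fin q) :
    Measurable fun g : Matrix (Fin q) (Fin q) 𝔽 => logMinor g r := by
  simp only [logMinor_eq]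
  exact ((continuous_blockDet_gram r).measurable.log).const_mul _

theorem continuous_logMinor_comp {α : Type*} [TopologicalSpace α]
    {f : α → Matrix (Fin q) (Fin q) 𝔽} (hf : Continuous f) (hu : ∀ a, IsUnit (f a)) (r : Fin q) :
    Continuous fun a => logMinor (f a) r := by
  simp only [logMinor_eq]
  exact continuous_const.mul (((continuous_blockDet_gram r).comp hf).log
    fun a => (blockDet_star_mul_self_pos (hu a) r).ne')

theorem continuous_realDiag_exp_mul :
    Continuous fun p : (Fin q → ℝ) × UnitaryGroup 𝔽 q =>
      (realDiag (fun i => Real.exp (p.1 i)) * p.2.1 : Matrix (Fin q) (Fin q) 𝔽) := by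
  have h : Continuous (algebraMap ℝ 𝔽) := continuous_algebraMap ℝ 𝔽
  refine Continuous.mul ?_ (continuous_subtype_val.comp continuous_snd)
  refine (continuous_pi fun i => h.comp ?_).matrix_diagonal
  fun_prop

theorem continuous_logMinor_exp_mul (r : Fin q) :
    Continuous fun p : (Fin q → ℝ) × UnitaryGroup 𝔽 q =>
      logMinor (realDiag (fun i => Real.exp (p.1 i)) * p.2.1) r :=
  continuous_logMinor_comp continuous_realDiag_exp_mul
    (fun p => isUnit_realDiag_exp_mul p.1 p.2) r

theorem logMinor_mul_le_topSum (g : GL (Fin q) 𝔽) (u : UnitaryGroup 𝔽 q) (r : Fin q) :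
    logMinor (g.1 * u.1) r ≤ topSum (logSingularSpectrum g) r := by
  obtain ⟨ht, k, l, hg⟩ := exists_singularValueDecomposition g
  rw [hg, mul_assoc, mul_assoc, logMinor_unitary_mul]
  exact logMinor_exp_mul_le _ ht (l * u) r

theorem exists_logMinor_mul_eq_topSum (g : GL (Fin q) 𝔽) :
    ∃ u : UnitaryGroup 𝔽 q, ∀ r, logMinor (g.1 * u.1) r = topSum (logSingularSpectrum g) r := by
  obtain ⟨ht, k, l, hg⟩ := exists_singularValueDecomposition g
  refine ⟨star l, fun r => ?_⟩
  have : l.1 * (star l).1 = 1 := Unitary.mul_star_self_of_mem l.2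
  rw [hg, mul_assoc, mul_assoc, logMinor_unitary_mul, this, mul_one, logMinor_exp _ ht]

/-- The spectrum is defined by choice, so measurability must come from a variational formula: the
partial sum is the maximum over `u` of `logMinor (g u)`, and continuity in `u` reduces this to a
countable supremum. -/
theorem measurable_topSum_logSingularSpectrum (r : Fin q) :
    Measurable fun g : GL (Fin q) 𝔽 => topSum (logSingularSpectrum g) r := by
  have hsc : SecondCountableTopology (UnitaryGroup 𝔽 q) :=
    TopologicalSpace.Subtype.secondCountableTopology _
  have heq : ∀ g : GL (Fin q) 𝔽, topSum (logSingularSpectrum g) r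
      = ⨆ n, logMinor (g.1 * (TopologicalSpace.denseSeq (UnitaryGroup 𝔽 q) n).1) r := fun g => by
    have hbdd : BddAbove (Set.range fun n =>
        logMinor (g.1 * (TopologicalSpace.denseSeq (UnitaryGroup 𝔽 q) n).1) r) :=
      ⟨_, by rintro _ ⟨n, rfl⟩; exact logMinor_mul_le_topSum g _ r⟩
    refine le_antisymm ?_ (ciSup_le fun n => logMinor_mul_le_topSum g _ r)
    obtain ⟨u, hu⟩ := exists_logMinor_mul_eq_topSum g
    rw [← hu r]
    have hc : Continuous fun v : UnitaryGroup 𝔽 q => logMinor (g.1 * v.1) r :=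
      continuous_logMinor_comp (continuous_const.mul continuous_subtype_val)
        (fun v => g.isUnit.mul (Unitary.toUnits v).isUnit) r
    have hclosed : IsClosed {v : UnitaryGroup 𝔽 q | logMinor (g.1 * v.1) r ≤
        ⨆ n, logMinor (g.1 * (TopologicalSpace.denseSeq (UnitaryGroup 𝔽 q) n).1) r} :=
      isClosed_le hc continuous_const
    have hsub : Set.range (TopologicalSpace.denseSeq (UnitaryGroup 𝔽 q)) ⊆
        {v : UnitaryGroup 𝔽 q | logMinor (g.1 * v.1) r ≤
        ⨆ n, logMinor (g.1 * (TopologicalSpace.denseSeq (UnitaryGroup 𝔽 q) n).1) r} := by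
      rintro _ ⟨n, rfl⟩
      exact le_ciSup hbdd n
    exact (hclosed.closure_subset_iff.mpr hsub)
      ((TopologicalSpace.denseRange_denseSeq (UnitaryGroup 𝔽 q)).closure_range ▸ Set.mem_univ u)
  simp only [heq]
  refine Measurable.iSup fun n => ?_
  have hval : Measurable fun g : GL (Fin q) 𝔽 => g.1 := comap_measurable _
  have hc : Continuous fun g : Matrix (Fin q) (Fin q) 𝔽 =>
      g * (TopologicalSpace.denseSeq (UnitaryGroup 𝔽 q) n).1 := continuous_id.mul continuous_const
  exact (measurable_logMinor r).comp (hc.measurable.comp hval)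

theorem measurable_logSingularSpectrum :
    Measurable (logSingularSpectrum : GL (Fin q) 𝔽 → Fin q → ℝ) := by
  have : (logSingularSpectrum : GL (Fin q) 𝔽 → Fin q → ℝ)
      = fun g => incr (topSum (logSingularSpectrum g)) := by
    ext g; rw [incr_topSum]
  rw [this]
  exact measurable_incr.comp
    (measurable_pi_lambda _ fun r => measurable_topSum_logSingularSpectrum r)

end Measurability

/-! ### Estimates and Haar means of `logMinor` at `g* u` -/

section StarEstimates

variable {𝔽 : Type*} [NormedDivisionRing 𝔽] [NormedAlgebra ℝ 𝔽] [StarRing 𝔽]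
  [IsRealComplexOrQuaternion 𝔽] {q : ℕ}

/-- If `g = k e^t l`, then `g* u = l* e^t (k* u)`, and the left unitary factor `l*` is invisible to
`logMinor`. -/
theorem exists_logMinor_star_mul (g : GL (Fin q) 𝔽) : Antitone (logSingularSpectrum g) ∧
    ∃ k : UnitaryGroup 𝔽 q, ∀ (u : UnitaryGroup 𝔽 q) (r : Fin q), logMinor (star g.1 * u.1) r =
      logMinor (realDiag (fun i => Real.exp (logSingularSpectrum g i)) * (k * u).1) r := by
  obtain ⟨ht, k, l, hg⟩ := exists_singularValueDecomposition g
  refine ⟨ht, star k, fun u r => ?_⟩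
  have : star g.1 * u.1 = (star l).1 * (realDiag (fun i => Real.exp (logSingularSpectrum g i)) *
      (star k * u).1) := by
    conv_lhs => rw [hg]
    rw [star_mul, star_mul, star_realDiag]
    simp only [mul_assoc]
    rfl
  rw [this, logMinor_unitary_mul]

theorem abs_logMinor_star_mul_le (g : GL (Fin q) 𝔽) (u : UnitaryGroup 𝔽 q) (r : Fin q) :
    |logMinor (star g.1 * u.1) r| ≤ q * ∑ i, |logSingularSpectrum g i| := by
  obtain ⟨ht, k, h⟩ := exists_logMinor_star_mul g
  rw [h]
  exact abs_logMinor_exp_mul_le _ _ r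

theorem abs_logMinor_star_le (g : GL (Fin q) 𝔽) (r : Fin q) :
    |logMinor (star g.1) r| ≤ q * ∑ i, |logSingularSpectrum g i| := by
  simpa using abs_logMinor_star_mul_le g 1 r

variable (𝔽) in
/-- The mean of `logMinor (e ^ t u)` over the unitary group. -/
def meanLogMinor (t : Fin q → ℝ) (r : Fin q) : ℝ :=
  ∫ u : UnitaryGroup 𝔽 q, logMinor (realDiag (fun i => Real.exp (t i)) * u.1) r ∂(haarUnitary 𝔽 q)

theorem integral_logMinor_star_mul (g : GL (Fin q) 𝔽) (r : Fin q) :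
    ∫ u : UnitaryGroup 𝔽 q, logMinor (star g.1 * u.1) r ∂(haarUnitary 𝔽 q)
      = meanLogMinor 𝔽 (logSingularSpectrum g) r := by
  obtain ⟨ht, k, h⟩ := exists_logMinor_star_mul g
  simp only [h]
  exact integral_mul_left_eq_self (fun u : UnitaryGroup 𝔽 q =>
    logMinor (realDiag (fun i => Real.exp (logSingularSpectrum g i)) * u.1) r) k

theorem exists_lintegral_sq_topSum_sub_star_le (r : Fin q) :
    ∃ C : ℝ≥0∞, C ≠ ∞ ∧ ∀ g : GL (Fin q) 𝔽,
      ∫⁻ u : UnitaryGroup 𝔽 q, ENNReal.ofReal ((topSum (logSingularSpectrum g) r -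
        logMinor (star g.1 * u.1) r) ^ 2) ∂(haarUnitary 𝔽 q) ≤ C := by
  obtain ⟨C, hC, h⟩ := exists_lintegral_sq_topSum_sub_le (𝔽 := 𝔽) r
  refine ⟨C, hC, fun g => ?_⟩
  obtain ⟨ht, k, hk⟩ := exists_logMinor_star_mul g
  simp only [hk]
  exact h _ ht k

theorem measurable_meanLogMinor (r : Fin q) : Measurable fun t => meanLogMinor 𝔽 t r := by
  have h : StronglyMeasurable fun p : (Fin q → ℝ) × UnitaryGroup 𝔽 q =>
      logMinor (realDiag (fun i => Real.exp (p.1 i)) * p.2.1) r :=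
    (continuous_logMinor_exp_mul r).measurable.stronglyMeasurable
  exact h.integral_prod_right.measurable

theorem integrable_logMinor_exp_mul (t : Fin q → ℝ) (r : Fin q) :
    Integrable (fun u : UnitaryGroup 𝔽 q => logMinor (realDiag (fun i => Real.exp (t i)) * u.1) r)
      (haarUnitary 𝔽 q) := by
  refine Integrable.of_bound (C := q * ∑ i, |t i|) ?_ (ae_of_all _ fun u => ?_)
  · exact ((continuous_logMinor_exp_mul r).comp
      (continuous_const.prodMk continuous_id)).aestronglyMeasurable
  · exact abs_logMinor_exp_mul_le t u r

theorem abs_meanLogMinor_le (t : Fin q → ℝ) (r : Fin q) :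
    |meanLogMinor 𝔽 t r| ≤ q * ∑ i, |t i| := by
  have := norm_integral_le_of_norm_le_const (μ := haarUnitary 𝔽 q) (C := q * ∑ i, |t i|)
    (f := fun u : UnitaryGroup 𝔽 q => logMinor (realDiag (fun i => Real.exp (t i)) * u.1) r)
    (ae_of_all _ fun u => abs_logMinor_exp_mul_le t u r)
  simpa [meanLogMinor] using this

end StarEstimates

/-! ### The moment function as a Haar mean -/

section MomentFunction

variable {𝔽 : Type*} [NormedDivisionRing 𝔽] [NormedAlgebra ℝ 𝔽] [StarRing 𝔽]
  [IsRealComplexOrQuaternion 𝔽] {q : ℕ}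

/-- Summation by parts moves the differences from the exponents `μ_r - μ_{r+1}` to the logarithmic
minors; only the difference at `j` survives. -/
theorem powerFunction_single {g : Matrix (Fin q) (Fin q) 𝔽} (hg : IsUnit g) (j : Fin q) (s : ℝ) :
    powerFunction (fun l => (((Pi.single j s : Fin q → ℝ) l : ℝ) : ℂ) / 2) (star g * g)
      = (Real.exp (s * incr (logMinor g) j) : ℂ) := by
  have hterm : ∀ r : Fin q, ((minor (star g * g) r : ℂ) ^
      ((((Pi.single j s : Fin q → ℝ) r : ℝ) : ℂ) / 2 - if h : (r : ℕ) + 1 < q then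
        (((Pi.single j s : Fin q → ℝ) ⟨(r : ℕ) + 1, h⟩ : ℝ) : ℂ) / 2 else 0))
      = ((Real.exp (logMinor g r * (Pi.single j s : Fin q → ℝ) r - logMinor g r *
        if h : (r : ℕ) + 1 < q then (Pi.single j s : Fin q → ℝ) ⟨(r : ℕ) + 1, h⟩ else 0) : ℝ) : ℂ)
      := fun r => by
    have hpos := minor_star_mul_self_pos hg r
    rw [Complex.cpow_def_of_ne_zero (by exact_mod_cast hpos.ne'), ← Complex.ofReal_log hpos.le,
      Complex.ofReal_exp]
    congr 1
    rw [logMinor]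
    split_ifs <;> push_cast <;> ring
  rw [powerFunction]
  simp only [hterm]
  rw [← Complex.ofReal_prod, ← Real.exp_sum]
  congr 2
  rw [Finset.sum_sub_distrib]
  have h1 : ∑ r, logMinor g r * (Pi.single j s : Fin q → ℝ) r = logMinor g j * s := by
    rw [Finset.sum_eq_single j (by intro b _ hb; simp [hb]) (by simp)]
    simp
  have h2 : (∑ r : Fin q, logMinor g r * if h : (r : ℕ) + 1 < q then
      (Pi.single j s : Fin q → ℝ) ⟨(r : ℕ) + 1, h⟩ else 0)
      = (if h : 0 < (j : ℕ) then logMinor g ⟨j - 1, by omega⟩ else 0) * s := by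
    split_ifs with hj
    · rw [Finset.sum_eq_single ⟨j - 1, by omega⟩]
      · have h3 : ((⟨(j : ℕ) - 1, by omega⟩ : Fin q) : ℕ) + 1 < q := by
          have := j.isLt
          simp only; omega
        rw [dif_pos h3]
        have : (⟨((⟨(j : ℕ) - 1, by omega⟩ : Fin q) : ℕ) + 1, h3⟩ : Fin q) = j := by
          ext; simp only; omega
        rw [this, Pi.single_eq_same]
      · intro b _ hb
        split_ifs with h
        · have : (⟨(b : ℕ) + 1, h⟩ : Fin q) ≠ j := by
            rintro rfl
            exact hb (by ext; simp)
          simp [this]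
        · simp
      · simp
    · rw [zero_mul]
      refine Finset.sum_eq_zero fun b _ => ?_
      split_ifs with h
      · have : (⟨(b : ℕ) + 1, h⟩ : Fin q) ≠ j := by
          rintro rfl
          simp at hj
        simp [this]
      · simp
  rw [h1, h2, incr]
  ring

/-- The shift by `-iρ` cancels `ρ` in the exponent, leaving half the real vector `s e_j`, so the
integrand is a real exponential. -/
theorem spherical_single (t : Fin q → ℝ) (j : Fin q) (s : ℝ) :
    spherical 𝔽 (fun l => -Complex.I * (halfSum 𝔽 l : ℂ)
      - Complex.I * (Pi.single j s : Fin q → ℝ) l) t =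
      ((∫ u : UnitaryGroup 𝔽 q, Real.exp (s * incr (logMinor
        (realDiag (fun i => Real.exp (t i)) * u.1)) j) ∂(haarUnitary 𝔽 q) : ℝ) : ℂ) := by
  rw [spherical, ← integral_complex_ofReal]
  congr 1
  ext u
  have h1 : (fun l => (Complex.I * (-Complex.I * (halfSum 𝔽 l : ℂ)
      - Complex.I * (Pi.single j s : Fin q → ℝ) l) - (halfSum 𝔽 l : ℂ)) / 2)
      = fun l => (((Pi.single j s : Fin q → ℝ) l : ℝ) : ℂ) / 2 := by
    ext l
    have := Complex.I_mul_I
    linear_combination (-(halfSum 𝔽 l : ℂ) / 2 - ((Pi.single j s : Fin q → ℝ) l : ℂ) / 2) * this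
  have h2 : star (u : Matrix (Fin q) (Fin q) 𝔽) * realDiag (fun i => Real.exp (2 * t i)) *
        (u : Matrix (Fin q) (Fin q) 𝔽) =
      star (realDiag (fun i => Real.exp (t i)) * u.1) * (realDiag (fun i => Real.exp (t i)) * u.1)
      := by
    have : (realDiag (fun i => Real.exp (2 * t i)) : Matrix (Fin q) (Fin q) 𝔽)
        = realDiag (fun i => Real.exp (t i)) * realDiag (fun i => Real.exp (t i)) := by
      rw [realDiag, realDiag, diagonal_mul_diagonal]
      simp only [← map_mul, ← Real.exp_add, two_mul]
    rw [this, star_mul, star_realDiag]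
    simp only [mul_assoc]
  rw [h1, h2, powerFunction_single (isUnit_realDiag_exp_mul t u)]

/-- Differentiation under the integral, with the constant dominating function `B exp B` on `|s| <
1`. -/
theorem hasDerivAt_integral_exp_mul {α : Type*} [MeasurableSpace α] (μ : Measure α)
    [IsProbabilityMeasure μ] (D : α → ℝ) (hD : Measurable D) (B : ℝ) (hB : ∀ a, |D a| ≤ B) :
    HasDerivAt (fun s : ℝ => ∫ a, Real.exp (s * D a) ∂μ) (∫ a, D a ∂μ) 0 := by
  have h := hasDerivAt_integral_of_dominated_loc_of_deriv_le (μ := μ) (𝕜 := ℝ)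
    (F := fun s a => Real.exp (s * D a)) (F' := fun s a => D a * Real.exp (s * D a)) (x₀ := 0)
    (s := Metric.ball 0 1) (bound := fun _ => B * Real.exp B)
    (Metric.ball_mem_nhds 0 one_pos)
    (Eventually.of_forall fun s => by fun_prop) (by simp)
    (by fun_prop) (ae_of_all _ fun a s hs => by
      rw [norm_mul, Real.norm_eq_abs, Real.norm_eq_abs, Real.abs_exp]
      have hs' : |s| ≤ 1 := by
        rw [Metric.mem_ball, dist_zero_right, Real.norm_eq_abs] at hs
        exact hs.le
      have h1 : s * D a ≤ B := by
        calc s * D a ≤ |s * D a| := le_abs_self _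
          _ = |s| * |D a| := abs_mul _ _
          _ ≤ 1 * |D a| := by gcongr
          _ ≤ B := by rw [one_mul]; exact hB a
      have hB0 : 0 ≤ B := (abs_nonneg _).trans (hB a)
      gcongr
      exact hB a)
    (integrable_const _) (ae_of_all _ fun a s _ => by
      have h1 : HasDerivAt (fun s : ℝ => s * D a) (D a) s := by
        simpa using (hasDerivAt_id s).mul_const (D a)
      have := h1.exp
      rwa [mul_comm] at this)
  simpa using h.2

theorem momentFunction_eq (t : Fin q → ℝ) (j : Fin q) :
    momentFunction 𝔽 t j = incr (meanLogMinor 𝔽 t) j := by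
  have hmeas : Measurable fun u : UnitaryGroup 𝔽 q =>
      incr (logMinor (realDiag (fun i => Real.exp (t i)) * u.1)) j := by
    refine (measurable_pi_apply j).comp (measurable_incr.comp (measurable_pi_lambda _ fun r => ?_))
    exact ((continuous_logMinor_exp_mul r).comp
      (continuous_const.prodMk continuous_id)).measurable
  have hder := hasDerivAt_integral_exp_mul (haarUnitary 𝔽 q) _ hmeas (2 * (q * ∑ i, |t i|))
    (fun u => abs_incr_le _ (fun r => abs_logMinor_exp_mul_le t u r) j)
  rw [momentFunction]
  simp only [spherical_single]
  rw [hder.ofReal_comp.deriv, Complex.ofReal_re,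
    integral_incr _ _ (fun r => integrable_logMinor_exp_mul t r)]
  rfl

end MomentFunction

end BiinvariantWalk
end

noncomputable section

namespace BiinvariantWalk

open Matrix
open scoped ENNReal

/-! ### Kronecker's lemma -/

section Kronecker

/-- Kronecker's lemma for the weights `k ^ ε`. -/
theorem tendsto_inv_rpow_mul_sum {y : ℕ → ℝ} {ε : ℝ} (hε : 0 < ε) {l : ℝ}
    (h : Tendsto (fun k : ℕ => ∑ i ∈ Finset.range k, (((i + 1 : ℕ) : ℝ) ^ ε)⁻¹ * y i) atTop (𝓝 l)) :
    Tendsto (fun k : ℕ => ((k : ℝ) ^ ε)⁻¹ * ∑ i ∈ Finset.range k, y i) atTop (𝓝 0) := by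
  set Z : ℕ → ℝ := fun k => ∑ i ∈ Finset.range k, (((i + 1 : ℕ) : ℝ) ^ ε)⁻¹ * y i with hZ
  set W : ℕ → ℝ := fun k => Z k - l with hW
  set a : ℕ → ℝ := fun k => (k : ℝ) ^ ε with ha
  have hW0 : Tendsto W atTop (𝓝 0) := by simpa using h.sub_const l
  have ha0 : a 0 = 0 := by simp [ha, Real.zero_rpow hε.ne']
  have hapos : ∀ k, 0 < a (k + 1) := fun k => by
    simp only [ha]; positivity
  have hy : ∀ i, y i = a (i + 1) * (W (i + 1) - W i) := fun i => by
    have : W (i + 1) - W i = (a (i + 1))⁻¹ * y i := by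
      simp only [hW, hZ, Finset.sum_range_succ, ha]; ring
    rw [this, mul_inv_cancel_left₀ (hapos i).ne']
  -- Abel summation against the tail `W`; there is no boundary term at the start because `a 0 = 0`.
  have hsum : ∀ k, ∑ i ∈ Finset.range k, y i
      = a k * W k - ∑ i ∈ Finset.range k, (a (i + 1) - a i) * W i := fun k => by
    induction k with
    | zero => simp [ha0]
    | succ k ih => rw [Finset.sum_range_succ, Finset.sum_range_succ, ih, hy k]; ring
  have hmono : ∀ i, 0 ≤ a (i + 1) - a i := fun i => by
    rw [sub_nonneg]
    exact Real.rpow_le_rpow (by positivity) (by push_cast; linarith) hε.le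
  have hasum : ∀ k, ∑ i ∈ Finset.range k, (a (i + 1) - a i) = a k := fun k => by
    rw [Finset.sum_range_sub, ha0, sub_zero]
  have hatop : Tendsto a atTop atTop := (tendsto_rpow_atTop hε).comp tendsto_natCast_atTop_atTop
  -- A weighted Cesàro mean: the nonnegative weights sum to `a k → ∞`, and `W` tends to `0`.
  have hlo : (fun k => ∑ i ∈ Finset.range k, (a (i + 1) - a i) * W i) =o[atTop] a := by
    have h1 : (fun i => (a (i + 1) - a i) * W i) =o[atTop] fun i => a (i + 1) - a i := by
      have := (Asymptotics.isBigO_refl (fun i => a (i + 1) - a i) atTop).mul_isLittleO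
        ((Asymptotics.isLittleO_one_iff ℝ).mpr hW0)
      simpa using this
    have h2 := h1.sum_range hmono (by simpa only [hasum] using hatop)
    simpa only [hasum] using h2
  have h3 := hW0.sub hlo.tendsto_div_nhds_zero
  rw [sub_zero] at h3
  refine h3.congr' ?_
  filter_upwards [eventually_gt_atTop 0] with k hk
  have hak : a k ≠ 0 := by
    obtain ⟨j, rfl⟩ := Nat.exists_eq_succ_of_ne_zero hk.ne'
    exact (hapos j).ne'
  rw [hsum]
  change _ = (a k)⁻¹ * _
  field_simp

end Kronecker

/-! ### Independence of increments and almost sure limit theorems -/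

section AlmostSure

/-- If `X` is independent of `m`, `W` is `m`-measurable and the law of `ψ (X, w)` does not depend on
`w`, then `ψ (X, W)` has this law and is independent of `m`. -/
theorem map_eq_and_indep_of_forall_map_eq {Ω α β : Type*} [MeasurableSpace α]
    [MeasurableSpace β] (m : MeasurableSpace Ω) [mΩ : MeasurableSpace Ω] (P : Measure Ω)
    [IsProbabilityMeasure P] (hm : m ≤ mΩ) (X : Ω → α) (hX : Measurable X)
    (hind : Indep m (MeasurableSpace.comap X inferInstance) P) (W : Ω → β) (hW : Measurable[m] W)
    (ψ : α × β → ℝ) (hψ : Measurable ψ) (μ : Measure ℝ)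
    (hlaw : ∀ ω, (P.map X).map (fun x => ψ (x, W ω)) = μ) :
    P.map (fun ω => ψ (X ω, W ω)) = μ ∧
      Indep (MeasurableSpace.comap (fun ω => ψ (X ω, W ω)) inferInstance) m P := by
  have hWm : Measurable W := hW.mono hm le_rfl
  have hY : Measurable fun ω => ψ (X ω, W ω) := hψ.comp (hX.prodMk hWm)
  have key : ∀ A : Set Ω, MeasurableSet[m] A → ∀ S : Set ℝ, MeasurableSet S →
      P ((fun ω => ψ (X ω, W ω)) ⁻¹' S ∩ A) = μ S * P A := by
    intro A hA S hS
    -- Recording the event `A` along with `W` turns independence of `X` from `m` into one product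
    -- law; in the Fubini integral the inner measure is then the constant `μ S` on `A`.
    let V : Ω → β × Prop := fun ω => (W ω, ω ∈ A)
    have hV : Measurable[m] V := hW.prodMk (measurable_to_prop (by simpa using hA))
    have hVm : Measurable V := hV.mono hm le_rfl
    have hVX : IndepFun V X P := indep_of_indep_of_le_left hind hV.comap_le
    have hprod := (indepFun_iff_map_prod_eq_prod_map_map hVm.aemeasurable hX.aemeasurable).mp hVX
    let T : Set ((β × Prop) × α) := {p | p.1.2 ∧ ψ (p.2, p.1.1) ∈ S}
    have hT : MeasurableSet T := by
      refine MeasurableSet.inter ?_ ?_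
      · exact (measurable_snd.comp measurable_fst) (measurableSet_singleton True |>.congr (by
          ext p; simp) : MeasurableSet {p : Prop | p})
      · exact (hψ.comp (measurable_snd.prodMk (measurable_fst.comp measurable_fst))) hS
    have h1 : P ((fun ω => ψ (X ω, W ω)) ⁻¹' S ∩ A) = P.map (fun ω => (V ω, X ω)) T := by
      rw [Measure.map_apply (hVm.prodMk hX) hT]
      congr 1
      ext ω
      simp [T, V, and_comm]
    rw [h1, hprod, Measure.prod_apply hT, lintegral_map (measurable_measure_prodMk_left hT) hVm]
    have h2 : ∀ ω, (P.map X) (Prod.mk (V ω) ⁻¹' T) = A.indicator (fun _ => μ S) ω := fun ω => by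
      by_cases hω : ω ∈ A
      · rw [Set.indicator_of_mem hω, ← hlaw ω, Measure.map_apply (by fun_prop) hS]
        congr 1
        ext x
        simp [T, V, hω]
      · rw [Set.indicator_of_notMem hω]
        have : Prod.mk (V ω) ⁻¹' T = ∅ := by
          ext x
          simp [T, V, hω]
        rw [this, measure_empty]
    simp only [h2]
    rw [lintegral_indicator_const (hm _ hA)]
  have hmap : P.map (fun ω => ψ (X ω, W ω)) = μ := by
    ext S hS
    have := key Set.univ MeasurableSet.univ S hS
    rw [Set.inter_univ, measure_univ, mul_one] at this
    rw [Measure.map_apply hY hS, this]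
  refine ⟨hmap, ?_⟩
  rw [Indep_iff]
  rintro _ A ⟨S, hS, rfl⟩ hA
  rw [key A hA S hS, ← hmap, Measure.map_apply hY hS]

variable {Ω : Type*} [mΩ : MeasurableSpace Ω] (P : Measure Ω)

theorem summable_inv_rpow_sq {ε : ℝ} (hε : 1 / 2 < ε) :
    Summable fun k : ℕ => ((((k + 1 : ℕ) : ℝ) ^ ε)⁻¹) ^ 2 := by
  have h : Summable fun k : ℕ => ((k : ℝ) ^ (2 * ε))⁻¹ :=
    Real.summable_nat_rpow_inv.mpr (by linarith)
  refine ((summable_nat_add_iff 1).mpr h).congr fun k => ?_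
  rw [inv_pow, ← Real.rpow_natCast, ← Real.rpow_mul (by positivity)]
  congr 2
  push_cast; ring

/-- Random variables with bounded second moments are almost surely `o(k ^ ε)` for `ε > 1 / 2`. -/
theorem ae_tendsto_inv_rpow_mul_of_lintegral_sq_le (D : ℕ → Ω → ℝ) (hD : ∀ k, Measurable (D k))
    (C : ℝ≥0∞) (hC : C ≠ ∞) (hDC : ∀ k, ∫⁻ ω, ENNReal.ofReal (D (k + 1) ω ^ 2) ∂P ≤ C)
    {ε : ℝ} (hε : 1 / 2 < ε) :
    ∀ᵐ ω ∂P, Tendsto (fun k : ℕ => ((k : ℝ) ^ ε)⁻¹ * D k ω) atTop (𝓝 0) := by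
  set b : ℕ → ℝ := fun k => (((k + 1 : ℕ) : ℝ) ^ ε)⁻¹ with hb
  -- Since `2ε > 1`, the expected sum of squares is finite; so the series converges almost surely
  -- and its terms vanish in the limit.
  have hfin : ∫⁻ ω, ∑' k, ENNReal.ofReal ((b k * D (k + 1) ω) ^ 2) ∂P ≠ ∞ := by
    rw [lintegral_tsum fun k => by have := hD (k + 1); fun_prop]
    have hle : ∀ k, ∫⁻ ω, ENNReal.ofReal ((b k * D (k + 1) ω) ^ 2) ∂P
        ≤ ENNReal.ofReal (b k ^ 2) * C := fun k => by
      simp only [mul_pow, ENNReal.ofReal_mul (sq_nonneg (b k))]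
      rw [lintegral_const_mul' _ _ ENNReal.ofReal_ne_top]
      gcongr
      exact hDC k
    refine ne_top_of_le_ne_top ?_ (ENNReal.tsum_le_tsum hle)
    rw [ENNReal.tsum_mul_right]
    exact ENNReal.mul_ne_top (summable_inv_rpow_sq hε).tsum_ofReal_ne_top hC
  have hmeas : Measurable fun ω => ∑' k, ENNReal.ofReal ((b k * D (k + 1) ω) ^ 2) :=
    Measurable.tsum fun k => by have := hD (k + 1); fun_prop
  filter_upwards [ae_lt_top hmeas hfin] with ω hω
  have h1 := ENNReal.tendsto_atTop_zero_of_tsum_ne_top hω.ne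
  have h2 : Tendsto (fun k => (b k * D (k + 1) ω) ^ 2) atTop (𝓝 0) := by
    have := (ENNReal.tendsto_toReal ENNReal.zero_ne_top).comp h1
    simpa [Function.comp_def, ENNReal.toReal_ofReal (sq_nonneg _)] using this
  have h3 : Tendsto (fun k => |b k * D (k + 1) ω|) atTop (𝓝 0) := by
    have := h2.sqrt
    simpa [Real.sqrt_sq_eq_abs] using this
  rw [← tendsto_add_atTop_iff_nat 1]
  exact (tendsto_zero_iff_abs_tendsto_zero _).mpr h3

variable [IsProbabilityMeasure P]

variable (ℱ : Filtration ℕ mΩ) (Y : ℕ → Ω → ℝ)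

theorem pairwise_indepFun_of_filtration (hY : ∀ k, Measurable[ℱ (k + 1)] (Y k))
    (hind : ∀ k, Indep (MeasurableSpace.comap (Y k) inferInstance) (ℱ k) P) :
    Pairwise (Function.onFun (fun f g => IndepFun f g P) Y) := by
  have key : ∀ i j, i < j → IndepFun (Y j) (Y i) P := fun i j hij =>
    indep_of_indep_of_le_right (hind j) ((hY i).comap_le.trans (ℱ.mono hij))
  intro i j hij
  rcases lt_or_gt_of_ne hij with h | h
  · exact (key i j h).symm
  · exact key j i h

/-- The Marcinkiewicz–Zygmund type strong law for square-integrable variables. -/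
theorem ae_tendsto_inv_rpow_mul_sum_sub (hY : ∀ k, Measurable[ℱ (k + 1)] (Y k))
    (hind : ∀ k, Indep (MeasurableSpace.comap (Y k) inferInstance) (ℱ k) P)
    (hid : ∀ k, IdentDistrib (Y k) (Y 0) P P) (hL2 : MemLp (Y 0) 2 P) {ε : ℝ} (hε : 1 / 2 < ε) :
    ∀ᵐ ω ∂P, Tendsto (fun k : ℕ => ((k : ℝ) ^ ε)⁻¹ *
      (∑ i ∈ Finset.range k, Y i ω - k * ∫ ω, Y 0 ω ∂P)) atTop (𝓝 0) := by
  set c := ∫ ω, Y 0 ω ∂P with hc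
  set b : ℕ → ℝ := fun k => (((k + 1 : ℕ) : ℝ) ^ ε)⁻¹ with hb
  have hYm : ∀ k, Measurable (Y k) := fun k => (hY k).mono (ℱ.le _) le_rfl
  have hYL2 : ∀ k, MemLp (Y k) 2 P := fun k => (hid k).memLp_iff.mpr hL2
  -- Dividing by `(k + 1)^ε` makes the variances summable, so the partial sums form an `L²`-bounded
  -- martingale; Kronecker's lemma undoes the weights.
  set Z : ℕ → Ω → ℝ := fun k ω => b k * (Y k ω - c) with hZ
  have hφ : ∀ k, Measurable fun x : ℝ => b k * (x - c) := fun k => by fun_prop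
  have hZL2 : ∀ k, MemLp (Z k) 2 P := fun k => ((hYL2 k).sub (memLp_const c)).const_mul (b k)
  have hZint : ∀ k, Integrable (Z k) P := fun k => (hZL2 k).integrable (by norm_num)
  have hZ0 : ∀ k, ∫ ω, Z k ω ∂P = 0 := fun k => by
    simp only [hZ]
    rw [integral_const_mul, integral_sub ((hYL2 k).integrable (by norm_num)) (integrable_const c),
      (hid k).integral_eq]
    simp [hc]
  have hZmeas : ∀ k, Measurable[ℱ (k + 1)] (Z k) := fun k => (hφ k).comp (hY k)
  have hZcomap : ∀ k, Measurable[MeasurableSpace.comap (Y k) inferInstance] (Z k) := fun k =>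
    (hφ k).comp (comap_measurable (Y k))
  have hpw := pairwise_indepFun_of_filtration P ℱ Y hY hind
  have hZpw : ∀ i j, i ≠ j → IndepFun (Z i) (Z j) P := fun i j hij =>
    (hpw hij).comp (hφ i) (hφ j)
  set N : ℕ → Ω → ℝ := fun k ω => ∑ i ∈ Finset.range k, Z i ω with hN
  have hNadapt : StronglyAdapted ℱ N := fun k =>
    (Finset.measurable_fun_sum _ fun i hi =>
      (hZmeas i).mono (ℱ.mono (Finset.mem_range.mp hi)) le_rfl).stronglyMeasurable
  have hNint : ∀ k, Integrable (N k) P := fun k => integrable_finsetSum _ fun i _ => hZint i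
  have hmart : Martingale N ℱ P := by
    refine martingale_of_condExp_sub_eq_zero_nat hNadapt hNint fun k => ?_
    have e : N (k + 1) - N k = Z k := by
      ext ω
      simp [hN, Finset.sum_range_succ]
    rw [e]
    have h1 := condExp_indep_eq (μ := P) (hYm k).comap_le (ℱ.le k)
      (hZcomap k).stronglyMeasurable (hind k)
    refine h1.trans ?_
    rw [hZ0 k]
    rfl
  have hsum := summable_inv_rpow_sq hε
  set R : ℝ := variance (Y 0) P * ∑' k, b k ^ 2 with hR
  have hvar : ∀ k, ∫ ω, N k ω ^ 2 ∂P ≤ R := fun k => by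
    have hN0 : ∫ ω, N k ω ∂P = 0 := by
      simp only [hN]
      rw [integral_finsetSum _ fun i _ => hZint i]
      simp [hZ0]
    have hNm : AEMeasurable (N k) P := (hNint k).aemeasurable
    have h1 : variance (N k) P = ∫ ω, N k ω ^ 2 ∂P :=
      variance_of_integral_eq_zero hNm hN0
    have h2 : variance (∑ i ∈ Finset.range k, Z i) P
        = ∑ i ∈ Finset.range k, variance (Z i) P :=
      IndepFun.variance_sum (fun i _ => hZL2 i) fun i _ j _ hij => hZpw i j hij
    have h3 : (∑ i ∈ Finset.range k, Z i) = N k := by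
      ext ω
      simp [hN]
    have h4 : ∀ i, variance (Z i) P = variance (Y 0) P * b i ^ 2 := fun i => by
      simp only [hZ]
      rw [variance_const_mul, variance_sub_const (hYm i).aestronglyMeasurable,
        (hid i).variance_eq, mul_comm]
    rw [← h1, ← h3, h2]
    simp only [h4]
    rw [← Finset.mul_sum]
    refine mul_le_mul_of_nonneg_left ?_ (variance_nonneg _ _)
    exact hsum.sum_le_tsum _ fun i _ => sq_nonneg _
  -- Martingale convergence asks for an `L¹` bound, obtained from the `L²` bound by `|x| ≤ 1 + x²`.
  have hbdd : ∀ k, eLpNorm (N k) 1 P ≤ ((1 + R).toNNReal : ℝ≥0∞) := fun k => by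
    have hsq : Integrable (fun ω => N k ω ^ 2) P := by
      have : MemLp (N k) 2 P := memLp_finsetSum _ fun i _ => hZL2 i
      exact this.integrable_sq
    rw [eLpNorm_one_eq_lintegral_enorm]
    calc ∫⁻ ω, ‖N k ω‖ₑ ∂P ≤ ∫⁻ ω, ENNReal.ofReal (1 + N k ω ^ 2) ∂P := by
          refine lintegral_mono fun ω => ?_
          rw [Real.enorm_eq_ofReal_abs]
          refine ENNReal.ofReal_le_ofReal ?_
          nlinarith [sq_abs (N k ω), sq_nonneg (|N k ω| - 1), abs_nonneg (N k ω)]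
      _ = ENNReal.ofReal (∫ ω, (1 + N k ω ^ 2) ∂P) :=
          (ofReal_integral_eq_lintegral_ofReal ((integrable_const 1).add hsq)
            (ae_of_all _ fun ω => add_nonneg zero_le_one (sq_nonneg (N k ω)))).symm
      _ ≤ ENNReal.ofReal (1 + R) := by
          refine ENNReal.ofReal_le_ofReal ?_
          rw [integral_add (integrable_const 1) hsq]
          simpa using hvar k
  have hconv := hmart.submartingale.exists_ae_tendsto_of_bdd hbdd
  filter_upwards [hconv] with ω hω
  obtain ⟨l, hl⟩ := hω
  have h5 := tendsto_inv_rpow_mul_sum (y := fun i => Y i ω - c) (by linarith) hl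
  refine h5.congr fun k => ?_
  rw [Finset.sum_sub_distrib, Finset.sum_const, Finset.card_range, nsmul_eq_mul]

end AlmostSure

end BiinvariantWalk
end

noncomputable section

namespace BiinvariantWalk

open Matrix
open scoped ENNReal

/-! ### Consequences of unitary invariance of the law -/

section Biinvariance

variable {𝔽 : Type*} [NormedDivisionRing 𝔽] [NormedAlgebra ℝ 𝔽] [StarRing 𝔽]
  [IsRealComplexOrQuaternion 𝔽] {q : ℕ}

theorem measurable_units_val : Measurable fun g : GL (Fin q) 𝔽 => g.1 := comap_measurable _

theorem measurable_toGL {α : Type*} [MeasurableSpace α] {f : α → GL (Fin q) 𝔽}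
    (hf : Measurable fun a => (f a).1) : Measurable f :=
  measurable_comap_iff.mpr hf

theorem measurable_mul_matrix : Measurable fun p : Matrix (Fin q) (Fin q) 𝔽 ×
    Matrix (Fin q) (Fin q) 𝔽 => p.1 * p.2 :=
  continuous_mul.measurable

theorem measurable_mul_GL : Measurable fun p : GL (Fin q) 𝔽 × GL (Fin q) 𝔽 => p.1 * p.2 :=
  measurable_toGL (measurable_mul_matrix.comp
    ((measurable_units_val.comp measurable_fst).prodMk (measurable_units_val.comp measurable_snd)))

theorem measurable_unitary_mul_GL (u : UnitaryGroup 𝔽 q) :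
    Measurable fun g : GL (Fin q) 𝔽 => Unitary.toUnits u * g :=
  measurable_mul_GL.comp (measurable_const.prodMk measurable_id)

theorem measurable_star_val : Measurable fun g : GL (Fin q) 𝔽 => star g.1 :=
  continuous_star.measurable.comp measurable_units_val

/-- Invariance of a measure on `GL(q, 𝔽)` under left multiplication by unitary matrices. -/
def IsLeftUnitaryInvariant (μ : Measure (GL (Fin q) 𝔽)) : Prop :=
  ∀ u : UnitaryGroup 𝔽 q, μ.map (fun g => Unitary.toUnits u * g) = μ

theorem IsBiinvariant.isLeftUnitaryInvariant {μ : Measure (GL (Fin q) 𝔽)} (h : IsBiinvariant μ) :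
    IsLeftUnitaryInvariant μ := fun u => by
  have := h u 1
  simpa using this

theorem IsLeftUnitaryInvariant.map_mul {μ ν : Measure (GL (Fin q) 𝔽)} [IsProbabilityMeasure μ]
    [IsProbabilityMeasure ν] (h : IsLeftUnitaryInvariant μ) :
    IsLeftUnitaryInvariant ((μ.prod ν).map fun p => p.1 * p.2) := fun u => by
  have hL := measurable_unitary_mul_GL u
  rw [Measure.map_map hL measurable_mul_GL]
  have e : ((fun g => Unitary.toUnits u * g) ∘ fun p : GL (Fin q) 𝔽 × GL (Fin q) 𝔽 => p.1 * p.2)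
      = (fun p => p.1 * p.2) ∘ Prod.map (fun g => Unitary.toUnits u * g) id := by
    ext1 p
    simp [mul_assoc]
  rw [e, ← Measure.map_map measurable_mul_GL (hL.prodMap measurable_id),
    ← Measure.map_prod_map _ _ hL measurable_id, h u, Measure.map_id]

theorem star_toUnits_mul_val (u : UnitaryGroup 𝔽 q) (g : GL (Fin q) 𝔽) :
    star (Unitary.toUnits (star u) * g).1 = star g.1 * u.1 := by
  change star (star u.1 * g.1) = _
  rw [star_mul, star_star]

theorem logSingularSpectrum_unitary_mul (u : UnitaryGroup 𝔽 q) (g : GL (Fin q) 𝔽) :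
    logSingularSpectrum (Unitary.toUnits u * g) = logSingularSpectrum g := by
  have h : star (Unitary.toUnits u * g).1 * (Unitary.toUnits u * g).1 = star g.1 * g.1 := by
    change star (u.1 * g.1) * (u.1 * g.1) = _
    rw [star_mul, mul_assoc, ← mul_assoc (star u.1), Unitary.star_mul_self_of_mem u.2, one_mul]
  ext j
  simp only [logSingularSpectrum, singularSpectrum, h]

theorem measurable_star_mul_unitary : Measurable fun p : UnitaryGroup 𝔽 q × GL (Fin q) 𝔽 =>
    star p.2.1 * p.1.1 :=
  measurable_mul_matrix.comp ((measurable_star_val.comp measurable_snd).prodMk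
    (measurable_subtype_coe.comp measurable_fst))

theorem measurable_logMinor_star (r : Fin q) :
    Measurable fun g : GL (Fin q) 𝔽 => logMinor (star g.1) r :=
  (measurable_logMinor r).comp measurable_star_val

/-- Replacing `g` by `u* g` preserves both the law and the singular spectrum but turns `g*` into `g*
u`. Averaging over `u` therefore brings in the Haar bound, with a constant independent of the law.
-/
theorem exists_lintegral_sq_defect_le (r : Fin q) :
    ∃ C : ℝ≥0∞, C ≠ ∞ ∧ ∀ μ : Measure (GL (Fin q) 𝔽), IsProbabilityMeasure μ →
      IsLeftUnitaryInvariant μ → ∫⁻ g, ENNReal.ofReal ((topSum (logSingularSpectrum g) r -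
        logMinor (star g.1) r) ^ 2) ∂μ ≤ C := by
  obtain ⟨C, hC, h⟩ := exists_lintegral_sq_topSum_sub_star_le (𝔽 := 𝔽) r
  refine ⟨C, hC, fun μ _ hμ => ?_⟩
  set f : GL (Fin q) 𝔽 → ℝ≥0∞ := fun g => ENNReal.ofReal ((topSum (logSingularSpectrum g) r -
        logMinor (star g.1) r) ^ 2) with hf
  have hfm : Measurable f := by
    have h1 := measurable_topSum_logSingularSpectrum (𝔽 := 𝔽) r
    have h2 := measurable_logMinor_star (𝔽 := 𝔽) r
    exact ((h1.sub h2).pow_const 2).ennreal_ofReal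
  have hu : ∀ u : UnitaryGroup 𝔽 q, ∫⁻ g, f g ∂μ = ∫⁻ g, ENNReal.ofReal
      ((topSum (logSingularSpectrum g) r - logMinor (star g.1 * u.1) r) ^ 2) ∂μ := fun u => by
    conv_lhs => rw [← hμ (star u), lintegral_map hfm (measurable_unitary_mul_GL _)]
    simp only [hf, logSingularSpectrum_unitary_mul, star_toUnits_mul_val]
  calc ∫⁻ g, f g ∂μ = ∫⁻ _ : UnitaryGroup 𝔽 q, ∫⁻ g, f g ∂μ ∂(haarUnitary 𝔽 q) := by simp
    _ = ∫⁻ u : UnitaryGroup 𝔽 q, ∫⁻ g, ENNReal.ofReal ((topSum (logSingularSpectrum g) r -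
        logMinor (star g.1 * u.1) r) ^ 2) ∂μ ∂(haarUnitary 𝔽 q) := by simp only [← hu]
    _ = ∫⁻ g, ∫⁻ u : UnitaryGroup 𝔽 q, ENNReal.ofReal ((topSum (logSingularSpectrum g) r -
        logMinor (star g.1 * u.1) r) ^ 2) ∂(haarUnitary 𝔽 q) ∂μ := by
      refine lintegral_lintegral_swap (Measurable.aemeasurable ?_)
      have h1 : Measurable fun p : UnitaryGroup 𝔽 q × GL (Fin q) 𝔽 =>
          topSum (logSingularSpectrum p.2) r :=
        (measurable_topSum_logSingularSpectrum r).comp measurable_snd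
      have h2 : Measurable fun p : UnitaryGroup 𝔽 q × GL (Fin q) 𝔽 =>
          logMinor (star p.2.1 * p.1.1) r :=
        (measurable_logMinor r).comp measurable_star_mul_unitary
      exact ((h1.sub h2).pow_const 2).ennreal_ofReal
    _ ≤ ∫⁻ _, C ∂μ := lintegral_mono h
    _ = C := by simp

theorem integral_logMinor_star (μ : Measure (GL (Fin q) 𝔽)) [IsProbabilityMeasure μ]
    (hμ : IsLeftUnitaryInvariant μ)
    (hint : ∀ j, Integrable (fun g => logSingularSpectrum g j) μ) (r : Fin q) :
    ∫ g, logMinor (star g.1) r ∂μ = ∫ g, meanLogMinor 𝔽 (logSingularSpectrum g) r ∂μ := by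
  have hm := measurable_logMinor_star (𝔽 := 𝔽) r
  have hu : ∀ u : UnitaryGroup 𝔽 q, ∫ g, logMinor (star g.1) r ∂μ
      = ∫ g, logMinor (star g.1 * u.1) r ∂μ := fun u => by
    conv_lhs => rw [← hμ (star u), integral_map (measurable_unitary_mul_GL _).aemeasurable
      hm.aestronglyMeasurable]
    simp only [star_toUnits_mul_val]
  have hprod : Integrable (Function.uncurry fun (u : UnitaryGroup 𝔽 q) (g : GL (Fin q) 𝔽) =>
      logMinor (star g.1 * u.1) r) ((haarUnitary 𝔽 q).prod μ) := by
    have hdom : Integrable (fun g : GL (Fin q) 𝔽 => (q : ℝ) * ∑ i, |logSingularSpectrum g i|) μ :=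
      (integrable_finsetSum _ fun i _ => (hint i).abs).const_mul _
    refine (hdom.comp_snd (haarUnitary 𝔽 q)).mono'
      ((measurable_logMinor r).comp measurable_star_mul_unitary).aestronglyMeasurable
      (ae_of_all _ fun p => ?_)
    exact abs_logMinor_star_mul_le p.2 p.1 r
  calc ∫ g, logMinor (star g.1) r ∂μ
      = ∫ _ : UnitaryGroup 𝔽 q, ∫ g, logMinor (star g.1) r ∂μ ∂(haarUnitary 𝔽 q) := by simp
    _ = ∫ u : UnitaryGroup 𝔽 q, ∫ g, logMinor (star g.1 * u.1) r ∂μ ∂(haarUnitary 𝔽 q) := by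
      simp only [← hu]
    _ = ∫ g, ∫ u : UnitaryGroup 𝔽 q, logMinor (star g.1 * u.1) r ∂(haarUnitary 𝔽 q) ∂μ :=
      integral_integral_swap hprod
    _ = _ := by simp only [integral_logMinor_star_mul]

/-- By the cocycle identity the difference is `logMinor (g* u)` with `u` depending only on `s`, and
invariance absorbs `u`. -/
theorem map_logMinor_star_mul_sub (μ : Measure (GL (Fin q) 𝔽)) (hμ : IsLeftUnitaryInvariant μ)
    (s : Matrix (Fin q) (Fin q) 𝔽) (hs : IsUnit s) (r : Fin q) :
    μ.map (fun g => logMinor (star g.1 * s) r - logMinor s r)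
      = μ.map fun g => logMinor (star g.1) r := by
  obtain ⟨u, hu⟩ := exists_unitary_logMinor_mul s hs
  have e : (fun g : GL (Fin q) 𝔽 => logMinor (star g.1 * s) r - logMinor s r)
      = (fun g => logMinor (star g.1) r) ∘ fun g => Unitary.toUnits (star u) * g := by
    ext g
    simp only [Function.comp, star_toUnits_mul_val]
    rw [hu (star g.1) g.isUnit.star r]
    ring
  rw [e, ← Measure.map_map (measurable_logMinor_star r)
    (measurable_unitary_mul_GL _), hμ]

end Biinvariance

/-! ### The walk, its filtration and its increments -/

section Walk

variable {𝔽 : Type*} [NormedDivisionRing 𝔽] [NormedAlgebra ℝ 𝔽] [StarRing 𝔽]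
  [IsRealComplexOrQuaternion 𝔽] {q : ℕ} {Ω : Type*} [mΩ : MeasurableSpace Ω]

/-- The filtration generated by the increments; the `k`-th sigma-algebra is generated by the first
`k` of them. -/
def incrFiltration (X : ℕ → Ω → GL (Fin q) 𝔽) (hX : ∀ k, Measurable (X k)) :
    Filtration ℕ mΩ where
  seq k := ⨆ i ∈ {i | i < k}, MeasurableSpace.comap (X i) inferInstance
  mono' _ _ hkl := biSup_mono fun _ hi => lt_of_lt_of_le hi hkl
  le' _ := iSup₂_le fun i _ => (hX i).comap_le

variable (P : Measure Ω) [IsProbabilityMeasure P] (X : ℕ → Ω → GL (Fin q) 𝔽)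

theorem measurable_incr_of_lt (hX : ∀ k, Measurable (X k)) {i k : ℕ} (hik : i < k) :
    Measurable[incrFiltration X hX k] (X i) := by
  refine Measurable.mono (comap_measurable (X i)) ?_ le_rfl
  exact le_iSup₂ (f := fun i (_ : i ∈ {i | i < k}) =>
    MeasurableSpace.comap (X i) inferInstance) i hik

theorem measurable_walk (hX : ∀ k, Measurable (X k)) (k : ℕ) : Measurable[incrFiltration X hX k] (walk X k) := by
  induction k with
  | zero => exact measurable_const
  | succ k ih =>
    have h1 : Measurable[incrFiltration X hX (k + 1)] (walk X k) :=
      ih.mono ((incrFiltration X hX).mono (Nat.le_succ k)) le_rfl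
    exact measurable_mul_GL.comp (h1.prodMk (measurable_incr_of_lt X hX (Nat.lt_succ_self k)))

theorem indep_incrFiltration (hX : ∀ k, Measurable (X k)) (hindep : iIndepFun X P) (k : ℕ) :
    Indep (incrFiltration X hX k) (MeasurableSpace.comap (X k) inferInstance) P := by
  have h := indep_iSup_of_disjoint (fun i => (hX i).comap_le) hindep
    (S := {i | i < k}) (T := {k}) (by simp)
  have e : (⨆ i ∈ ({k} : Set ℕ), MeasurableSpace.comap (X i) inferInstance)
      = MeasurableSpace.comap (X k) inferInstance := iSup_singleton
  rw [e] at h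
  exact h

/-- The leftmost factor passes its invariance to the product. At least one factor is needed, which
excludes `S_0 = 1`. -/
theorem isLeftUnitaryInvariant_map_walk (hX : ∀ k, Measurable (X k))
    (νG : Measure (GL (Fin q) 𝔽)) (hνG : IsBiinvariant νG)
    (hlaw : ∀ k, P.map (X k) = νG) (hindep : iIndepFun X P) (k : ℕ) :
    IsLeftUnitaryInvariant (P.map (walk X (k + 1))) := by
  have hw : ∀ k, Measurable (walk X k) := fun k =>
    (measurable_walk X hX k).mono ((incrFiltration X hX).le k) le_rfl
  induction k with
  | zero =>
    have : walk X 1 = X 0 := by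
      ext1 ω
      simp [walk]
    rw [this, hlaw]
    exact hνG.isLeftUnitaryInvariant
  | succ k ih =>
    have hind : IndepFun (walk X (k + 1)) (X (k + 1)) P :=
      indep_of_indep_of_le_left (indep_incrFiltration P X hX hindep (k + 1))
        (measurable_walk X hX (k + 1)).comap_le
    have hprod := (indepFun_iff_map_prod_eq_prod_map_map (hw (k + 1)).aemeasurable
      (hX (k + 1)).aemeasurable).mp hind
    have e : walk X (k + 1 + 1) = (fun p => p.1 * p.2) ∘ fun ω => (walk X (k + 1) ω, X (k + 1) ω) :=
      rfl
    have h1 := Measure.isProbabilityMeasure_map (μ := P) (hw (k + 1)).aemeasurable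
    have h2 := Measure.isProbabilityMeasure_map (μ := P) (hX (k + 1)).aemeasurable
    rw [e, ← Measure.map_map measurable_mul_GL ((hw (k + 1)).prodMk (hX (k + 1))), hprod]
    exact ih.map_mul

/-- The increments of `logMinor` along the adjoint walk. -/
def logMinorIncr (r : Fin q) (k : ℕ) (ω : Ω) : ℝ :=
  logMinor (star (X k ω).1 * star (walk X k ω).1) r - logMinor (star (walk X k ω).1) r

theorem sum_logMinorIncr (r : Fin q) (k : ℕ) (ω : Ω) :
    ∑ i ∈ Finset.range k, logMinorIncr X r i ω = logMinor (star (walk X k ω).1) r := by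
  have h : ∀ i, logMinorIncr X r i ω
      = logMinor (star (walk X (i + 1) ω).1) r - logMinor (star (walk X i ω).1) r := fun i => by
    have : star (walk X (i + 1) ω).1 = star (X i ω).1 * star (walk X i ω).1 := by
      rw [← star_mul]; rfl
    rw [this]; rfl
  simp only [h]
  rw [Finset.sum_range_sub fun i => logMinor (star (walk X i ω).1) r]
  have h0 : logMinor (star (walk X 0 ω).1) r = 0 := by
    have : (walk X 0 ω).1 = 1 := rfl
    rw [this, star_one, logMinor_eq, star_one, one_mul, blockDet_one, Real.log_one, mul_zero]
  rw [h0, sub_zero]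

/-- Conditionally on the past the walk is a fixed matrix `s`, and the law of the increment does not
depend on `s`. -/
theorem map_eq_and_indep_logMinorIncr (hX : ∀ k, Measurable (X k))
    (νG : Measure (GL (Fin q) 𝔽)) (hνG : IsBiinvariant νG)
    (hlaw : ∀ k, P.map (X k) = νG) (hindep : iIndepFun X P) (r : Fin q) (k : ℕ) :
    P.map (logMinorIncr X r k) = νG.map (fun g => logMinor (star g.1) r) ∧
      Indep (MeasurableSpace.comap (logMinorIncr X r k) inferInstance)
        (incrFiltration X hX k) P := by
  have hψ : Measurable fun p : GL (Fin q) 𝔽 × GL (Fin q) 𝔽 =>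
      logMinor (star p.1.1 * star p.2.1) r - logMinor (star p.2.1) r := by
    have h1 : Measurable fun p : GL (Fin q) 𝔽 × GL (Fin q) 𝔽 => star p.1.1 * star p.2.1 :=
      measurable_mul_matrix.comp ((measurable_star_val.comp measurable_fst).prodMk
        (measurable_star_val.comp measurable_snd))
    exact ((measurable_logMinor r).comp h1).sub
      ((measurable_logMinor r).comp (measurable_star_val.comp measurable_snd))
  exact map_eq_and_indep_of_forall_map_eq (incrFiltration X hX k) P ((incrFiltration X hX).le k)
    (X k) (hX k) (indep_incrFiltration P X hX hindep k) (walk X k) (measurable_walk X hX k)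
    _ hψ _ fun ω => by
      rw [hlaw]
      exact map_logMinor_star_mul_sub νG hνG.isLeftUnitaryInvariant _
        (walk X k ω).isUnit.star r

theorem measurable_logMinorIncr (hX : ∀ k, Measurable (X k)) (r : Fin q) (k : ℕ) :
    Measurable[incrFiltration X hX (k + 1)] (logMinorIncr X r k) := by
  have h1 : Measurable[incrFiltration X hX (k + 1)] (walk X k) :=
    (measurable_walk X hX k).mono ((incrFiltration X hX).mono (Nat.le_succ k)) le_rfl
  have h2 := measurable_incr_of_lt X hX (Nat.lt_succ_self k)
  have h3 : Measurable[incrFiltration X hX (k + 1)] fun ω =>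
      star (X k ω).1 * star (walk X k ω).1 :=
    measurable_mul_matrix.comp ((measurable_star_val.comp h2).prodMk
      (measurable_star_val.comp h1))
  exact ((measurable_logMinor r).comp h3).sub
    ((measurable_logMinor r).comp (measurable_star_val.comp h1))

/-- The defect between the top singular values and `logMinor` of the adjoint walk is almost surely
`o(k ^ ε)`. -/
theorem ae_tendsto_defect (hX : ∀ k, Measurable (X k))
    (νG : Measure (GL (Fin q) 𝔽)) (hνG : IsBiinvariant νG)
    (hlaw : ∀ k, P.map (X k) = νG) (hindep : iIndepFun X P) (r : Fin q) {ε : ℝ}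
    (hε : 1 / 2 < ε) :
    ∀ᵐ ω ∂P, Tendsto (fun k : ℕ => ((k : ℝ) ^ ε)⁻¹ *
      (topSum (logSingularSpectrum (walk X k ω)) r - logMinor (star (walk X k ω).1) r))
      atTop (𝓝 0) := by
  obtain ⟨C, hC, h⟩ := exists_lintegral_sq_defect_le (𝔽 := 𝔽) r
  have hw : ∀ k, Measurable (walk X k) := fun k =>
    (measurable_walk X hX k).mono ((incrFiltration X hX).le k) le_rfl
  have hf : Measurable fun g : GL (Fin q) 𝔽 =>
      topSum (logSingularSpectrum g) r - logMinor (star g.1) r :=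
    (measurable_topSum_logSingularSpectrum r).sub
      (measurable_logMinor_star r)
  refine ae_tendsto_inv_rpow_mul_of_lintegral_sq_le P
    (fun k ω => topSum (logSingularSpectrum (walk X k ω)) r - logMinor (star (walk X k ω).1) r)
    (fun k => hf.comp (hw k)) C hC (fun k => ?_) hε
  have h1 := h (P.map (walk X (k + 1))) (Measure.isProbabilityMeasure_map (hw _).aemeasurable)
    (isLeftUnitaryInvariant_map_walk P X hX νG hνG hlaw hindep k)
  rwa [lintegral_map (hf.pow_const 2).ennreal_ofReal (hw _)] at h1

theorem identDistrib_logMinorIncr (hX : ∀ k, Measurable (X k))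
    (νG : Measure (GL (Fin q) 𝔽)) (hνG : IsBiinvariant νG)
    (hlaw : ∀ k, P.map (X k) = νG) (hindep : iIndepFun X P) (r : Fin q) (k : ℕ) :
    IdentDistrib (logMinorIncr X r k) (fun g : GL (Fin q) 𝔽 => logMinor (star g.1) r) P νG where
  aemeasurable_fst := ((measurable_logMinorIncr X hX r k).mono
    ((incrFiltration X hX).le _) le_rfl).aemeasurable
  aemeasurable_snd := (measurable_logMinor_star r).aemeasurable
  map_eq := (map_eq_and_indep_logMinorIncr P X hX νG hνG hlaw hindep r k).1

end Walk

end BiinvariantWalk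
end

noncomputable section

namespace BiinvariantWalk

open Matrix

/-! ### Moments, drift and the limit theorems -/

section LimitTheorems

variable {𝔽 : Type*} [NormedDivisionRing 𝔽] [NormedAlgebra ℝ 𝔽] [StarRing 𝔽]
  [IsRealComplexOrQuaternion 𝔽] {q : ℕ}

theorem AdmitsFirstMoments.integrable_meanLogMinor {ν : Measure (Fin q → ℝ)}
    (h : AdmitsFirstMoments ν) (r : Fin q) : Integrable (fun t => meanLogMinor 𝔽 t r) ν := by
  have hdom : Integrable (fun t : Fin q → ℝ => (q : ℝ) * ∑ i, |t i|) ν :=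
    (integrable_finsetSum _ fun i _ => (h i).abs).const_mul _
  exact hdom.mono' (measurable_meanLogMinor r).aestronglyMeasurable
    (ae_of_all _ fun t => abs_meanLogMinor_le t r)

theorem integrable_incr {α : Type*} [MeasurableSpace α] (μ : Measure α) (F : α → Fin q → ℝ)
    (hF : ∀ r, Integrable (fun a => F a r) μ) (j : Fin q) :
    Integrable (fun a => incr (F a) j) μ := by
  unfold incr
  split_ifs
  · exact (hF _).sub (hF _)
  · simpa using hF j

theorem AdmitsFirstMoments.integrable_momentFunction {ν : Measure (Fin q → ℝ)}
    (h : AdmitsFirstMoments ν) (j : Fin q) : Integrable (fun t => momentFunction 𝔽 t j) ν := by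
  simp only [momentFunction_eq]
  exact integrable_incr ν _ h.integrable_meanLogMinor j

theorem AdmitsFirstMoments.dispersion_eq {ν : Measure (Fin q → ℝ)} (h : AdmitsFirstMoments ν) :
    dispersion 𝔽 ν = incr fun r => ∫ t, meanLogMinor 𝔽 t r ∂ν := by
  ext j
  simp only [dispersion, momentFunction_eq]
  exact integral_incr ν _ h.integrable_meanLogMinor j

theorem AdmitsSecondMoments.memLp {ν : Measure (Fin q → ℝ)} (h : AdmitsSecondMoments ν)
    (j : Fin q) : MemLp (fun t : Fin q → ℝ => t j) 2 ν :=
  (memLp_two_iff_integrable_sq (measurable_pi_apply j).aestronglyMeasurable).mpr (h j)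

theorem AdmitsSecondMoments.admitsFirstMoments {ν : Measure (Fin q → ℝ)} [IsFiniteMeasure ν]
    (h : AdmitsSecondMoments ν) : AdmitsFirstMoments ν :=
  fun j => (h.memLp j).integrable (by norm_num)

/-- The linear bound by `∑ |t_i|` transfers any `L^p` condition; it is used with `p = 1` and `p =
2`. -/
theorem memLp_logMinor_star {μ : Measure (GL (Fin q) 𝔽)} {p : ENNReal}
    (h : ∀ j, MemLp (fun t : Fin q → ℝ => t j) p (radialPart μ)) (r : Fin q) :
    MemLp (fun g : GL (Fin q) 𝔽 => logMinor (star g.1) r) p μ := by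
  have h' : ∀ j, MemLp (fun g : GL (Fin q) 𝔽 => logSingularSpectrum g j) p μ := fun j =>
    (h j).comp_of_map measurable_logSingularSpectrum.aemeasurable
  have hdom : MemLp (fun g : GL (Fin q) 𝔽 => (q : ℝ) * ∑ i, |logSingularSpectrum g i|) p μ :=
    (memLp_finsetSum _ fun i _ => (h' i).abs).const_mul _
  exact hdom.mono' (measurable_logMinor_star r).aestronglyMeasurable
    (ae_of_all _ fun g => abs_logMinor_star_le g r)

theorem integral_logMinor_star_eq (μ : Measure (GL (Fin q) 𝔽)) [IsProbabilityMeasure μ]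
    (hμ : IsLeftUnitaryInvariant μ) (h : AdmitsFirstMoments (radialPart μ)) (r : Fin q) :
    ∫ g, logMinor (star g.1) r ∂μ = ∫ t, meanLogMinor 𝔽 t r ∂(radialPart μ) := by
  have hm : AEMeasurable (logSingularSpectrum : GL (Fin q) 𝔽 → Fin q → ℝ) μ :=
    measurable_logSingularSpectrum.aemeasurable
  rw [radialPart, integral_map hm (measurable_meanLogMinor r).aestronglyMeasurable]
  exact integral_logMinor_star μ hμ (fun j => (h j).comp_aemeasurable hm) r

variable {Ω : Type*} [MeasurableSpace Ω] (P : Measure Ω) [IsProbabilityMeasure P]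
  (X : ℕ → Ω → GL (Fin q) 𝔽)

/-- If `logMinor` of the adjoint walk has the drift `k * c r` up to `o(k ^ ε)`, then so has the
logarithmic singular spectrum of the walk, with the drift vector `incr c`. -/
theorem ae_tendsto_logSingularSpectrum (hX : ∀ k, Measurable (X k))
    (νG : Measure (GL (Fin q) 𝔽)) (hνG : IsBiinvariant νG)
    (hlaw : ∀ k, P.map (X k) = νG) (hindep : iIndepFun X P) {ε : ℝ} (hε : 1 / 2 < ε)
    (c : Fin q → ℝ)
    (h : ∀ r, ∀ᵐ ω ∂P, Tendsto (fun k : ℕ => ((k : ℝ) ^ ε)⁻¹ *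
      (∑ i ∈ Finset.range k, logMinorIncr X r i ω - k * c r)) atTop (𝓝 0)) :
    ∀ᵐ ω ∂P, Tendsto (fun k : ℕ => ((k : ℝ) ^ ε)⁻¹ •
      (logSingularSpectrum (walk X k ω) - (k : ℝ) • incr c)) atTop (𝓝 0) := by
  have hdef := fun r => ae_tendsto_defect P X hX νG hνG hlaw hindep r hε
  filter_upwards [ae_all_iff.mpr h, ae_all_iff.mpr hdef] with ω h1 h2
  have h3 : Tendsto (fun k : ℕ => ((k : ℝ) ^ ε)⁻¹ •
      (topSum (logSingularSpectrum (walk X k ω)) - (k : ℝ) • c)) atTop (𝓝 0) := by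
    refine tendsto_pi_nhds.mpr fun r => ?_
    -- Top sum minus drift is the defect plus the centred sum of increments.
    have := (h2 r).add (h1 r)
    simp only [sum_logMinorIncr, add_zero] at this
    refine this.congr fun k => ?_
    simp only [Pi.smul_apply, Pi.sub_apply, smul_eq_mul]
    ring
  have h4 := (continuous_incr.tendsto 0).comp h3
  have h0 : incr (0 : Fin q → ℝ) = 0 := by simpa using incr_smul 0 (0 : Fin q → ℝ)
  rw [h0] at h4
  refine h4.congr fun k => ?_
  simp only [Function.comp, incr_smul, incr_sub, incr_topSum]

theorem identDistrib_logMinorIncr_zero (hX : ∀ k, Measurable (X k))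
    (νG : Measure (GL (Fin q) 𝔽)) (hνG : IsBiinvariant νG)
    (hlaw : ∀ k, P.map (X k) = νG) (hindep : iIndepFun X P) (r : Fin q) (k : ℕ) :
    IdentDistrib (logMinorIncr X r k) (logMinorIncr X r 0) P P :=
  (identDistrib_logMinorIncr P X hX νG hνG hlaw hindep r k).trans
    (identDistrib_logMinorIncr P X hX νG hνG hlaw hindep r 0).symm

/-- Pairwise independence of the increments is enough for the strong law. The normalization is
written as a power with exponent `1` to match the case of general `ε`. -/
theorem ae_tendsto_inv_mul_sum_logMinorIncr_sub (hX : ∀ k, Measurable (X k))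
    (νG : Measure (GL (Fin q) 𝔽)) (hνG : IsBiinvariant νG)
    (hlaw : ∀ k, P.map (X k) = νG) (hindep : iIndepFun X P) (r : Fin q)
    (hint : Integrable (fun g : GL (Fin q) 𝔽 => logMinor (star g.1) r) νG) :
    ∀ᵐ ω ∂P, Tendsto (fun k : ℕ => ((k : ℝ) ^ (1 : ℝ))⁻¹ *
      (∑ i ∈ Finset.range k, logMinorIncr X r i ω - k * ∫ g, logMinor (star g.1) r ∂νG))
      atTop (𝓝 0) := by
  have hid := identDistrib_logMinorIncr P X hX νG hνG hlaw hindep r 0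
  have hlln := strong_law_ae_real (logMinorIncr X r) (hid.integrable_iff.mpr hint)
    (pairwise_indepFun_of_filtration P (incrFiltration X hX) _ (measurable_logMinorIncr X hX r)
      fun k => (map_eq_and_indep_logMinorIncr P X hX νG hνG hlaw hindep r k).2)
    (identDistrib_logMinorIncr_zero P X hX νG hνG hlaw hindep r)
  filter_upwards [hlln] with ω hω
  rw [hid.integral_eq] at hω
  have := hω.sub_const (∫ g, logMinor (star g.1) r ∂νG)
  rw [sub_self] at this
  refine this.congr' ?_
  filter_upwards [eventually_ne_atTop 0] with k hk
  have : (k : ℝ) ≠ 0 := Nat.cast_ne_zero.mpr hk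
  rw [Real.rpow_one]
  field_simp

theorem ae_tendsto_inv_rpow_mul_sum_logMinorIncr_sub (hX : ∀ k, Measurable (X k))
    (νG : Measure (GL (Fin q) 𝔽)) (hνG : IsBiinvariant νG)
    (hlaw : ∀ k, P.map (X k) = νG) (hindep : iIndepFun X P) (r : Fin q)
    (hL2 : MemLp (fun g : GL (Fin q) 𝔽 => logMinor (star g.1) r) 2 νG) {ε : ℝ} (hε : 1 / 2 < ε) :
    ∀ᵐ ω ∂P, Tendsto (fun k : ℕ => ((k : ℝ) ^ ε)⁻¹ *
      (∑ i ∈ Finset.range k, logMinorIncr X r i ω - k * ∫ g, logMinor (star g.1) r ∂νG))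
      atTop (𝓝 0) := by
  have hid := identDistrib_logMinorIncr P X hX νG hνG hlaw hindep r 0
  rw [← hid.integral_eq]
  exact ae_tendsto_inv_rpow_mul_sum_sub P (incrFiltration X hX) _ (measurable_logMinorIncr X hX r)
    (fun k => (map_eq_and_indep_logMinorIncr P X hX νG hνG hlaw hindep r k).2)
    (identDistrib_logMinorIncr_zero P X hX νG hνG hlaw hindep r) (hid.memLp_iff.mpr hL2) hε

end LimitTheorems

end BiinvariantWalk

end

theorem theorem2p4 {𝔽 : Type*} [NormedDivisionRing 𝔽] [NormedAlgebra ℝ 𝔽] [StarRing 𝔽]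
    [IsRealComplexOrQuaternion 𝔽] {q : ℕ} (hq : 2 ≤ q)
    {Ω : Type*} [MeasurableSpace Ω] (P : Measure Ω) [IsProbabilityMeasure P]
    (νG : Measure (GL (Fin q) 𝔽)) (hνG : IsBiinvariant νG)
    (X : ℕ → Ω → GL (Fin q) 𝔽) (hX : ∀ k, Measurable (X k))
    (hlaw : ∀ k, P.map (X k) = νG) (hindep : iIndepFun X P) :
    (AdmitsFirstMoments (radialPart νG) →
      (∀ j, Integrable (fun t => momentFunction 𝔽 t j) (radialPart νG)) ∧
      ∀ᵐ ω ∂P, Tendsto (fun k : ℕ => (k : ℝ)⁻¹ • logSingularSpectrum (walk X k ω)) atTop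
        (𝓝 (dispersion 𝔽 (radialPart νG)))) ∧
    (AdmitsSecondMoments (radialPart νG) → ∀ ε : ℝ, 1 / 2 < ε →
      ∀ᵐ ω ∂P, Tendsto (fun k : ℕ => ((k : ℝ) ^ ε)⁻¹ •
        (logSingularSpectrum (walk X k ω) - (k : ℝ) • dispersion 𝔽 (radialPart νG))) atTop
        (𝓝 0)) := by
  have : IsProbabilityMeasure νG := hlaw 0 ▸ Measure.isProbabilityMeasure_map (hX 0).aemeasurable
  have : IsProbabilityMeasure (radialPart νG) :=
    Measure.isProbabilityMeasure_map measurable_logSingularSpectrum.aemeasurable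
  have hmean := integral_logMinor_star_eq νG hνG.isLeftUnitaryInvariant
  refine ⟨fun h => ⟨h.integrable_momentFunction, ?_⟩, fun h ε hε => ?_⟩
  · have hint := fun r => memLp_one_iff_integrable.mp
      (memLp_logMinor_star (fun j => memLp_one_iff_integrable.mpr (h j)) r)
    -- The exponent `1` is admissible under first moments alone, because the estimate of the defect
    -- uses no moments of the law.
    have key := ae_tendsto_logSingularSpectrum P X hX νG hνG hlaw hindep (ε := 1) (by norm_num) _
      fun r => hmean h r ▸
        ae_tendsto_inv_mul_sum_logMinorIncr_sub P X hX νG hνG hlaw hindep r (hint r)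
    rw [← h.dispersion_eq] at key
    filter_upwards [key] with ω hω
    have h1 := hω.add_const (dispersion 𝔽 (radialPart νG))
    rw [zero_add] at h1
    refine h1.congr' ?_
    filter_upwards [eventually_ne_atTop 0] with k hk
    have : (k : ℝ) ≠ 0 := Nat.cast_ne_zero.mpr hk
    rw [Real.rpow_one, smul_sub, inv_smul_smul₀ this, sub_add_cancel]
  · have h1 := h.admitsFirstMoments
    have key := ae_tendsto_logSingularSpectrum P X hX νG hνG hlaw hindep hε _
      fun r => hmean h1 r ▸ ae_tendsto_inv_rpow_mul_sum_logMinorIncr_sub P X hX νG hνG hlaw hindep r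
        (memLp_logMinor_star h.memLp r) hε
    rwa [← h1.dispersion_eq] at key
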